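/- Let $\Bbbk$ be a field of characteristic $\neq 2$. A superalgebra is a $\mathbb{Z}/2$-graded $\Bbbk$-algebra $A=A_0\oplus A_1$ with $ab=(-1)^{|a||b|}ba$ for homogeneous $a,b$. Write $I_A=(A_1)$ for the super-ideal generated by $A_1$ and $\operatorname{gr}A=\bigoplus_{n\ge 0}I_A^n/I_A^{n+1}$, a superalgebra by reduction of the degree mod $2$. The affine superscheme $\operatorname{Spec}A$ is the space $\operatorname{Spec}(A_0)$ with the sheaf of superalgebras whose value on $D(x)$ is $A_x$ ($x\in A_0$). A superscheme over $\Bbbk$ is a topological space with a sheaf of superalgebras with local stalks which is locally isomorphic to affine superschemes. Let $X$ be a superscheme with structure sheaf $\mathcal{O}_X$ and underlying space $|X|$. For each non-empty affine open $U\subset|X|$ set $Y_U=\operatorname{Spec}(\operatorname{gr}\mathcal{O}_X(U))$ and $Z_U=\operatorname{Spec}\bigl(\mathcal{O}_X(U)/(\mathcal{O}_X(U)_1)\bigr)$. The spaces $|Y_U|$ and $|Z_U|$ are identified with $\operatorname{Spec}(\mathcal{O}_X(U)_0)$ through the canonical ring maps $A_0\to A/I_A\subset(\operatorname{gr}A)_0$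 and $A_0\to A/I_A$ (where $A=\mathcal{O}_X(U)$), and hence with $U$, a point $x\in U$ corresponding to the prime of those $f\in\mathcal{O}_X(U)_0$ whose germ at $x$ is not a unit. (1) The affine superschemes $Y_U$ are uniquely glued into a superscheme with underlying topological space $|X|$. That is, there are a superscheme $\operatorname{gr}X$ with underlying space $|X|$ and, for every non-empty affine open $U$, an open immersion $j_U:Y_U\to\operatorname{gr}X$ with image $U$ that induces the above identification of $|Y_U|$ with $U$, such that for non-empty affine opens $V\subset U$ the morphism $Y_V\to Y_U$ induced by $\operatorname{gr}$ of the restriction map $\mathcal{O}_X(U)\to\mathcal{O}_X(V)$, followed by $j_U$, is $j_V$. For any two such data $(Y,(j_U))$ and $(Y',(j'_U))$ there is exactly one isomorphism $h:Y\to Y'$ that is the identity on $|X|$ and satisfies $h\circ j_U=j'_U$ for all $U$. (2) In the same sense, the affine $\Bbbk$-schemes $Z_U$ are uniquely glued, along the morphisms induced by the restriction maps of $\mathcal{O}_X$, into a $\Bbbk$-scheme with underlying topological space $|X|$, the scheme associated with $X$. -/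

import Mathlib

open CategoryTheory Opposite TopologicalSpace AlgebraicGeometry

universe u

noncomputable section

/-- A (super-commutative) superalgebra over `k`: a `k`-algebra `A` with a `ℤ/2`-grading
`A = A₀ ⊕ A₁` such that `a b = (-1)^(|a| |b|) b a` for homogeneous `a`, `b`. -/
structure SAlg (k : Type u) [Field k] : Type (u + 1) where
  carrier : Type u
  [ring : Ring carrier]
  [algebra : Algebra k carrier]
  grading : ZMod 2 → Submodule k carrier
  [graded : SetLike.GradedMonoid grading]
  isCompl : IsCompl (grading 0) (grading 1)
  supercomm : ∀ (i j : ZMod 2) (a b : carrier), a ∈ grading i → b ∈ grading j →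
    a * b = (-1) ^ (i.val * j.val) * (b * a)

namespace SAlg

variable {k : Type u} [Field k]

instance : CoeSort (SAlg k) (Type u) := ⟨SAlg.carrier⟩

attribute [instance] SAlg.ring SAlg.algebra SAlg.graded

/-- A morphism of superalgebras: a `k`-algebra map that preserves the grading. -/
structure Hom (A B : SAlg k) where
  toAlgHom : A →ₐ[k] B
  map_mem : ∀ (i : ZMod 2) (a : A), a ∈ A.grading i → toAlgHom a ∈ B.grading i

theorem Hom.ext {A B : SAlg k} {f g : Hom A B} (h : f.toAlgHom = g.toAlgHom) : f = g := by
  cases f; cases g; cases h; rfl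

instance : Category (SAlg k) where
  Hom := Hom
  id A := ⟨AlgHom.id k A, fun _ _ h => h⟩
  comp f g := ⟨g.toAlgHom.comp f.toAlgHom, fun i a h => g.map_mem i _ (f.map_mem i a h)⟩

@[simp] theorem id_toAlgHom (A : SAlg k) : Hom.toAlgHom (𝟙 A) = AlgHom.id k A := rfl

@[simp] theorem comp_toAlgHom {A B C : SAlg k} (f : A ⟶ B) (g : B ⟶ C) :
    Hom.toAlgHom (f ≫ g) = (Hom.toAlgHom g).comp (Hom.toAlgHom f) := rfl

/-- The underlying set of a superalgebra. -/
def toType (k : Type u) [Field k] : SAlg k ⥤ Type u where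
  obj A := A
  map f := ↾(Hom.toAlgHom f)

theorem even_comm {A : SAlg k} {a : A} (ha : a ∈ A.grading 0) {i : ZMod 2} {b : A}
    (hb : b ∈ A.grading i) : a * b = b * a := by
  simpa using A.supercomm 0 i a b ha hb

theorem exists_add (A : SAlg k) (a : A) : ∃ b ∈ A.grading 0, ∃ c ∈ A.grading 1, b + c = a := by
  have : a ∈ A.grading 0 ⊔ A.grading 1 := by rw [A.isCompl.sup_eq_top]; trivial
  exact Submodule.mem_sup.1 this

theorem even_central {A : SAlg k} {a : A} (ha : a ∈ A.grading 0) (b : A) : a * b = b * a := by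
  obtain ⟨x, hx, y, hy, rfl⟩ := A.exists_add b
  rw [mul_add, add_mul, even_comm ha hx, even_comm ha hy]

/-- The even part `A₀`, a commutative `k`-algebra that is central in `A`. -/
def even (A : SAlg k) : Subalgebra k A := SetLike.GradeZero.subalgebra A.grading

instance (A : SAlg k) : CommRing A.even where
  mul_comm a b := Subtype.ext (even_central a.2 b.1)

instance (A : SAlg k) : Algebra A.even A where
  algebraMap := A.even.val.toRingHom
  commutes' a b := even_central a.2 b
  smul_def' _ _ := rfl

instance (A : SAlg k) : IsScalarTower k A.even A := ⟨fun c a b => smul_mul_assoc c (a : A) b⟩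

/-- The map `A₀ → B₀` induced by a superalgebra map. -/
def evenMap {A B : SAlg k} (f : A ⟶ B) : A.even →+* B.even where
  toFun a := ⟨Hom.toAlgHom f a, Hom.map_mem f 0 _ a.2⟩
  map_one' := Subtype.ext (map_one (Hom.toAlgHom f))
  map_mul' a b := Subtype.ext (map_mul (Hom.toAlgHom f) a.1 b.1)
  map_zero' := Subtype.ext (map_zero (Hom.toAlgHom f))
  map_add' a b := Subtype.ext (map_add (Hom.toAlgHom f) a.1 b.1)

/-- The functor `A ↦ A₀` to commutative rings. -/
def evenFunctor (k : Type u) [Field k] : SAlg k ⥤ CommRingCat.{u} where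
  obj A := CommRingCat.of A.even
  map f := CommRingCat.ofHom (evenMap f)

/-- The super-ideal `I_A = (A₁)` generated by the odd component; by super-commutativity the left
ideal generated by `A₁` is two-sided. -/
def oddIdeal (A : SAlg k) : Ideal A := Ideal.span (A.grading 1)

theorem odd_comm {A : SAlg k} {a b : A} (ha : a ∈ A.grading 1)
    (hb : b ∈ A.grading 1) : a * b = - (b * a) := by
  simpa [show (1 : ZMod 2).val = 1 from rfl] using A.supercomm 1 1 a b ha hb

instance (A : SAlg k) : A.oddIdeal.IsTwoSided := by
  constructor
  intro a b ha
  unfold oddIdeal at ha ⊢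
  induction ha using Submodule.span_induction with
  | mem x hx =>
    obtain ⟨c, hc, d, hd, rfl⟩ := A.exists_add b
    rw [mul_add, ← even_comm hc hx, odd_comm hx hd]
    exact add_mem (Ideal.mul_mem_left _ _ (Ideal.subset_span hx))
      (neg_mem (Ideal.mul_mem_left _ _ (Ideal.subset_span hx)))
  | zero => simp
  | add x y _ _ hx hy => rw [add_mul]; exact add_mem hx hy
  | smul r x _ hx => rw [smul_eq_mul, mul_assoc]; exact Ideal.mul_mem_left _ _ hx

theorem oddIdeal_map {A B : SAlg k} (f : A ⟶ B) {a : A} (ha : a ∈ A.oddIdeal) :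
    Hom.toAlgHom f a ∈ B.oddIdeal := by
  unfold oddIdeal at ha ⊢
  induction ha using Submodule.span_induction with
  | mem x hx => exact Ideal.subset_span (Hom.map_mem f 1 _ hx)
  | zero => simp
  | add x y _ _ hx hy => rw [map_add]; exact add_mem hx hy
  | smul r x _ hx => rw [smul_eq_mul, map_mul]; exact Ideal.mul_mem_left _ _ hx

/-- The associated commutative algebra `A / (A₁)`. -/
abbrev Assoc (A : SAlg k) : Type u := A ⧸ A.oddIdeal

instance (A : SAlg k) : CommRing A.Assoc where
  mul_comm a b := by
    obtain ⟨a, rfl⟩ := Ideal.Quotient.mk_surjective a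
    obtain ⟨b, rfl⟩ := Ideal.Quotient.mk_surjective b
    obtain ⟨c, hc, d, hd, rfl⟩ := A.exists_add a
    have : Ideal.Quotient.mk A.oddIdeal d = 0 :=
      Ideal.Quotient.eq_zero_iff_mem.2 (Ideal.subset_span hd)
    rw [map_add, this, add_zero, ← map_mul, ← map_mul, even_central hc]

/-- The canonical map `A₀ → A / (A₁)`. -/
def evenToAssoc (A : SAlg k) : A.even →+* A.Assoc :=
  (Ideal.Quotient.mk A.oddIdeal).comp A.even.val.toRingHom

/-- The map `A / (A₁) → B / (B₁)` induced by a superalgebra map. -/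
def assocMap {A B : SAlg k} (f : A ⟶ B) : A.Assoc →+* B.Assoc :=
  Ideal.Quotient.lift A.oddIdeal ((Ideal.Quotient.mk B.oddIdeal).comp (Hom.toAlgHom f).toRingHom)
    fun _ ha => Ideal.Quotient.eq_zero_iff_mem.2 (oddIdeal_map f ha)

/-- The power `I_A ^ n`, as a `k`-submodule of `A`. -/
def filt (A : SAlg k) (n : ℕ) : Submodule k A := (A.oddIdeal ^ n).restrictScalars k

theorem mul_mem_filt {A : SAlg k} {m n : ℕ} {a b : A} (ha : a ∈ A.filt m) (hb : b ∈ A.filt n) :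
    a * b ∈ A.filt (m + n) := by
  change a * b ∈ A.oddIdeal ^ (m + n)
  rw [Ideal.IsTwoSided.pow_add]
  exact Ideal.mul_mem_mul ha hb

theorem filt_anti (A : SAlg k) {m n : ℕ} (h : m ≤ n) : A.filt n ≤ A.filt m :=
  fun _ ha => Ideal.pow_le_pow_right h ha

theorem mem_filt_zero {A : SAlg k} (a : A) : a ∈ A.filt 0 := by
  change a ∈ A.oddIdeal ^ 0
  rw [Submodule.pow_zero, Ideal.one_eq_top]; trivial

theorem filt_map {A B : SAlg k} (f : A ⟶ B) {n : ℕ} {a : A} (ha : a ∈ A.filt n) :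
    Hom.toAlgHom f a ∈ B.filt n := by
  induction n generalizing a with
  | zero => exact mem_filt_zero _
  | succ n ih =>
    change a ∈ A.oddIdeal ^ (n + 1) at ha
    rw [Ideal.IsTwoSided.pow_succ] at ha
    refine Submodule.mul_induction_on ha ?_ ?_
    · intro x hx y hy
      rw [map_mul, add_comm]
      refine mul_mem_filt (m := 1) ?_ (ih hy)
      change _ ∈ B.oddIdeal ^ 1
      rw [Submodule.pow_one]
      exact oddIdeal_map f hx
    · intro x y hx hy
      rw [map_add]; exact add_mem hx hy

/-- The homogeneous piece `I_A ^ n / I_A ^ (n + 1)`. -/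
def GrPiece (A : SAlg k) (n : ℕ) : Type u :=
  A.filt n ⧸ (A.filt (n + 1)).submoduleOf (A.filt n)

instance (A : SAlg k) (n : ℕ) : AddCommGroup (A.GrPiece n) :=
  inferInstanceAs (AddCommGroup (A.filt n ⧸ (A.filt (n + 1)).submoduleOf (A.filt n)))

instance (A : SAlg k) (n : ℕ) : Module k (A.GrPiece n) :=
  inferInstanceAs (Module k (A.filt n ⧸ (A.filt (n + 1)).submoduleOf (A.filt n)))

/-- The quotient map `I_A ^ n → I_A ^ n / I_A ^ (n + 1)`. -/
def symb (A : SAlg k) (n : ℕ) : A.filt n →ₗ[k] A.GrPiece n :=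
  Submodule.mkQ ((A.filt (n + 1)).submoduleOf (A.filt n))

theorem symb_surjective (A : SAlg k) (n : ℕ) : Function.Surjective (A.symb n) :=
  Submodule.mkQ_surjective _

theorem symb_eq_zero {A : SAlg k} {n : ℕ} {a : A.filt n} (h : (a : A) ∈ A.filt (n + 1)) :
    A.symb n a = 0 := (Submodule.Quotient.mk_eq_zero _).2 h

/-- Multiplication `I_A ^ m × I_A ^ n → I_A ^ (m + n)`. -/
def filtMul (A : SAlg k) (m n : ℕ) : A.filt m →ₗ[k] A.filt n →ₗ[k] A.filt (m + n) :=
  LinearMap.mk₂ k (fun a b => ⟨a.1 * b.1, mul_mem_filt a.2 b.2⟩)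
    (fun _ _ _ => Subtype.ext (add_mul _ _ _)) (fun _ _ _ => Subtype.ext (smul_mul_assoc _ _ _))
    (fun _ _ _ => Subtype.ext (mul_add _ _ _)) (fun _ _ _ => Subtype.ext (mul_smul_comm _ _ _))

/-- Multiplication `(I_A ^ m / I_A ^ (m + 1)) × (I_A ^ n / I_A ^ (n + 1)) →
I_A ^ (m + n) / I_A ^ (m + n + 1)`, induced by the multiplication of `A`. -/
def grMul (A : SAlg k) (m n : ℕ) : A.GrPiece m →ₗ[k] A.GrPiece n →ₗ[k] A.GrPiece (m + n) :=
  Submodule.liftQ ((A.filt (m + 1)).submoduleOf (A.filt m))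
    (LinearMap.flip <| Submodule.liftQ ((A.filt (n + 1)).submoduleOf (A.filt n)) ((A.filtMul m n).compr₂ (A.symb (m + n))).flip <| by
      intro b hb
      refine LinearMap.ext fun a => symb_eq_zero ?_
      exact mul_mem_filt (n := n + 1) a.2 hb) <| by
    intro a ha
    refine LinearMap.ext fun b => ?_
    obtain ⟨b, rfl⟩ := A.symb_surjective n b
    refine symb_eq_zero ?_
    rw [add_right_comm]
    exact mul_mem_filt (m := m + 1) ha b.2

theorem grMul_symb (A : SAlg k) {m n : ℕ} (a : A.filt m) (b : A.filt n) :
    A.grMul m n (A.symb m a) (A.symb n b) = A.symb (m + n) (A.filtMul m n a b) := rfl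

theorem mk_symb_eq {A : SAlg k} {m n : ℕ} (h : m = n) (a : A.filt m) (b : A.filt n)
    (hab : (a : A) = b) :
    GradedMonoid.mk (A := A.GrPiece) m (A.symb m a) = GradedMonoid.mk n (A.symb n b) := by
  subst h; rw [Subtype.ext hab]

instance (A : SAlg k) : GradedMonoid.GMul A.GrPiece where
  mul a b := A.grMul _ _ a b

instance (A : SAlg k) : GradedMonoid.GOne A.GrPiece where
  one := A.symb 0 ⟨1, mem_filt_zero _⟩

instance (A : SAlg k) : DirectSum.GRing A.GrPiece where
  one_mul := by
    rintro ⟨n, a⟩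
    obtain ⟨a, rfl⟩ := A.symb_surjective n a
    exact mk_symb_eq (zero_add n) _ _ (one_mul _)
  mul_one := by
    rintro ⟨n, a⟩
    obtain ⟨a, rfl⟩ := A.symb_surjective n a
    exact mk_symb_eq (add_zero n) _ _ (mul_one _)
  mul_assoc := by
    rintro ⟨m, a⟩ ⟨n, b⟩ ⟨l, c⟩
    obtain ⟨a, rfl⟩ := A.symb_surjective m a
    obtain ⟨b, rfl⟩ := A.symb_surjective n b
    obtain ⟨c, rfl⟩ := A.symb_surjective l c
    exact mk_symb_eq (add_assoc m n l) _ _ (mul_assoc _ _ _)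
  mul_zero a := map_zero (A.grMul _ _ a)
  zero_mul b := LinearMap.map_zero₂ (A.grMul _ _) b
  mul_add a b c := map_add (A.grMul _ _ a) b c
  add_mul a b c := LinearMap.map_add₂ (A.grMul _ _) a b c
  natCast n := n • A.symb 0 ⟨1, mem_filt_zero _⟩
  natCast_zero := zero_smul ℕ _
  natCast_succ n := succ_nsmul _ n
  intCast n := n • A.symb 0 ⟨1, mem_filt_zero _⟩
  intCast_ofNat n := natCast_zsmul _ n
  intCast_negSucc_ofNat n := negSucc_zsmul _ n

instance (A : SAlg k) : DirectSum.GAlgebra k A.GrPiece where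
  toFun := (LinearMap.toSpanSingleton k (A.GrPiece 0)
    (A.symb 0 ⟨1, mem_filt_zero _⟩)).toAddMonoidHom
  map_one := one_smul k (A.symb 0 ⟨1, mem_filt_zero _⟩)
  map_mul r s := by
    refine mk_symb_eq (a := (r * s) • ⟨1, mem_filt_zero _⟩)
      (b := A.filtMul 0 0 (r • ⟨1, mem_filt_zero _⟩) (s • ⟨1, mem_filt_zero _⟩)) (add_zero 0).symm ?_
    change (r * s) • (1 : A) = (r • 1) * (s • 1)
    rw [smul_mul_smul_comm, one_mul]
  commutes r := by
    rintro ⟨n, a⟩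
    obtain ⟨a, rfl⟩ := A.symb_surjective n a
    refine mk_symb_eq (a := A.filtMul 0 n (r • ⟨1, mem_filt_zero _⟩) a)
      (b := A.filtMul n 0 a (r • ⟨1, mem_filt_zero _⟩)) (add_comm 0 n) ?_
    change (r • (1 : A)) * a = a * (r • 1)
    simp
  smul_def r := by
    rintro ⟨n, a⟩
    obtain ⟨a, rfl⟩ := A.symb_surjective n a
    refine mk_symb_eq (a := r • a)
      (b := A.filtMul 0 n (r • ⟨1, mem_filt_zero _⟩) a) (zero_add n).symm ?_
    change r • (a : A) = (r • (1 : A)) * a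
    simp

/-- The algebra `⨁ n, I_A ^ n / I_A ^ (n + 1)`. -/
abbrev Gr (A : SAlg k) : Type u := DirectSum ℕ A.GrPiece

instance (A : SAlg k) : Ring A.Gr := inferInstance
instance (A : SAlg k) : Algebra k A.Gr := inferInstance

/-- The `ℤ/2`-grading of `⨁ n, I_A ^ n / I_A ^ (n + 1)` by reduction mod `2` of the degree. -/
def grGrading (A : SAlg k) (i : ZMod 2) : Submodule k A.Gr where
  carrier := {x | ∀ n : ℕ, (n : ZMod 2) ≠ i → x n = 0}
  zero_mem' _ _ := rfl
  add_mem' hx hy n hn := by rw [DirectSum.add_apply, hx n hn, hy n hn, add_zero]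
  smul_mem' c x hx n hn := by rw [DirectSum.smul_apply, hx n hn, smul_zero]


theorem gr_induction {A : SAlg k} {i : ZMod 2} {p : A.Gr → Prop} (h0 : p 0)
    (hadd : ∀ x y, p x → p y → p (x + y))
    (hof : ∀ (n : ℕ) (a : A.filt n), (n : ZMod 2) = i → p (DirectSum.of A.GrPiece n (A.symb n a)))
    {x : A.Gr} (hx : x ∈ A.grGrading i) : p x := by
  classical
  rw [← DirectSum.sum_support_of x]
  refine Finset.sum_induction _ p hadd h0 fun n hn => ?_
  obtain ⟨a, ha⟩ := A.symb_surjective n (x n)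
  rw [← ha]
  refine hof n a ?_
  by_contra hne
  exact (DFinsupp.mem_support_iff.1 hn) (hx n hne)

theorem of_mem_grGrading {A : SAlg k} {n : ℕ} {i : ZMod 2} (h : (n : ZMod 2) = i)
    (a : A.GrPiece n) : DirectSum.of A.GrPiece n a ∈ A.grGrading i := by
  intro m hm
  refine DirectSum.of_eq_of_ne _ _ _ ?_
  rintro rfl
  exact hm h

theorem of_symb_mul_of_symb {A : SAlg k} {m n : ℕ} (a : A.filt m) (b : A.filt n) :
    DirectSum.of A.GrPiece m (A.symb m a) * DirectSum.of A.GrPiece n (A.symb n b) =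
      DirectSum.of A.GrPiece (m + n) (A.symb (m + n) (A.filtMul m n a b)) :=
  DirectSum.of_mul_of _ _

instance (A : SAlg k) : SetLike.GradedMonoid A.grGrading where
  one_mem := of_mem_grGrading (A := A) (n := 0) Nat.cast_zero _
  mul_mem i j x y hx hy := by
    refine gr_induction (p := fun x => x * y ∈ A.grGrading (i + j)) ?_ ?_ ?_ hx
    · rw [zero_mul]; exact zero_mem _
    · intro x x' h h'; rw [add_mul]; exact add_mem h h'
    intro m a hm
    refine gr_induction (p := fun y => DirectSum.of A.GrPiece m (A.symb m a) * y ∈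
      A.grGrading (i + j)) ?_ ?_ ?_ hy
    · rw [mul_zero]; exact zero_mem _
    · intro x x' h h'; rw [mul_add]; exact add_mem h h'
    intro n b hn
    rw [of_symb_mul_of_symb]
    exact of_mem_grGrading (by rw [Nat.cast_add, hm, hn]) _

theorem isCompl_grGrading (A : SAlg k) : IsCompl (A.grGrading 0) (A.grGrading 1) := by
  constructor
  · rw [Submodule.disjoint_def]
    intro x h0 h1
    refine DFinsupp.ext fun n => ?_
    by_cases h : (n : ZMod 2) = 0
    · exact h1 n (by rw [h]; decide)
    · exact h0 n h
  · rw [codisjoint_iff, Submodule.eq_top_iff']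
    intro x
    induction x using DirectSum.induction_on with
    | zero => exact zero_mem _
    | add x y hx hy => exact add_mem hx hy
    | of n a =>
      have : ∀ i : ZMod 2, i = 0 ∨ i = 1 := by decide
      rcases this n with h | h
      · exact Submodule.mem_sup_left (of_mem_grGrading h a)
      · exact Submodule.mem_sup_right (of_mem_grGrading h a)

theorem odd_mem_filt_one {A : SAlg k} {a : A} (ha : a ∈ A.grading 1) : a ∈ A.filt 1 := by
  change a ∈ A.oddIdeal ^ 1
  rw [Submodule.pow_one]
  exact Ideal.subset_span ha

theorem exists_parity {A : SAlg k} {n : ℕ} {a : A} (ha : a ∈ A.filt n) :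
    ∃ b ∈ A.filt n, b ∈ A.grading n ∧ a - b ∈ A.filt (n + 1) := by
  induction n generalizing a with
  | zero =>
    obtain ⟨c, hc, d, hd, rfl⟩ := A.exists_add a
    exact ⟨c, mem_filt_zero _, by simpa using hc, by simpa using odd_mem_filt_one hd⟩
  | succ n ih =>
    have key1 : ∀ x ∈ A.oddIdeal, ∃ o ∈ A.grading 1, x - o ∈ A.filt 2 := by
      intro x hx
      unfold oddIdeal at hx
      induction hx using Submodule.span_induction with
      | mem x hx => exact ⟨x, hx, by simp⟩
      | zero => exact ⟨0, zero_mem _, by simp⟩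
      | add x y _ _ hx hy =>
        obtain ⟨o, ho, h⟩ := hx
        obtain ⟨o', ho', h'⟩ := hy
        refine ⟨o + o', add_mem ho ho', ?_⟩
        rw [add_sub_add_comm]; exact add_mem h h'
      | smul r x _ hx =>
        obtain ⟨o, ho, h⟩ := hx
        obtain ⟨c, hc, d, hd, rfl⟩ := A.exists_add r
        refine ⟨c * o, by simpa using SetLike.mul_mem_graded hc ho, ?_⟩
        have e : (c + d) • x - c * o = (c + d) * (x - o) + d * o := by
          rw [smul_eq_mul]; noncomm_ring
        rw [e]
        refine add_mem ?_ (mul_mem_filt (odd_mem_filt_one hd) (odd_mem_filt_one ho))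
        simpa using mul_mem_filt (mem_filt_zero (c + d)) h
    change a ∈ A.oddIdeal ^ (n + 1) at ha
    rw [Ideal.IsTwoSided.pow_succ] at ha
    refine Submodule.mul_induction_on ha ?_ ?_
    · intro x hx y hy
      obtain ⟨o, ho, h⟩ := key1 x hx
      obtain ⟨c, hc, hc', h'⟩ := ih (show y ∈ A.filt n from hy)
      have ho1 := odd_mem_filt_one ho
      refine ⟨o * c, ?_, ?_, ?_⟩
      · have := mul_mem_filt ho1 hc
        rwa [add_comm] at this
      · have := SetLike.mul_mem_graded ho hc'
        rwa [add_comm, ← Nat.cast_succ] at this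
      · have e : x * y - o * c = (x - o) * y + o * (y - c) := by noncomm_ring
        rw [e]
        refine add_mem ?_ ?_
        · have := mul_mem_filt h (show y ∈ A.filt n from hy)
          rwa [show 2 + n = n + 1 + 1 by ring] at this
        · have := mul_mem_filt ho1 h'
          rwa [show 1 + (n + 1) = n + 1 + 1 by ring] at this
    · rintro x y ⟨c, h1, h2, h3⟩ ⟨c', h1', h2', h3'⟩
      refine ⟨c + c', add_mem h1 h1', add_mem h2 h2', ?_⟩
      rw [add_sub_add_comm]; exact add_mem h3 h3'

theorem symb_exists_parity {A : SAlg k} {n : ℕ} (a : A.filt n) :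
    ∃ b : A.filt n, (b : A) ∈ A.grading n ∧ A.symb n a = A.symb n b := by
  obtain ⟨b, hb, hb', h⟩ := exists_parity a.2
  refine ⟨⟨b, hb⟩, hb', ?_⟩
  rw [← sub_eq_zero, ← map_sub]
  exact symb_eq_zero h

theorem gr_supercomm (A : SAlg k) (i j : ZMod 2) (x y : A.Gr) (hx : x ∈ A.grGrading i)
    (hy : y ∈ A.grGrading j) : x * y = (-1) ^ (i.val * j.val) * (y * x) := by
  refine gr_induction (p := fun x => x * y = (-1) ^ (i.val * j.val) * (y * x)) ?_ ?_ ?_ hx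
  · simp
  · intro x x' h h'; rw [add_mul, h, h', mul_add y, mul_add]
  intro m a hm
  refine gr_induction (p := fun y => DirectSum.of A.GrPiece m (A.symb m a) * y =
    (-1) ^ (i.val * j.val) * (y * DirectSum.of A.GrPiece m (A.symb m a))) ?_ ?_ ?_ hy
  · simp
  · intro x x' h h'; rw [mul_add, h, h', add_mul, mul_add]
  intro n b hn
  obtain ⟨a', ha', ha⟩ := symb_exists_parity a
  obtain ⟨b', hb', hb⟩ := symb_exists_parity b
  rw [ha, hb, of_symb_mul_of_symb, of_symb_mul_of_symb]
  rw [hm] at ha'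
  rw [hn] at hb'
  have key := A.supercomm i j a' b' ha' hb'
  rcases Nat.even_or_odd (i.val * j.val) with h | h
  · rw [h.neg_one_pow, one_mul] at key ⊢
    exact DirectSum.of_eq_of_gradedMonoid_eq (mk_symb_eq (add_comm m n) _ _ key)
  · rw [h.neg_one_pow, neg_one_mul] at key ⊢
    rw [← map_neg, ← map_neg]
    exact DirectSum.of_eq_of_gradedMonoid_eq (mk_symb_eq (add_comm m n) _
      (-A.filtMul n m b' a') key)

/-- The graded superalgebra `gr A = ⨁ n, I_A ^ n / I_A ^ (n + 1)` associated with `A`. -/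
def gr (A : SAlg k) : SAlg k where
  carrier := A.Gr
  grading := A.grGrading
  isCompl := A.isCompl_grGrading
  supercomm := A.gr_supercomm

/-- The map `I_A ^ n → I_B ^ n` induced by a superalgebra map `A → B`. -/
def filtMap {A B : SAlg k} (f : A ⟶ B) (n : ℕ) : A.filt n →ₗ[k] B.filt n :=
  (Hom.toAlgHom f).toLinearMap.restrict fun _ ha => filt_map f ha

/-- The map `I_A ^ n / I_A ^ (n + 1) → I_B ^ n / I_B ^ (n + 1)` induced by `A → B`. -/
def grPieceMap {A B : SAlg k} (f : A ⟶ B) (n : ℕ) : A.GrPiece n →ₗ[k] B.GrPiece n :=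
  Submodule.mapQ ((A.filt (n + 1)).submoduleOf (A.filt n))
    ((B.filt (n + 1)).submoduleOf (B.filt n)) (filtMap f n) fun _ ha => filt_map f ha

theorem grPieceMap_symb {A B : SAlg k} (f : A ⟶ B) {n : ℕ} (a : A.filt n) :
    grPieceMap f n (A.symb n a) = B.symb n (filtMap f n a) := rfl

/-- The algebra map `⨁ n, I_A ^ n / I_A ^ (n + 1) → ⨁ n, I_B ^ n / I_B ^ (n + 1)`. -/
def grAlgHom {A B : SAlg k} (f : A ⟶ B) : A.Gr →ₐ[k] B.Gr :=
  DirectSum.toAlgebra k A.GrPiece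
    (fun n => (DirectSum.lof k ℕ B.GrPiece n).comp (grPieceMap f n))
    (congrArg (fun b => DirectSum.of B.GrPiece 0 (B.symb 0 b))
      (Subtype.ext (map_one (Hom.toAlgHom f))))
    (by
      intro m n a b
      obtain ⟨a, rfl⟩ := A.symb_surjective m a
      obtain ⟨b, rfl⟩ := A.symb_surjective n b
      refine Eq.trans ?_ (of_symb_mul_of_symb (filtMap f m a) (filtMap f n b)).symm
      exact congrArg (fun b => DirectSum.of B.GrPiece (m + n) (B.symb (m + n) b))
        (Subtype.ext (map_mul (Hom.toAlgHom f) a.1 b.1)))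

theorem grAlgHom_of {A B : SAlg k} (f : A ⟶ B) {n : ℕ} (a : A.GrPiece n) :
    grAlgHom f (DirectSum.of A.GrPiece n a) = DirectSum.of B.GrPiece n (grPieceMap f n a) :=
  DirectSum.toAddMonoid_of _ _ _

/-- The superalgebra map `gr A → gr B` induced by `A → B`. -/
def grMap {A B : SAlg k} (f : A ⟶ B) : A.gr ⟶ B.gr where
  toAlgHom := grAlgHom f
  map_mem i x hx := by
    refine gr_induction (A := A) (i := i) (p := fun x => grAlgHom f x ∈ B.grGrading i) ?_ ?_ ?_ hx
    · rw [map_zero]; exact zero_mem _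
    · intro x y h h'; rw [map_add]; exact add_mem h h'
    · intro n a hn
      rw [grAlgHom_of]
      exact of_mem_grGrading hn _

/-- The ring map `A₀ → (gr A)₀` sending `a` to its class in degree zero, that is, the composite
`A₀ → A / I_A ⊆ (gr A)₀`. It induces the natural identification of `Spec (gr A)₀` with
`Spec A₀`, both being identified with `Spec (A / I_A)`. -/
def evenToGr (A : SAlg k) : A.even →+* A.gr.even where
  toFun a := ⟨DirectSum.of A.GrPiece 0 (A.symb 0 ⟨a, mem_filt_zero _⟩),
    of_mem_grGrading Nat.cast_zero _⟩
  map_one' := rfl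
  map_mul' a b := Subtype.ext (of_symb_mul_of_symb (A := A) ⟨a, mem_filt_zero _⟩
    ⟨b, mem_filt_zero _⟩).symm
  map_zero' := Subtype.ext (map_zero (DirectSum.of A.GrPiece 0))
  map_add' a b := Subtype.ext (map_add (DirectSum.of A.GrPiece 0)
    (A.symb 0 ⟨a, mem_filt_zero _⟩) (A.symb 0 ⟨b, mem_filt_zero _⟩))



/-- The localization `A_P` of `A` at a prime `P` of `A₀`. -/
def Loc (A : SAlg k) (x : PrimeSpectrum A.even) : Type u :=
  LocalizedModule x.asIdeal.primeCompl A

instance (A : SAlg k) (x : PrimeSpectrum A.even) : Ring (A.Loc x) :=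
  inferInstanceAs (Ring (LocalizedModule x.asIdeal.primeCompl A))

instance (A : SAlg k) (x : PrimeSpectrum A.even) : Algebra A.even (A.Loc x) :=
  inferInstanceAs (Algebra A.even (LocalizedModule x.asIdeal.primeCompl A))

instance (A : SAlg k) (x : PrimeSpectrum A.even) : Algebra k (A.Loc x) :=
  Algebra.compHom (A.Loc x) (algebraMap k A.even)

/-- The fraction `a / s` in `A_P`. -/
def frac {A : SAlg k} (x : PrimeSpectrum A.even) (a : A) (s : x.asIdeal.primeCompl) : A.Loc x :=
  LocalizedModule.mk a s

theorem frac_eq {A : SAlg k} {x : PrimeSpectrum A.even} {a b : A} {s t : x.asIdeal.primeCompl} :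
    frac x a s = frac x b t ↔
      ∃ u : x.asIdeal.primeCompl, (u : A) * ((t : A) * a) = (u : A) * ((s : A) * b) :=
  LocalizedModule.mk_eq

theorem frac_add {A : SAlg k} {x : PrimeSpectrum A.even} (a b : A) (s t : x.asIdeal.primeCompl) :
    frac x a s + frac x b t = frac x ((t : A) * a + (s : A) * b) (s * t) :=
  LocalizedModule.mk_add_mk

theorem frac_add' {A : SAlg k} {x : PrimeSpectrum A.even} (a b : A) (s : x.asIdeal.primeCompl) :
    frac x a s + frac x b s = frac x (a + b) s := by
  rw [frac_add, frac_eq]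
  refine ⟨1, ?_⟩
  change 1 * ((s : A) * _) = 1 * ((s : A) * (s : A) * _)
  simp only [one_mul, mul_add, mul_assoc]

theorem frac_mul {A : SAlg k} {x : PrimeSpectrum A.even} (a b : A) (s t : x.asIdeal.primeCompl) :
    frac x a s * frac x b t = frac x (a * b) (s * t) :=
  LocalizedModule.mk_mul_mk

theorem frac_zero {A : SAlg k} {x : PrimeSpectrum A.even} (s : x.asIdeal.primeCompl) :
    frac x (0 : A) s = 0 :=
  OreLocalization.zero_oreDiv s

theorem frac_one {A : SAlg k} {x : PrimeSpectrum A.even} :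
    frac x (1 : A) 1 = 1 :=
  OreLocalization.one_def.symm

theorem algebraMap_eq_frac {A : SAlg k} (x : PrimeSpectrum A.even) (c : k) :
    algebraMap k (A.Loc x) c = frac x (algebraMap k A c) 1 := rfl

theorem smul_frac {A : SAlg k} {x : PrimeSpectrum A.even} (c : k) (a : A)
    (s : x.asIdeal.primeCompl) : c • frac x a s = frac x (c • a) s := by
  rw [Algebra.smul_def, algebraMap_eq_frac, frac_mul, one_mul, Algebra.smul_def]

theorem frac_surjective {A : SAlg k} {x : PrimeSpectrum A.even} (z : A.Loc x) :
    ∃ a s, frac x a s = z := by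
  induction z using LocalizedModule.induction_on with | h a s => exact ⟨a, s, rfl⟩

/-- The grading of `A_P`: fractions with homogeneous numerator. -/
def locGrading (A : SAlg k) (x : PrimeSpectrum A.even) (i : ZMod 2) : Submodule k (A.Loc x) where
  carrier := {z | ∃ a ∈ A.grading i, ∃ s, frac x a s = z}
  zero_mem' := ⟨0, zero_mem _, 1, frac_zero _⟩
  add_mem' := by
    rintro _ _ ⟨a, ha, s, rfl⟩ ⟨b, hb, t, rfl⟩
    refine ⟨_, ?_, _, (frac_add a b s t).symm⟩
    refine add_mem ?_ ?_
    · simpa using SetLike.mul_mem_graded t.1.2 ha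
    · simpa using SetLike.mul_mem_graded s.1.2 hb
  smul_mem' := by
    rintro c _ ⟨a, ha, s, rfl⟩
    exact ⟨c • a, Submodule.smul_mem _ c ha, s, (smul_frac c a s).symm⟩

instance (A : SAlg k) (x : PrimeSpectrum A.even) : SetLike.GradedMonoid (A.locGrading x) where
  one_mem := ⟨1, SetLike.one_mem_graded _, 1, frac_one⟩
  mul_mem := by
    rintro i j _ _ ⟨a, ha, s, rfl⟩ ⟨b, hb, t, rfl⟩
    exact ⟨a * b, SetLike.mul_mem_graded ha hb, s * t, (frac_mul a b s t).symm⟩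

theorem disjoint_locGrading (A : SAlg k) (x : PrimeSpectrum A.even) :
    Disjoint (A.locGrading x 0) (A.locGrading x 1) := by
  rw [Submodule.disjoint_def]
  rintro _ ⟨a, ha, s, rfl⟩ ⟨b, hb, t, h⟩
  obtain ⟨u, hu⟩ := frac_eq.1 h
  have h1 : (u : A) * ((s : A) * b) ∈ A.grading 1 := by
    simpa using SetLike.mul_mem_graded u.1.2 (SetLike.mul_mem_graded s.1.2 hb)
  have h0 : (u : A) * ((t : A) * a) ∈ A.grading 0 := by
    simpa using SetLike.mul_mem_graded u.1.2 (SetLike.mul_mem_graded t.1.2 ha)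
  rw [hu] at h1
  have := Submodule.disjoint_def.1 A.isCompl.disjoint _ h0 h1
  rw [← frac_zero 1, frac_eq]
  refine ⟨u * t, ?_⟩
  change (u : A) * (t : A) * (1 * a) = (u : A) * (t : A) * ((s : A) * 0)
  rw [one_mul, mul_assoc, this, mul_zero, mul_zero]

theorem mul_notMem {R : Type u} [CommRing R] (x : PrimeSpectrum R) {s t : R} (hs : s ∉ x.asIdeal)
    (ht : t ∉ x.asIdeal) : s * t ∉ x.asIdeal := x.asIdeal.primeCompl.mul_mem hs ht

theorem one_notMem {R : Type u} [CommRing R] (x : PrimeSpectrum R) : (1 : R) ∉ x.asIdeal :=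
  x.asIdeal.primeCompl.one_mem

/-- Sections of the structure sheaf of the affine superscheme over `U ⊆ Spec A₀`: the functions
`P ↦ f P ∈ A_P` that are locally of the form `a / s` with `a ∈ A` and `s ∈ A₀`. -/
def sections (A : SAlg k) (U : Opens (PrimeSpectrum A.even)) :
    Subalgebra k (∀ x : U, A.Loc x.1) where
  carrier := {f | (StructureSheaf.isLocallyFraction A.even A).pred f}
  add_mem' := by
    intro f g hf hg x
    obtain ⟨V, hxV, hV, a, s, hf⟩ := hf x
    obtain ⟨W, hxW, hW, b, t, hg⟩ := hg x
    refine ⟨V ⊓ W, ⟨hxV, hxW⟩, homOfLE (inf_le_left.trans hV.le), (t : A) * a + (s : A) * b, s * t,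
      fun y => ?_⟩
    obtain ⟨hs, hf⟩ := hf ⟨y, y.2.1⟩
    obtain ⟨ht, hg⟩ := hg ⟨y, y.2.2⟩
    refine ⟨mul_notMem y.1 hs ht, ?_⟩
    exact (congrArg₂ (· + ·) hf hg).trans (frac_add a b ⟨s, hs⟩ ⟨t, ht⟩)
  mul_mem' := by
    intro f g hf hg x
    obtain ⟨V, hxV, hV, a, s, hf⟩ := hf x
    obtain ⟨W, hxW, hW, b, t, hg⟩ := hg x
    refine ⟨V ⊓ W, ⟨hxV, hxW⟩, homOfLE (inf_le_left.trans hV.le), a * b, s * t, fun y => ?_⟩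
    obtain ⟨hs, hf⟩ := hf ⟨y, y.2.1⟩
    obtain ⟨ht, hg⟩ := hg ⟨y, y.2.2⟩
    refine ⟨mul_notMem y.1 hs ht, ?_⟩
    exact (congrArg₂ (· * ·) hf hg).trans (frac_mul a b ⟨s, hs⟩ ⟨t, ht⟩)
  algebraMap_mem' c x :=
    ⟨U, x.2, 𝟙 _, algebraMap k A c, 1, fun y => ⟨one_notMem y.1,
      algebraMap_eq_frac y.1 c⟩⟩

/-- The grading of the sections, defined pointwise. -/
def secGrading (A : SAlg k) (U : Opens (PrimeSpectrum A.even)) (i : ZMod 2) :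
    Submodule k (A.sections U) where
  carrier := {f | ∀ x : U, f.1 x ∈ A.locGrading x.1 i}
  zero_mem' _ := zero_mem _
  add_mem' hf hg x := add_mem (hf x) (hg x)
  smul_mem' c _ hf x := Submodule.smul_mem _ c (hf x)

instance (A : SAlg k) (U : Opens (PrimeSpectrum A.even)) :
    SetLike.GradedMonoid (A.secGrading U) where
  one_mem x := SetLike.one_mem_graded (A.locGrading x.1)
  mul_mem _ _ _ _ hf hg x := SetLike.mul_mem_graded (A := A.locGrading x.1) (hf x) (hg x)

theorem loc_exists_add {A : SAlg k} {x : PrimeSpectrum A.even} (z : A.Loc x) :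
    ∃ b ∈ A.locGrading x 0, ∃ c ∈ A.locGrading x 1, b + c = z := by
  obtain ⟨a, s, rfl⟩ := frac_surjective z
  obtain ⟨b, hb, c, hc, rfl⟩ := A.exists_add a
  exact ⟨_, ⟨b, hb, s, rfl⟩, _, ⟨c, hc, s, rfl⟩, frac_add' b c s⟩


theorem isCompl_secGrading (A : SAlg k) (U : Opens (PrimeSpectrum A.even)) :
    IsCompl (A.secGrading U 0) (A.secGrading U 1) := by
  constructor
  · rw [Submodule.disjoint_def]
    intro f h0 h1
    exact Subtype.ext (funext fun x =>
      Submodule.disjoint_def.1 (A.disjoint_locGrading x.1) _ (h0 x) (h1 x))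
  · rw [codisjoint_iff, Submodule.eq_top_iff']
    intro f
    choose e he o ho heo using fun x : U => loc_exists_add (f.1 x)
    have key : ∀ x : U, ∃ (V : Opens (PrimeSpectrum A.even)) (_ : x.1 ∈ V) (hV : V ≤ U)
        (a b : A) (s : A.even), ∀ y : V, ∃ hs : s ∉ y.1.asIdeal,
          e ⟨y, hV y.2⟩ = frac y.1 a ⟨s, hs⟩ ∧ o ⟨y, hV y.2⟩ = frac y.1 b ⟨s, hs⟩ := by
      intro x
      obtain ⟨V, hxV, hV, a, s, hf⟩ := f.2 x
      obtain ⟨b, hb, c, hc, rfl⟩ := A.exists_add a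
      refine ⟨V, hxV, hV.le, b, c, s, fun y => ?_⟩
      obtain ⟨hs, hf⟩ := hf y
      refine ⟨hs, ?_⟩
      have h1 : e ⟨y, hV.le y.2⟩ + o ⟨y, hV.le y.2⟩ = frac y.1 b ⟨s, hs⟩ + frac y.1 c ⟨s, hs⟩ :=
        (heo ⟨y, hV.le y.2⟩).trans (hf.trans (frac_add' b c ⟨s, hs⟩).symm)
      have h2 : e ⟨y, hV.le y.2⟩ - frac y.1 b ⟨s, hs⟩ = frac y.1 c ⟨s, hs⟩ - o ⟨y, hV.le y.2⟩ := by
        rw [sub_eq_sub_iff_add_eq_add, h1, add_comm]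
      have h3 := Submodule.disjoint_def.1 (A.disjoint_locGrading y.1) _
        (sub_mem (he ⟨y, hV.le y.2⟩) ⟨b, hb, ⟨s, hs⟩, rfl⟩)
        (h2 ▸ sub_mem ⟨c, hc, ⟨s, hs⟩, rfl⟩ (ho ⟨y, hV.le y.2⟩))
      exact ⟨sub_eq_zero.1 h3, (sub_eq_zero.1 (h2.symm.trans h3)).symm⟩
    refine Submodule.mem_sup.2 ⟨⟨e, fun x => ?_⟩, he, ⟨o, fun x => ?_⟩, ho, Subtype.ext (funext heo)⟩
    · obtain ⟨V, hxV, hV, a, b, s, h⟩ := key x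
      exact ⟨V, hxV, homOfLE hV, a, s, fun y => ⟨(h y).1, (h y).2.1⟩⟩
    · obtain ⟨V, hxV, hV, a, b, s, h⟩ := key x
      exact ⟨V, hxV, homOfLE hV, b, s, fun y => ⟨(h y).1, (h y).2.2⟩⟩

theorem loc_supercomm {A : SAlg k} {x : PrimeSpectrum A.even} (i j : ZMod 2) (p q : A.Loc x)
    (hp : p ∈ A.locGrading x i) (hq : q ∈ A.locGrading x j) :
    p * q = (-1) ^ (i.val * j.val) * (q * p) := by
  obtain ⟨a, ha, s, rfl⟩ := hp
  obtain ⟨b, hb, t, rfl⟩ := hq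
  rw [frac_mul, frac_mul, A.supercomm i j a b ha hb, mul_comm t s]
  rcases Nat.even_or_odd (i.val * j.val) with h | h
  · rw [h.neg_one_pow, h.neg_one_pow, one_mul, one_mul]
  · rw [h.neg_one_pow, h.neg_one_pow, neg_one_mul, neg_one_mul, eq_neg_iff_add_eq_zero,
      frac_add', neg_add_cancel, frac_zero]

/-- The superalgebra of sections over `U`. -/
def specSections (A : SAlg k) (U : Opens (PrimeSpectrum A.even)) : SAlg k where
  carrier := A.sections U
  grading := A.secGrading U
  isCompl := A.isCompl_secGrading U
  supercomm i j f g hf hg := Subtype.ext <| funext fun x => by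
    have := loc_supercomm i j (f.1 x) (g.1 x) (hf x) (hg x)
    simpa using this

/-- Restriction of sections. -/
def specRes (A : SAlg k) {U V : Opens (PrimeSpectrum A.even)} (h : V ≤ U) :
    A.specSections U ⟶ A.specSections V where
  toAlgHom :=
    { toFun := fun f => ⟨fun x => f.1 ⟨x, h x.2⟩,
        (StructureSheaf.isLocallyFraction A.even A).res (homOfLE h) f.1 f.2⟩
      map_one' := rfl
      map_mul' := fun _ _ => rfl
      map_zero' := rfl
      map_add' := fun _ _ => rfl
      commutes' := fun _ => rfl }
  map_mem _ _ hf x := hf ⟨x, h x.2⟩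

/-- The affine superscheme of `A`: the space `Spec A₀` with the sheaf of superalgebras whose
sections over `D(s)` are `A_s` and whose stalk at `P` is `A_P`. -/
def SSpec (A : SAlg k) : PresheafedSpace (SAlg k) where
  carrier := TopCat.of (PrimeSpectrum A.even)
  presheaf :=
    { obj := fun U => A.specSections U.unop
      map := fun i => A.specRes i.unop.le }

/-- The map `A_Q → B_P`, `a / s ↦ f a / f s`, where `Q` is the preimage of `P`. -/
def locFun {A B : SAlg k} (f : A ⟶ B) (y : PrimeSpectrum B.even) :
    A.Loc (y.comap (evenMap f)) → B.Loc y := fun z =>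
  LocalizedModule.liftOn z (fun p => frac y (Hom.toAlgHom f p.1) ⟨evenMap f p.2, p.2.2⟩) <| by
    rintro ⟨a, s⟩ ⟨b, t⟩ ⟨u, hu⟩
    refine frac_eq.2 ⟨⟨evenMap f u, u.2⟩, ?_⟩
    have hu : (u : A) * ((t : A) * a) = (u : A) * ((s : A) * b) := hu
    have := congrArg (Hom.toAlgHom f) hu
    simpa only [map_mul] using! this

theorem locFun_frac {A B : SAlg k} (f : A ⟶ B) (y : PrimeSpectrum B.even) (a : A)
    (s : (y.comap (evenMap f)).asIdeal.primeCompl) :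
    locFun f y (frac _ a s) = frac y (Hom.toAlgHom f a) ⟨evenMap f s, s.2⟩ :=
  LocalizedModule.liftOn_mk _ _ _

/-- The algebra map `A_Q → B_P`, `a / s ↦ f a / f s`, where `Q` is the preimage of `P`. -/
def locMap {A B : SAlg k} (f : A ⟶ B) (y : PrimeSpectrum B.even) :
    A.Loc (y.comap (evenMap f)) →ₐ[k] B.Loc y :=
  AlgHom.ofLinearMap
    { toFun := locFun f y
      map_add' := fun p q => by
        obtain ⟨a, s, rfl⟩ := frac_surjective p
        obtain ⟨b, t, rfl⟩ := frac_surjective q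
        rw [frac_add, locFun_frac, locFun_frac, locFun_frac, frac_add]
        exact congrArg₂ (frac y) (by rw [map_add, map_mul, map_mul]; rfl)
          (Subtype.ext (map_mul (evenMap f) s.1 t.1))
      map_smul' := fun c p => by
        obtain ⟨a, s, rfl⟩ := frac_surjective p
        rw [smul_frac, locFun_frac, locFun_frac, RingHom.id_apply, smul_frac, map_smul] }
    (by
      change locFun f y 1 = 1
      rw [← frac_one, locFun_frac, ← frac_one]
      exact congrArg₂ (frac y) (map_one _) (Subtype.ext (map_one (evenMap f))))
    (fun p q => by
      change locFun f y _ = locFun f y _ * locFun f y _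
      obtain ⟨a, s, rfl⟩ := frac_surjective p
      obtain ⟨b, t, rfl⟩ := frac_surjective q
      rw [frac_mul, locFun_frac, locFun_frac, locFun_frac, frac_mul]
      exact congrArg₂ (frac y) (map_mul _ a b) (Subtype.ext (map_mul (evenMap f) s.1 t.1)))


theorem locMap_frac {A B : SAlg k} (f : A ⟶ B) (y : PrimeSpectrum B.even) (a : A)
    (s : (y.comap (evenMap f)).asIdeal.primeCompl) :
    locMap f y (frac _ a s) = frac y (Hom.toAlgHom f a) ⟨evenMap f s, s.2⟩ :=
  locFun_frac f y a s

/-- The continuous map `Spec B₀ → Spec A₀` induced by a superalgebra map `A → B`. -/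
def specPoint {A B : SAlg k} (f : A ⟶ B) : C(PrimeSpectrum B.even, PrimeSpectrum A.even) :=
  ⟨PrimeSpectrum.comap (evenMap f), by fun_prop⟩

/-- The pullback of functions along `Spec B₀ → Spec A₀`. -/
def specFun {A B : SAlg k} (f : A ⟶ B) (U : Opens (PrimeSpectrum A.even)) :
    (∀ x : U, A.Loc x.1) →ₐ[k] (∀ y : U.comap (specPoint f), B.Loc y.1) :=
  AlgHom.pi fun y => (locMap f y.1).comp
    (Pi.evalAlgHom k (fun x : U => A.Loc x.1) ⟨PrimeSpectrum.comap (evenMap f) y.1, y.2⟩)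

theorem specFun_apply {A B : SAlg k} (f : A ⟶ B) (U : Opens (PrimeSpectrum A.even))
    (s : ∀ x : U, A.Loc x.1) (y : U.comap (specPoint f)) :
    specFun f U s y = locMap f y.1 (s ⟨PrimeSpectrum.comap (evenMap f) y.1, y.2⟩) := rfl

theorem specFun_mem {A B : SAlg k} (f : A ⟶ B) (U : Opens (PrimeSpectrum A.even))
    (s : ∀ x : U, A.Loc x.1) (hs : s ∈ A.sections U) :
    specFun f U s ∈ B.sections (U.comap (specPoint f)) := by
  intro y
  obtain ⟨V, hV, hVU, a, t, h⟩ := hs ⟨PrimeSpectrum.comap (evenMap f) y.1, y.2⟩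
  refine ⟨V.comap (specPoint f), hV, homOfLE fun z hz => hVU.le hz, Hom.toAlgHom f a,
    evenMap f t, fun z => ?_⟩
  obtain ⟨ht, h⟩ := h ⟨PrimeSpectrum.comap (evenMap f) z.1, z.2⟩
  exact ⟨ht, (congrArg (locMap f z.1) h).trans (locMap_frac f z.1 a ⟨t, ht⟩)⟩

/-- The pullback of sections, as an algebra map. -/
def specSectionsHom {A B : SAlg k} (f : A ⟶ B) (U : Opens (PrimeSpectrum A.even)) :
    A.sections U →ₐ[k] B.sections (U.comap (specPoint f)) :=
  ((specFun f U).comp (A.sections U).val).codRestrict _ fun s => specFun_mem f U s.1 s.2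

theorem specSectionsHom_mem {A B : SAlg k} (f : A ⟶ B) (U : Opens (PrimeSpectrum A.even))
    (i : ZMod 2) (s : A.sections U) (hs : s ∈ A.secGrading U i) :
    specSectionsHom f U s ∈ B.secGrading (U.comap (specPoint f)) i := by
  intro y
  obtain ⟨a, ha, t, h⟩ := hs ⟨PrimeSpectrum.comap (evenMap f) y.1, y.2⟩
  exact ⟨Hom.toAlgHom f a, Hom.map_mem f i a ha, ⟨evenMap f t, t.2⟩,
    (locMap_frac f y.1 a t).symm.trans (congrArg (locMap f y.1) h)⟩

/-- The pullback of sections, as a superalgebra map. -/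
def specSectionsMap {A B : SAlg k} (f : A ⟶ B) (U : Opens (PrimeSpectrum A.even)) :
    A.specSections U ⟶ B.specSections (U.comap (specPoint f)) where
  toAlgHom := specSectionsHom f U
  map_mem := specSectionsHom_mem f U

/-- The morphism of affine superschemes induced by a superalgebra map `A → B`. -/
def specMap {A B : SAlg k} (f : A ⟶ B) : B.SSpec ⟶ A.SSpec where
  base := TopCat.ofHom (specPoint f)
  c := { app := fun U => specSectionsMap f U.unop }

end SAlg

/-- The even part of the stalk at `x` of a space with a presheaf of superalgebras, that is, the
stalk of the even part of the presheaf. -/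
def evenStalk {k : Type u} [Field k] (X : PresheafedSpace (SAlg k)) (x : X) : CommRingCat.{u} :=
  TopCat.Presheaf.stalk (X := X.carrier) (C := CommRingCat.{u})
    (X.presheaf ⋙ SAlg.evenFunctor k) x

/-- The even part of the germ map `O(U) → O_x`. -/
def evenGerm {k : Type u} [Field k] (X : PresheafedSpace (SAlg k)) (U : Opens X) (x : X)
    (hx : x ∈ U) : (X.presheaf.obj (op U)).even →+* evenStalk X x :=
  (TopCat.Presheaf.germ (X := X.carrier) (C := CommRingCat.{u})
    (X.presheaf ⋙ SAlg.evenFunctor k) U x hx).hom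

/-- An open subset `U` of `X` is affine if the restriction of `X` to `U` is isomorphic to the affine
superscheme of some superalgebra. An isomorphism of super-ringed spaces is automatically local on
stalks. -/
def IsAffineOpenSuper {k : Type u} [Field k] (X : PresheafedSpace (SAlg k)) (U : Opens X) : Prop :=
  ∃ A : SAlg k, Nonempty (X.restrict U.isOpenEmbedding ≅ A.SSpec)

/-- A superscheme over `k`: a space with a sheaf of superalgebras with local stalks, locally
isomorphic to affine superschemes. A superalgebra is local, that is, has a unique maximal
super-ideal, exactly when its even part is a local ring. -/
structure IsSuperscheme {k : Type u} [Field k] (X : PresheafedSpace (SAlg k)) : Prop where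
  isSheaf : TopCat.Presheaf.IsSheaf (X := X.carrier) (C := Type u) (X.presheaf ⋙ SAlg.toType k)
  isLocalRing : ∀ x : X, IsLocalRing (evenStalk X x)
  exists_affine : ∀ x : X, ∃ U : Opens X, x ∈ U ∧ IsAffineOpenSuper X U

/-- A superscheme over `k`. -/
structure Superscheme (k : Type u) [Field k] extends PresheafedSpace (SAlg k) where
  isSuperscheme : IsSuperscheme toPresheafedSpace

namespace Superscheme

variable {k : Type u} [Field k]

instance (X : Superscheme k) (x : X.carrier) : IsLocalRing (evenStalk X.toPresheafedSpace x) :=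
  X.isSuperscheme.isLocalRing x

/-- The non-empty affine open subsets of `X`. -/
def AffineOpens (X : Superscheme k) : Type u :=
  {U : Opens X.carrier // (U : Set X.carrier).Nonempty ∧ IsAffineOpenSuper X.toPresheafedSpace U}

/-- The superalgebra `O_X(U)`. -/
def sec (X : Superscheme k) (U : X.AffineOpens) : SAlg k := X.presheaf.obj (op U.1)

/-- The restriction map `O_X(U) → O_X(V)` for `V ⊆ U`. -/
def res (X : Superscheme k) {U V : X.AffineOpens} (h : V.1 ≤ U.1) : X.sec U ⟶ X.sec V :=
  X.presheaf.map (homOfLE h).op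

/-- The canonical map `U → Spec O_X(U)₀`, sending `x` to the prime of those even sections whose
germ at `x` lies in the maximal ideal of the stalk. -/
def point (X : Superscheme k) (U : X.AffineOpens) (x : X.carrier) (hx : x ∈ U.1) :
    PrimeSpectrum (X.sec U).even :=
  PrimeSpectrum.comap (evenGerm X.toPresheafedSpace U.1 x hx)
    (IsLocalRing.closedPoint (evenStalk X.toPresheafedSpace x))

/-- A gluing of the affine superschemes `Y_U` given by the superalgebras `gr O_X(U)`, where `U`
ranges over the non-empty affine open subsets of `X`, to a superscheme with underlying space `|X|`:
a sheaf on `|X|` that makes it a superscheme, with open immersions `Y_U → (|X|, sheaf)` that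
identify `|Y_U|` with `U` in the natural way and are compatible with the morphisms `Y_V → Y_U`
induced by the restriction maps of `X`. -/
structure GrGluing (X : Superscheme k) where
  sheaf : TopCat.Presheaf (SAlg k) X.carrier
  isSuperscheme : IsSuperscheme ⟨X.carrier, sheaf⟩
  emb : ∀ U : X.AffineOpens, (X.sec U).gr.SSpec ⟶ ⟨X.carrier, sheaf⟩
  isOpenImmersion : ∀ U, PresheafedSpace.IsOpenImmersion (emb U)
  range_emb : ∀ U, Set.range (emb U).base = (U.1 : Set X.carrier)
  comap_emb : ∀ (U : X.AffineOpens) (q : PrimeSpectrum (X.sec U).gr.even)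
    (hq : (emb U).base q ∈ U.1),
    PrimeSpectrum.comap (X.sec U).evenToGr q = X.point U ((emb U).base q) hq
  specMap_emb : ∀ (U V : X.AffineOpens) (h : V.1 ≤ U.1),
    SAlg.specMap (SAlg.grMap (X.res h)) ≫ emb U = emb V

/-- The superscheme that results from a gluing. -/
abbrev GrGluing.space {X : Superscheme k} (G : X.GrGluing) : PresheafedSpace (SAlg k) :=
  ⟨X.carrier, G.sheaf⟩

/-- A gluing of the affine `k`-schemes `Spec (O_X(U) / (O_X(U)₁))`, where `U` ranges over the
non-empty affine open subsets of `X`, to a `k`-scheme with underlying space `|X|`. -/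
structure AssocGluing (X : Superscheme k) where
  scheme : Scheme.{u}
  str : scheme ⟶ Spec (CommRingCat.of k)
  homeo : scheme ≃ₜ X.carrier
  emb : ∀ U : X.AffineOpens, Spec (CommRingCat.of (X.sec U).Assoc) ⟶ scheme
  emb_str : ∀ U, emb U ≫ str =
    Spec.map (CommRingCat.ofHom (algebraMap k (X.sec U).Assoc))
  isOpenImmersion : ∀ U, IsOpenImmersion (emb U)
  range_emb : ∀ U, Set.range (fun q => homeo (emb U q)) = (U.1 : Set X.carrier)
  comap_emb : ∀ (U : X.AffineOpens) (q : PrimeSpectrum (X.sec U).Assoc)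
    (hq : homeo (emb U q) ∈ U.1),
    PrimeSpectrum.comap (X.sec U).evenToAssoc q = X.point U (homeo (emb U q)) hq
  specMap_emb : ∀ (U V : X.AffineOpens) (h : V.1 ≤ U.1),
    Spec.map (CommRingCat.ofHom (SAlg.assocMap (X.res h))) ≫ emb U = emb V

end Superscheme

end

/-! In characteristic different from 2 odd elements square to zero, so products of two odd elements
are nilpotent. Hence `I_A ∩ A₀` is a nil ideal, and every element of `(gr A)₀` is the class of an
element of `A₀` plus a nilpotent. The maps from `Spec (A / I_A)` and `Spec (gr A)₀` to `Spec A₀` are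
therefore homeomorphisms (`isHomeomorph_comap_evenToAssoc`, `isHomeomorph_comap_evenToGr`).

For affine opens `V ⊆ U` the restriction `O(U) → O(V)` need not invert a single element, but it is
an open embedding on spectra (`isOpenEmbedding_specPoint_res`) and an isomorphism on localizations
at every prime of `O(V)₀` (`IsLocIso`, `isLocIso_res`). This is seen by comparing the charts `Spec
O(U) → X` and `Spec O(V) → X` of `IsAffineOpenSuper.exists_chart`. Powers of `I_A` are compatible
with localization (`IsLocIso.isFracAt`, `IsLocIso.exists_smul_mem_filt_succ`), so the local
isomorphism property passes to `gr` and to `A / I_A`. Thus all the transition maps `Y_V → Y_U` and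
`Z_V → Z_U` are open immersions, lying over the inclusion of `V` in `U`.

Affine opens form a basis of `|X|`, so (1) is an instance of gluing an `AffineFamily`. A section of
the glued sheaf over `W` is a family of sections on the preimages of `W` in all the members,
compatible under the transition maps. Over the image of one member such a family is determined by
its component there, and that component is arbitrary (`proj_injective`, `proj_surjective`); so the
members embed as open immersions. For any other gluing, pulling its sections back to all the members
gives such families, bijectively by the sheaf condition (`IsGlued.toFamily_bijective`); existence
and uniqueness of the comparison isomorphism follow.

For (2) the scheme is the colimit of the diagram of the `Z_U`, a locally directed diagram of open
immersions. Its points are those of `|X|`, because two points of pieces are identified exactly when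
they have the same image in `|X|`. Morphisms between two gluings are glued along the cover by the
`Z_U`. -/

noncomputable section

/-! ### Local isomorphisms of superalgebras and open immersions of affine superschemes. -/

namespace SAlg

variable {k : Type u} [Field k]

theorem zmod_two_cases (i : ZMod 2) : i = 0 ∨ i = 1 := by revert i; decide

/-- The inverse respects parity: the component of a preimage with the wrong parity maps to an
element that is both even and odd, hence to zero, and so vanishes by injectivity. -/
theorem isIso_of_bijective {A B : SAlg k} (f : A ⟶ B)
    (hf : Function.Bijective (Hom.toAlgHom f)) : IsIso f := by
  let e := AlgEquiv.ofBijective (Hom.toAlgHom f) hf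
  have he : ∀ b, Hom.toAlgHom f (e.symm b) = b := e.apply_symm_apply
  have he' : ∀ a, e.symm (Hom.toAlgHom f a) = a := e.symm_apply_apply
  refine ⟨⟨⟨e.symm.toAlgHom, fun i b hb => ?_⟩, Hom.ext (AlgHom.ext he'), Hom.ext (AlgHom.ext he)⟩⟩
  change e.symm b ∈ A.grading i
  obtain ⟨c, hc, d, hd, hcd⟩ := A.exists_add (e.symm b)
  have hb' : Hom.toAlgHom f c + Hom.toAlgHom f d = b := by rw [← map_add, hcd, he]
  have hc' := Hom.map_mem f 0 _ hc
  have hd' := Hom.map_mem f 1 _ hd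
  rcases zmod_two_cases i with rfl | rfl
  · have h0 : Hom.toAlgHom f d ∈ B.grading 0 := by
      rw [← add_sub_cancel_left (Hom.toAlgHom f c) (Hom.toAlgHom f d), hb']
      exact sub_mem hb hc'
    have := Submodule.disjoint_def.1 B.isCompl.disjoint _ h0 hd'
    rw [← map_zero (Hom.toAlgHom f)] at this
    rw [← hcd, hf.1 this, add_zero]
    exact hc
  · have h0 : Hom.toAlgHom f c ∈ B.grading 1 := by
      rw [← add_sub_cancel_right (Hom.toAlgHom f c) (Hom.toAlgHom f d), hb']
      exact sub_mem hb hd'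
    have := Submodule.disjoint_def.1 B.isCompl.disjoint _ hc' h0
    rw [← map_zero (Hom.toAlgHom f)] at this
    rw [← hcd, hf.1 this, zero_add]
    exact hd

theorem bijective_of_isIso {A B : SAlg k} (f : A ⟶ B) [IsIso f] :
    Function.Bijective (Hom.toAlgHom f) := by
  refine Function.bijective_iff_has_inverse.2 ⟨Hom.toAlgHom (inv f), fun a => ?_, fun b => ?_⟩
  · exact congrArg (fun g => Hom.toAlgHom g a) (IsIso.hom_inv_id f)
  · exact congrArg (fun g => Hom.toAlgHom g b) (IsIso.inv_hom_id f)

theorem map_even_smul {A B : SAlg k} (f : A ⟶ B) (a : A.even) (b : A) :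
    Hom.toAlgHom f (a • b) = evenMap f a • Hom.toAlgHom f b := map_mul (Hom.toAlgHom f) a.1 b

theorem even_smul_mem {A : SAlg k} (a : A.even) {b : A} {i : ZMod 2} (hb : b ∈ A.grading i) :
    a • b ∈ A.grading i := by
  have := SetLike.mul_mem_graded a.2 hb
  rwa [zero_add] at this

theorem frac_eq_iff {A : SAlg k} {x : PrimeSpectrum A.even} {a b : A} {s t : x.asIdeal.primeCompl} :
    frac x a s = frac x b t ↔
      ∃ u : A.even, u ∉ x.asIdeal ∧ u • t.1 • a = u • s.1 • b := by
  rw [frac_eq]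
  exact ⟨fun ⟨u, hu⟩ => ⟨u, u.2, hu⟩, fun ⟨u, hu, h⟩ => ⟨⟨u, hu⟩, h⟩⟩

theorem frac_eq_zero {A : SAlg k} {x : PrimeSpectrum A.even} {a : A} {s : x.asIdeal.primeCompl} :
    frac x a s = 0 ↔ ∃ u : A.even, u ∉ x.asIdeal ∧ u • a = 0 := by
  rw [← frac_zero 1, frac_eq_iff]
  refine exists_congr fun u => and_congr_right fun _ => ?_
  rw [smul_zero, smul_zero]
  exact Eq.congr_left (congrArg (u • ·) (one_smul A.even a))

/-- The constant section `a / 1`. -/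
def toSections (A : SAlg k) (U : Opens (PrimeSpectrum A.even)) : A ⟶ A.specSections U where
  toAlgHom := AlgHom.codRestrict
    { toFun := fun a (x : U) => frac x.1 a 1
      map_one' := funext fun _ => frac_one
      map_mul' := fun a b => funext fun x =>
        ((frac_mul a b 1 1).trans (congrArg (frac x.1 (a * b)) (one_mul _))).symm
      map_zero' := funext fun _ => frac_zero 1
      map_add' := fun a b => funext fun _ => (frac_add' a b 1).symm
      commutes' := fun _ => rfl } (A.sections U)
    fun a _ => ⟨U, Subtype.property _, 𝟙 _, a, 1, fun y => ⟨one_notMem y.1, rfl⟩⟩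
  map_mem _ a ha _ := ⟨a, ha, 1, rfl⟩

theorem sections_ext {A : SAlg k} {U : Opens (PrimeSpectrum A.even)} {s t : A.specSections U}
    (h : ∀ x : U, s.1 x = t.1 x) : s = t :=
  Subtype.ext (funext h)

theorem sections_exists_frac {A : SAlg k} {U : Opens (PrimeSpectrum A.even)}
    (s : A.specSections U) {x : PrimeSpectrum A.even} (hx : x ∈ U) :
    ∃ (V : Opens (PrimeSpectrum A.even)) (_ : x ∈ V) (hV : V ≤ U) (a : A) (t : A.even),
      ∀ (y) (hy : y ∈ V), ∃ ht : t ∉ y.asIdeal, s.1 ⟨y, hV hy⟩ = frac y a ⟨t, ht⟩ := by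
  obtain ⟨V, hxV, hV, a, t, h⟩ := s.2 ⟨x, hx⟩
  exact ⟨V, hxV, hV.le, a, t, fun y hy => h ⟨y, hy⟩⟩

/-- A superalgebra map `f : A → B` that induces isomorphisms `A_Q ≅ B_P` for every prime `P` of `B₀`
with preimage `Q`. -/
structure IsLocIso {A B : SAlg k} (f : A ⟶ B) : Prop where
  exists_frac : ∀ (q : PrimeSpectrum B.even) (b : B), ∃ (a : A) (s : A.even) (u : B.even),
    evenMap f s ∉ q.asIdeal ∧ u ∉ q.asIdeal ∧ u • evenMap f s • b = u • Hom.toAlgHom f a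
  exists_smul_eq_zero : ∀ (q : PrimeSpectrum B.even) (a : A) (u : B.even), u ∉ q.asIdeal →
    u • Hom.toAlgHom f a = 0 → ∃ v : A.even, evenMap f v ∉ q.asIdeal ∧ v • a = 0

theorem IsLocIso.of_isIso {A B : SAlg k} (f : A ⟶ B) [IsIso f] : IsLocIso f where
  exists_frac q b := by
    obtain ⟨a, rfl⟩ := (bijective_of_isIso f).2 b
    refine ⟨a, 1, 1, ?_, one_notMem q, ?_⟩
    · rw [map_one]; exact one_notMem q
    · rw [map_one, one_smul]
  exists_smul_eq_zero q a u hu h := by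
    let v : A.even := ⟨Hom.toAlgHom (inv f) u, Hom.map_mem (inv f) 0 _ u.2⟩
    have e : evenMap f v = u :=
      Subtype.ext (congrArg (fun g => Hom.toAlgHom g (u : B)) (IsIso.inv_hom_id f))
    rw [← e] at h hu
    rw [← map_even_smul] at h
    exact ⟨v, hu, (bijective_of_isIso f).1 (h.trans (map_zero _).symm)⟩

/-- The even version of `IsLocIso.exists_frac`. -/
theorem IsLocIso.exists_frac_even {A B : SAlg k} {f : A ⟶ B} (hf : IsLocIso f)
    (q : PrimeSpectrum B.even) (b : B.even) : ∃ (a s : A.even) (u : B.even),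
    evenMap f s ∉ q.asIdeal ∧ u ∉ q.asIdeal ∧ u * (evenMap f s * b) = u * evenMap f a := by
  obtain ⟨c, s, u, hs, hu, h⟩ := hf.exists_frac q b
  obtain ⟨c, hc, d, hd, rfl⟩ := A.exists_add c
  refine ⟨⟨c, hc⟩, s, u, hs, hu, Subtype.ext ?_⟩
  change u • evenMap f s • (b : B) = u • Hom.toAlgHom f c
  -- The difference is even by its form and, by `h`, equal to the image of an odd element; so it is
  -- zero. The odd part of the numerator can thus be dropped.
  have h0 : u • evenMap f s • (b : B) - u • Hom.toAlgHom f c ∈ B.grading 0 :=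
    sub_mem (even_smul_mem _ (even_smul_mem _ b.2)) (even_smul_mem _ (Hom.map_mem f 0 _ hc))
  have h1 : u • evenMap f s • (b : B) - u • Hom.toAlgHom f c ∈ B.grading 1 := by
    rw [h, map_add, smul_add, add_sub_cancel_left]
    exact even_smul_mem _ (Hom.map_mem f 1 _ hd)
  exact sub_eq_zero.1 (Submodule.disjoint_def.1 B.isCompl.disjoint _ h0 h1)

/-- The odd version of `IsLocIso.exists_frac`. -/
theorem IsLocIso.exists_frac_odd {A B : SAlg k} {f : A ⟶ B} (hf : IsLocIso f)
    (q : PrimeSpectrum B.even) {b : B} (hb : b ∈ B.grading 1) : ∃ a ∈ A.grading 1,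
    ∃ (s : A.even) (u : B.even), evenMap f s ∉ q.asIdeal ∧ u ∉ q.asIdeal ∧
      u • evenMap f s • b = u • Hom.toAlgHom f a := by
  obtain ⟨c, s, u, hs, hu, h⟩ := hf.exists_frac q b
  obtain ⟨c, hc, d, hd, rfl⟩ := A.exists_add c
  refine ⟨d, hd, s, u, hs, hu, ?_⟩
  have h0 : u • evenMap f s • b - u • Hom.toAlgHom f d ∈ B.grading 1 :=
    sub_mem (even_smul_mem _ (even_smul_mem _ hb)) (even_smul_mem _ (Hom.map_mem f 1 _ hd))
  have h1 : u • evenMap f s • b - u • Hom.toAlgHom f d ∈ B.grading 0 := by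
    rw [h, map_add, smul_add, add_sub_cancel_right]
    exact even_smul_mem _ (Hom.map_mem f 0 _ hc)
  exact sub_eq_zero.1 (Submodule.disjoint_def.1 B.isCompl.disjoint _ h1 h0)

/-- Denominators outside a prime of `B₀` can be cleared by denominators from `A₀`. -/
theorem IsLocIso.exists_mul_eq_evenMap {A B : SAlg k} {f : A ⟶ B} (hf : IsLocIso f)
    (q : PrimeSpectrum B.even) {t : B.even} (ht : t ∉ q.asIdeal) :
    ∃ (c : A.even) (v : B.even), evenMap f c ∉ q.asIdeal ∧ v ∉ q.asIdeal ∧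
      ∃ w : A.even, evenMap f w ∉ q.asIdeal ∧ v * (evenMap f w * t) = v * evenMap f c := by
  obtain ⟨c, s, u, hs, hu, h⟩ := hf.exists_frac_even q t
  refine ⟨c, u, fun hc => ?_, hu, s, hs, h⟩
  have := q.asIdeal.mul_mem_left u hc
  rw [← h] at this
  exact mul_notMem q hu (mul_notMem q hs ht) this

theorem IsLocIso.locMap_bijective {A B : SAlg k} {f : A ⟶ B} (hf : IsLocIso f)
    (y : PrimeSpectrum B.even) : Function.Bijective (locMap f y) := by
  constructor
  · rw [injective_iff_map_eq_zero]
    intro z hz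
    obtain ⟨a, s, rfl⟩ := frac_surjective z
    rw [locMap_frac, frac_eq_zero] at hz
    obtain ⟨u, hu, h⟩ := hz
    exact frac_eq_zero.2 (hf.exists_smul_eq_zero y a u hu h)
  · intro z
    obtain ⟨b, t, rfl⟩ := frac_surjective z
    obtain ⟨a, s, u, hs, hu, h⟩ := hf.exists_frac y b
    obtain ⟨c, u', hc, hu', s', hs', h'⟩ := hf.exists_mul_eq_evenMap y t.2
    -- Locally `b = f a / f s` and `t = f c / f s'`, so `b / t` is the image of `s' a / (s c)`.
    refine ⟨frac _ (s' • a) ⟨s * c, mul_notMem (y.comap (evenMap f)) hs hc⟩, ?_⟩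
    rw [locMap_frac, frac_eq_iff]
    refine ⟨u * u', mul_notMem y hu hu', ?_⟩
    simp only [map_even_smul, map_mul]
    linear_combination (norm := skip) h' • (u • Hom.toAlgHom f a) - (u' * evenMap f c) • h
    module

/-- Over the range of an open embedding of spectra, sections can be pulled back and forth pointwise
by the bijections `locMap`. What remains is that the resulting function is again locally a fraction.
-/
theorem specSectionsHom_bijective {A B : SAlg k} {f : A ⟶ B} (hf : IsLocIso f)
    (ho : Topology.IsOpenEmbedding (specPoint f)) {U : Opens (PrimeSpectrum A.even)}
    (hU : (U : Set (PrimeSpectrum A.even)) ⊆ Set.range (specPoint f)) :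
    Function.Bijective (specSectionsHom f U) := by
  constructor
  · intro s t hst
    refine sections_ext (A := A) fun ⟨x, hx⟩ => ?_
    obtain ⟨y, rfl⟩ := hU hx
    exact (hf.locMap_bijective y).1 (congrArg (fun s => s.1 ⟨y, hx⟩) hst)
  · intro t
    -- The type of the value depends on the point. Allowing any `z'` heterogeneously equal to `z`
    -- lets values be chosen at the points `x` and still be used at `specPoint f y`.
    have key : ∀ x : U, ∃ z : A.Loc x.1, ∀ y (hy : specPoint f y ∈ U)
        (z' : A.Loc (specPoint f y)), specPoint f y = x.1 → HEq z' z →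
          locMap f y z' = t.1 ⟨y, hy⟩ := by
      rintro ⟨x, hx⟩
      obtain ⟨y, rfl⟩ := hU hx
      obtain ⟨z, hz⟩ := (hf.locMap_bijective y).2 (t.1 ⟨y, hx⟩)
      refine ⟨z, fun y' hy' z' e he => ?_⟩
      obtain rfl := ho.injective e
      obtain rfl := eq_of_heq he
      exact hz
    choose s hs using key
    have hs' : ∀ y (hy : specPoint f y ∈ U), locMap f y (s ⟨specPoint f y, hy⟩) = t.1 ⟨y, hy⟩ :=
      fun y hy => hs ⟨specPoint f y, hy⟩ y hy _ rfl HEq.rfl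
    refine ⟨⟨s, ?_⟩, sections_ext (A := B) fun y => hs' y.1 y.2⟩
    rintro ⟨x, hx⟩
    obtain ⟨y, rfl⟩ : ∃ y, specPoint f y = x := hU hx
    obtain ⟨V, hyV, hV, b, r, hb⟩ := sections_exists_frac (A := B) t (x := y) hx
    obtain ⟨a, q, hq⟩ := frac_surjective (s ⟨specPoint f y, hx⟩)
    have h1 := hs' y hx
    obtain ⟨hr, h2⟩ := hb y hyV
    rw [h2, ← hq] at h1
    have h5 : frac y (Hom.toAlgHom f a) ⟨evenMap f q.1, q.2⟩ = frac y b ⟨r, hr⟩ :=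
      (locMap_frac f y a q).symm.trans h1
    obtain ⟨u, hu, h3⟩ := frac_eq_iff.1 h5
    -- On `W` the section `t` is `b / r`, and both the witness `u` of `f a / f q = b / r` and the
    -- denominator `f q` are invertible; hence `a / q` represents `s` on the image of `W`.
    let W : Opens (PrimeSpectrum B.even) :=
      V ⊓ PrimeSpectrum.basicOpen u ⊓ PrimeSpectrum.basicOpen (evenMap f q)
    refine ⟨⟨specPoint f '' W, ho.isOpenMap _ W.2⟩, ⟨y, ⟨⟨hyV, hu⟩, q.2⟩, rfl⟩, homOfLE ?_, a, q.1, ?_⟩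
    · rintro _ ⟨z, hz, rfl⟩
      exact hV hz.1.1
    · rintro ⟨_, z, hz, rfl⟩
      refine ⟨hz.2, (hf.locMap_bijective z).1 ?_⟩
      refine (hs' z (hV hz.1.1)).trans ?_
      obtain ⟨hr', h4⟩ := hb z hz.1.1
      refine (h4.trans ?_).trans (locMap_frac f z a ⟨q, hz.2⟩).symm
      exact (frac_eq_iff.2 ⟨u, hz.1.2, h3.symm⟩)

/-- A superalgebra map inducing an open embedding of spectra and isomorphisms of localizations
induces an open immersion of affine superschemes. -/
theorem isOpenImmersion_specMap {A B : SAlg k} {f : A ⟶ B} (hf : IsLocIso f)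
    (ho : Topology.IsOpenEmbedding (specPoint f)) :
    PresheafedSpace.IsOpenImmersion (specMap f) where
  base_open := ho
  c_iso U := isIso_of_bijective _ (specSectionsHom_bijective hf ho (by
    rintro _ ⟨y, _, rfl⟩
    exact ⟨y, rfl⟩))

end SAlg

open SAlg

variable {k : Type u} [Field k]

/-! ### Pullback and restriction of sections along morphisms of superspaces. -/

/-- The pullback of sections along a morphism `e : Y ⟶ Z`, from an open subset `W` of `Z` to an open
subset `W'` of its preimage. -/
def pull {Y Z : PresheafedSpace.{u} (SAlg k)} (e : Y ⟶ Z) (W : Opens Z) (W' : Opens Y)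
    (h : ∀ y ∈ W', e.base y ∈ W) : Z.presheaf.obj (op W) →ₐ[k] Y.presheaf.obj (op W') :=
  Hom.toAlgHom (e.c.app (op W) ≫
    Y.presheaf.map (homOfLE (show W' ≤ (Opens.map e.base).obj W from h)).op)

/-- Restriction of sections as an algebra map. -/
def resHom (Z : PresheafedSpace.{u} (SAlg k)) {W W' : Opens Z} (h : W' ≤ W) :
    Z.presheaf.obj (op W) →ₐ[k] Z.presheaf.obj (op W') :=
  Hom.toAlgHom (Z.presheaf.map (homOfLE h).op)

theorem resHom_resHom (Z : PresheafedSpace.{u} (SAlg k)) {W W' W'' : Opens Z} (h : W' ≤ W)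
    (h' : W'' ≤ W') (s : Z.presheaf.obj (op W)) :
    resHom Z h' (resHom Z h s) = resHom Z (h'.trans h) s :=
  (congrArg (fun g => Hom.toAlgHom g s) (Z.presheaf.map_comp (homOfLE h).op (homOfLE h').op)).symm

theorem resHom_self (Z : PresheafedSpace.{u} (SAlg k)) {W : Opens Z} (s : Z.presheaf.obj (op W)) :
    resHom Z le_rfl s = s :=
  congrArg (fun g => Hom.toAlgHom g s) (Z.presheaf.map_id (op W))

theorem pull_map_mem {Y Z : PresheafedSpace.{u} (SAlg k)} (e : Y ⟶ Z) (W : Opens Z) (W' : Opens Y)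
    (h : ∀ y ∈ W', e.base y ∈ W) {i : ZMod 2} {s : Z.presheaf.obj (op W)}
    (hs : s ∈ (Z.presheaf.obj (op W)).grading i) :
    pull e W W' h s ∈ (Y.presheaf.obj (op W')).grading i :=
  Hom.map_mem _ i s hs

theorem pull_resHom {Y Z : PresheafedSpace.{u} (SAlg k)} (e : Y ⟶ Z) {W V : Opens Z}
    {W' : Opens Y} (hV : V ≤ W) (h : ∀ y ∈ W', e.base y ∈ V) (s : Z.presheaf.obj (op W)) :
    pull e V W' h (resHom Z hV s) = pull e W W' (fun y hy => hV (h y hy)) s := by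
  have h1 := congrArg (fun g => Hom.toAlgHom g s) (e.c.naturality (homOfLE hV).op)
  have h2 : Hom.toAlgHom (e.c.app (op V)) (resHom Z hV s) =
    resHom Y (show (Opens.map e.base).obj V ≤ (Opens.map e.base).obj W from fun _ hx => hV hx)
      (Hom.toAlgHom (e.c.app (op W)) s) := h1
  change resHom Y _ (Hom.toAlgHom (e.c.app (op V)) (resHom Z hV s)) = _
  rw [h2, resHom_resHom]
  rfl

theorem resHom_pull {Y Z : PresheafedSpace.{u} (SAlg k)} (e : Y ⟶ Z) {W : Opens Z}
    {W' V' : Opens Y} (hV : V' ≤ W') (h : ∀ y ∈ W', e.base y ∈ W) (s : Z.presheaf.obj (op W)) :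
    resHom Y hV (pull e W W' h s) = pull e W V' (fun y hy => h y (hV hy)) s :=
  resHom_resHom Y _ _ _

theorem pull_comp {X Y Z : PresheafedSpace.{u} (SAlg k)} (f : X ⟶ Y) (e : Y ⟶ Z) {W : Opens Z}
    {W' : Opens Y} {W'' : Opens X} (h : ∀ y ∈ W', e.base y ∈ W) (h' : ∀ x ∈ W'', f.base x ∈ W')
    (s : Z.presheaf.obj (op W)) :
    pull (f ≫ e) W W'' (fun x hx => h _ (h' x hx)) s = pull f W' W'' h' (pull e W W' h s) := by
  change _ = pull f W' W'' h' (resHom Y _ (Hom.toAlgHom (e.c.app (op W)) s))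
  rw [pull_resHom]
  rfl

theorem pull_congr {Y Z : PresheafedSpace.{u} (SAlg k)} {e e' : Y ⟶ Z} (he : e = e') {W : Opens Z}
    {W' : Opens Y} (h : ∀ y ∈ W', e.base y ∈ W) (s : Z.presheaf.obj (op W)) :
    pull e W W' h s = pull e' W W' (he ▸ h) s := by
  subst he; rfl

/-- Morphisms of superspaces are determined by the maps on points and on sections. -/
theorem hom_ext_of_pull {Y Z : PresheafedSpace.{u} (SAlg k)} {e e' : Y ⟶ Z}
    (hb : e.base = e'.base)
    (h : ∀ (W : Opens Z) (W' : Opens Y) (h : ∀ y ∈ W', e.base y ∈ W)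
      (h' : ∀ y ∈ W', e'.base y ∈ W) (s : Z.presheaf.obj (op W)),
      pull e W W' h s = pull e' W W' h' s) : e = e' := by
  obtain ⟨b, c⟩ := e
  obtain ⟨b', c'⟩ := e'
  change b = b' at hb
  subst hb
  congr 1
  ext W
  refine Hom.ext (AlgHom.ext fun s => ?_)
  have := h W ((Opens.map b).obj W) (fun _ h => h) (fun _ h => h) s
  exact (resHom_self Y _).symm.trans (this.trans (resHom_self Y _))

/-- An open subset inside the range is the image of its preimage, where an open immersion is an
isomorphism on sections. Describing `W'` by an equivalence of memberships spares later arguments the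
transport along equalities of open subsets. -/
theorem pull_bijective {Y Z : PresheafedSpace.{u} (SAlg k)} (e : Y ⟶ Z)
    [he : PresheafedSpace.IsOpenImmersion e] {W : Opens Z} {W' : Opens Y}
    (h : ∀ y, y ∈ W' ↔ e.base y ∈ W) (hW : (W : Set Z) ⊆ Set.range e.base) :
    Function.Bijective (pull e W W' fun y hy => (h y).1 hy) := by
  have e1 : W = he.base_open.functor.obj W' := by
    ext z
    constructor
    · intro hz
      obtain ⟨y, rfl⟩ := hW hz
      exact ⟨y, (h y).2 hz, rfl⟩
    · rintro ⟨y, hy, rfl⟩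
      exact (h y).1 hy
  have e2 : (Opens.map e.base).obj W = W' := by
    ext y
    exact (h y).symm
  have i1 : IsIso (e.c.app (op W)) := by rw [e1]; exact he.c_iso W'
  subst e2
  have : IsIso (Y.presheaf.map (homOfLE (le_refl ((Opens.map e.base).obj W))).op) := by
    rw [show (homOfLE (le_refl ((Opens.map e.base).obj W))).op = 𝟙 _ from rfl]
    infer_instance
  exact bijective_of_isIso _

theorem isOpenImmersion_of_pull {Y Z : PresheafedSpace.{u} (SAlg k)} (e : Y ⟶ Z)
    (he : Topology.IsOpenEmbedding e.base)
    (h : ∀ (W : Opens Z) (W' : Opens Y) (h : ∀ y, y ∈ W' ↔ e.base y ∈ W),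
      (W : Set Z) ⊆ Set.range e.base → Function.Bijective (pull e W W' fun y hy => (h y).1 hy)) :
    PresheafedSpace.IsOpenImmersion e where
  base_open := he
  c_iso U := by
    refine isIso_of_bijective _ ?_
    have := h (he.functor.obj U) ((Opens.map e.base).obj (he.functor.obj U)) (fun _ => Iff.rfl) (by
      rintro _ ⟨y, _, rfl⟩
      exact ⟨y, rfl⟩)
    have e1 : ⇑(Hom.toAlgHom (e.c.app (op (he.functor.obj U)))) =
        ⇑(pull e (he.functor.obj U) ((Opens.map e.base).obj (he.functor.obj U)) fun _ h => h) :=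
      funext fun s => (resHom_self Y _).symm
    exact e1 ▸ this

/-! ### The spectra of `A₀`, `A / I_A` and `(gr A)₀` are homeomorphic. -/

/-- A ring map with nil kernel and whose image together with the nilradical spans the target
induces a homeomorphism on prime spectra. -/
theorem PrimeSpectrum.isHomeomorph_comap_of_exists_add_nilpotent {R S : Type*} [CommRing R]
    [CommRing S] (f : R →+* S) (hker : RingHom.ker f ≤ nilradical R)
    (hf : ∀ s, ∃ r n, IsNilpotent n ∧ s = f r + n) :
    IsHomeomorph (PrimeSpectrum.comap f) := by
  let p := Ideal.Quotient.mk (nilradical S)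
  have hp : IsHomeomorph (PrimeSpectrum.comap p) := by
    refine PrimeSpectrum.isHomeomorph_comap p (fun x => ⟨1, one_pos, ?_⟩) (by rw [Ideal.mk_ker])
    obtain ⟨y, rfl⟩ := Ideal.Quotient.mk_surjective x
    exact ⟨y, (pow_one _).symm⟩
  -- Modulo the nilradical of `S` the map becomes surjective, with nil kernel. Since `comap p` is a
  -- homeomorphism too, `comap f` is recovered from `comap (p.comp f)`.
  have hg : IsHomeomorph (PrimeSpectrum.comap (p.comp f)) := by
    refine PrimeSpectrum.isHomeomorph_comap _ (fun x => ⟨1, one_pos, ?_⟩) fun r hr => ?_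
    · obtain ⟨s, rfl⟩ := Ideal.Quotient.mk_surjective x
      obtain ⟨r, n, hn, rfl⟩ := hf s
      refine ⟨r, ?_⟩
      rw [pow_one, map_add, Ideal.Quotient.eq_zero_iff_mem.2 (show n ∈ nilradical S from hn),
        add_zero]
      rfl
    · have : f r ∈ nilradical S := Ideal.Quotient.eq_zero_iff_mem.1 hr
      obtain ⟨n, hn⟩ := this
      rw [← map_pow] at hn
      obtain ⟨m, hm⟩ := hker hn
      exact ⟨n * m, by rw [pow_mul]; exact hm⟩
  have e : PrimeSpectrum.comap f = PrimeSpectrum.comap (p.comp f) ∘ (hp.homeomorph _).symm := by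
    funext x
    obtain ⟨y, rfl⟩ := hp.surjective x
    rw [Function.comp_apply]
    change _ = PrimeSpectrum.comap (p.comp f) ((hp.homeomorph _).symm ((hp.homeomorph _) y))
    rw [Homeomorph.symm_apply_apply]
    rfl
  rw [e]
  exact hg.comp (Homeomorph.isHomeomorph _)

namespace SAlg

variable {k : Type u} [Field k]

/-- Anticommutativity gives `2 a² = 0`. All later uses of the assumption on the characteristic go
through this lemma. -/
theorem odd_mul_self (hk : ringChar k ≠ 2) {A : SAlg k} {a : A} (ha : a ∈ A.grading 1) :
    a * a = 0 := by
  have h := odd_comm ha ha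
  have h2 : (2 : k) • (a * a) = 0 := by
    rw [two_smul]
    nth_rewrite 1 [h]
    exact neg_add_cancel _
  exact (smul_eq_zero.1 h2).resolve_left (Ring.two_ne_zero hk)

theorem odd_mul_odd_mem {A : SAlg k} {a b : A} (ha : a ∈ A.grading 1) (hb : b ∈ A.grading 1) :
    a * b ∈ A.grading 0 :=
  SetLike.mul_mem_graded ha hb

/-- Already the square vanishes: `abab = -aabb = 0`. -/
theorem isNilpotent_odd_mul_odd (hk : ringChar k ≠ 2) {A : SAlg k} {a b : A}
    (ha : a ∈ A.grading 1) (hb : b ∈ A.grading 1) :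
    IsNilpotent (⟨a * b, odd_mul_odd_mem ha hb⟩ : A.even) := by
  refine ⟨2, Subtype.ext ?_⟩
  rw [pow_two]
  change a * b * (a * b) = 0
  rw [mul_assoc, ← mul_assoc b, odd_comm hb ha, neg_mul, mul_neg, mul_assoc a b, odd_mul_self hk hb,
    mul_zero, mul_zero, neg_zero]

/-- Multiplying `e + o` by `c + d` gives the even part `c e + d o`: the first term stays in the
nilradical, and the second is a product of two odd elements. -/
theorem exists_add_of_mem_oddIdeal (hk : ringChar k ≠ 2) {A : SAlg k} {z : A}
    (hz : z ∈ A.oddIdeal) : ∃ e ∈ nilradical A.even, ∃ o ∈ A.grading 1, z = e + o := by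
  unfold oddIdeal at hz
  induction hz using Submodule.span_induction with
  | mem x hx => exact ⟨0, zero_mem _, x, hx, (zero_add _).symm⟩
  | zero => exact ⟨0, zero_mem _, 0, zero_mem _, (zero_add _).symm⟩
  | add x y _ _ hx hy =>
    obtain ⟨e, he, o, ho, rfl⟩ := hx
    obtain ⟨e', he', o', ho', rfl⟩ := hy
    exact ⟨e + e', add_mem he he', o + o', add_mem ho ho', add_add_add_comm _ _ _ _⟩
  | smul r x _ hx =>
    obtain ⟨e, he, o, ho, rfl⟩ := hx
    obtain ⟨c, hc, d, hd, rfl⟩ := A.exists_add r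
    refine ⟨⟨c, hc⟩ * e + ⟨d * o, odd_mul_odd_mem hd ho⟩, add_mem (Ideal.mul_mem_left _ _ he)
      (isNilpotent_odd_mul_odd hk hd ho), c * o + d * e, add_mem ?_ ?_, ?_⟩
    · simpa using SetLike.mul_mem_graded hc ho
    · simpa using SetLike.mul_mem_graded hd e.2
    · change (c + d) * (e + o) = c * e + d * o + (c * o + d * e)
      rw [add_mul, mul_add, mul_add]
      abel

theorem mem_nilradical_of_mem_oddIdeal (hk : ringChar k ≠ 2) {A : SAlg k} {a : A.even}
    (ha : (a : A) ∈ A.oddIdeal) : a ∈ nilradical A.even := by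
  obtain ⟨e, he, o, ho, h⟩ := exists_add_of_mem_oddIdeal hk ha
  have : o ∈ A.grading 0 := by
    rw [← add_sub_cancel_left (e : A) o, ← h]
    exact sub_mem a.2 e.2
  rw [Submodule.disjoint_def.1 A.isCompl.disjoint _ this ho, add_zero] at h
  rwa [Subtype.ext h]

theorem evenToAssoc_surjective (A : SAlg k) : Function.Surjective A.evenToAssoc := by
  intro x
  obtain ⟨a, rfl⟩ := Ideal.Quotient.mk_surjective x
  obtain ⟨c, hc, d, hd, rfl⟩ := A.exists_add a
  refine ⟨⟨c, hc⟩, ?_⟩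
  rw [map_add, Ideal.Quotient.eq_zero_iff_mem.2 (show d ∈ A.oddIdeal from Ideal.subset_span hd),
    add_zero]
  rfl

/-- `Spec (A / I_A) → Spec A₀` is a homeomorphism. -/
theorem isHomeomorph_comap_evenToAssoc (hk : ringChar k ≠ 2) (A : SAlg k) :
    IsHomeomorph (PrimeSpectrum.comap A.evenToAssoc) := by
  refine PrimeSpectrum.isHomeomorph_comap _ (fun x => ⟨1, one_pos, ?_⟩) fun r hr => ?_
  · obtain ⟨y, rfl⟩ := A.evenToAssoc_surjective x
    exact ⟨y, (pow_one _).symm⟩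
  · exact mem_nilradical_of_mem_oddIdeal hk (Ideal.Quotient.eq_zero_iff_mem.1 hr)

theorem mem_filt_one {A : SAlg k} {a : A} : a ∈ A.filt 1 ↔ a ∈ A.oddIdeal := by
  change a ∈ A.oddIdeal ^ 1 ↔ _
  rw [Submodule.pow_one]

theorem symb_eq_zero_iff {A : SAlg k} {n : ℕ} {a : A.filt n} :
    A.symb n a = 0 ↔ (a : A) ∈ A.filt (n + 1) :=
  Submodule.Quotient.mk_eq_zero _

theorem evenToGr_grMap {A B : SAlg k} (f : A ⟶ B) (a : A.even) :
    evenMap (grMap f) (A.evenToGr a) = B.evenToGr (evenMap f a) :=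
  Subtype.ext (grAlgHom_of f _)

theorem even_smul_mem_filt {A : SAlg k} (c : A.even) {n : ℕ} {a : A} (ha : a ∈ A.filt n) :
    c • a ∈ A.filt n := by
  have := mul_mem_filt (mem_filt_zero (c : A)) ha
  rwa [zero_add] at this

/-- A free target degree `l` avoids casts between pieces such as `0 + n` and `n`. -/
theorem of_symb_mul_of_symb' {A : SAlg k} {m n l : ℕ} (e : m + n = l) (a : A.filt m)
    (b : A.filt n) (c : A.filt l) (hc : (a : A) * b = c) :
    DirectSum.of A.GrPiece m (A.symb m a) * DirectSum.of A.GrPiece n (A.symb n b) =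
      DirectSum.of A.GrPiece l (A.symb l c) := by
  subst e
  rw [of_symb_mul_of_symb]
  congr 2
  exact Subtype.ext hc

theorem evenToGr_smul_of {A : SAlg k} (c : A.even) {n : ℕ} (a : A.filt n) :
    A.evenToGr c • (show A.gr from DirectSum.of A.GrPiece n (A.symb n a)) =
      DirectSum.of A.GrPiece n (A.symb n ⟨c • (a : A), even_smul_mem_filt c a.2⟩) :=
  of_symb_mul_of_symb' (zero_add n) _ _ _ rfl

/-- Since `n + 2` is even, `n + 1` is odd. From `I ^ (n + 2) = I * I ^ (n + 1)`, the class is a sum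
of products of classes of degrees 1 and `n + 1`, both odd in `gr A`. -/
theorem isNilpotent_of_symb (hk : ringChar k ≠ 2) {A : SAlg k} {n : ℕ}
    (hn : ((n + 2 : ℕ) : ZMod 2) = 0) (a : A.filt (n + 2)) :
    ∃ x : A.gr.even, IsNilpotent x ∧
      DirectSum.of A.GrPiece (n + 2) (A.symb (n + 2) a) = (x : A.gr) := by
  have hn' : ((n + 1 : ℕ) : ZMod 2) = 1 := by
    have : ((n + 1 : ℕ) : ZMod 2) + 1 = 0 := by exact_mod_cast hn
    rcases zmod_two_cases ((n + 1 : ℕ) : ZMod 2) with h | h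
    · rw [h] at this; exact absurd this (by decide)
    · exact h
  have e : 1 + (n + 1) = n + 2 := by ring
  obtain ⟨a, ha⟩ := a
  have ha' : a ∈ A.oddIdeal * A.oddIdeal ^ (n + 1) := by
    rw [← Ideal.IsTwoSided.pow_succ]; exact ha
  -- The membership proof is bundled into the claim so that induction over sums of products can be
  -- applied to the bare element `a`.
  suffices key : ∃ h : a ∈ A.filt (n + 2), ∃ x : A.gr.even, IsNilpotent x ∧
      DirectSum.of A.GrPiece (n + 2) (A.symb (n + 2) ⟨a, h⟩) = (x : A.gr) from key.2
  refine Submodule.mul_induction_on ha' ?_ ?_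
  · intro x hx y hy
    have hx' : x ∈ A.filt 1 := mem_filt_one.2 hx
    have hy' : y ∈ A.filt (n + 1) := hy
    refine ⟨e ▸ mul_mem_filt hx' hy', _, isNilpotent_odd_mul_odd hk (A := A.gr)
      (of_mem_grGrading (A := A) (n := 1) (i := 1) Nat.cast_one (A.symb 1 ⟨x, hx'⟩))
      (of_mem_grGrading (A := A) (n := n + 1) (i := 1) hn' (A.symb (n + 1) ⟨y, hy'⟩)), ?_⟩
    exact (of_symb_mul_of_symb' e (⟨x, hx'⟩ : A.filt 1) (⟨y, hy'⟩ : A.filt (n + 1)) ⟨x * y, _⟩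
      rfl).symm
  · rintro x y ⟨hx, p, hp, hxp⟩ ⟨hy, q, hq, hyq⟩
    refine ⟨add_mem hx hy, p + q, (Commute.all _ _).isNilpotent_add hp hq, ?_⟩
    exact (congrArg (DirectSum.of A.GrPiece (n + 2))
      (map_add (A.symb (n + 2)) ⟨x, hx⟩ ⟨y, hy⟩)).trans
        ((map_add _ _ _).trans (congrArg₂ _ hxp hyq))

theorem exists_evenToGr_add (hk : ringChar k ≠ 2) {A : SAlg k} (x : A.gr.even) :
    ∃ (c : A.even) (n : A.gr.even), IsNilpotent n ∧ x = A.evenToGr c + n := by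
  suffices ∃ (c : A.even) (n : A.gr.even), IsNilpotent n ∧ (x : A.gr) = A.evenToGr c + n by
    obtain ⟨c, n, hn, h⟩ := this
    exact ⟨c, n, hn, Subtype.ext h⟩
  refine gr_induction (A := A) (i := 0) (p := fun x => ∃ (c : A.even) (n : A.gr.even),
    IsNilpotent n ∧ x = (A.evenToGr c : A.gr) + (n : A.gr)) ?_ ?_ ?_ x.2
  · refine ⟨0, 0, IsNilpotent.zero, ?_⟩
    rw [map_zero]
    exact (zero_add _).symm
  · rintro x y ⟨c, n, hn, rfl⟩ ⟨c', n', hn', rfl⟩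
    refine ⟨c + c', n + n', (Commute.all _ _).isNilpotent_add hn hn', ?_⟩
    rw [map_add]
    exact add_add_add_comm _ _ _ _
  -- In degree 0 the odd part of a representative lies in `I_A` and can be dropped; degree 1 is
  -- excluded by parity; even degrees from 2 on are nilpotent.
  · rintro (_ | _ | n) a hn
    · obtain ⟨a, ha⟩ := a
      obtain ⟨c, hc, d, hd, rfl⟩ := A.exists_add a
      refine ⟨⟨c, hc⟩, 0, IsNilpotent.zero, ?_⟩
      refine Eq.trans ?_ (add_zero _).symm
      refine congrArg (DirectSum.of A.GrPiece 0) ?_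
      rw [← sub_eq_zero, ← map_sub]
      refine symb_eq_zero ?_
      change c + d - c ∈ _
      rw [add_sub_cancel_left]
      exact odd_mem_filt_one hd
    · exact absurd hn (by decide)
    · obtain ⟨x, hx, h⟩ := isNilpotent_of_symb hk hn a
      refine ⟨0, x, hx, ?_⟩
      rw [map_zero]
      exact h.trans (zero_add _).symm

/-- `Spec (gr A)₀ → Spec A₀` is a homeomorphism. -/
theorem isHomeomorph_comap_evenToGr (hk : ringChar k ≠ 2) (A : SAlg k) :
    IsHomeomorph (PrimeSpectrum.comap A.evenToGr) := by
  refine PrimeSpectrum.isHomeomorph_comap_of_exists_add_nilpotent _ (fun a ha => ?_)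
    (exists_evenToGr_add hk)
  have h : DirectSum.of A.GrPiece 0 (A.symb 0 ⟨a, mem_filt_zero _⟩) = 0 := congrArg Subtype.val ha
  rw [← map_zero (DirectSum.of A.GrPiece 0)] at h
  exact mem_nilradical_of_mem_oddIdeal hk
    (mem_filt_one.1 (symb_eq_zero_iff.1 (DirectSum.of_injective 0 h)))

end SAlg

/-! ### Associated graded superalgebras and localization. -/

namespace SAlg

variable {k : Type u} [Field k]

/-- The element `b` of `B` becomes at the prime `q` a fraction with numerator in `I_A ^ n`. -/
def IsFracAt {A B : SAlg k} (f : A ⟶ B) (q : PrimeSpectrum B.even) (n : ℕ) (b : B) : Prop :=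
  ∃ a ∈ A.filt n, ∃ (s : A.even) (u : B.even), evenMap f s ∉ q.asIdeal ∧ u ∉ q.asIdeal ∧
    u • evenMap f s • b = u • Hom.toAlgHom f a

theorem IsFracAt.zero {A B : SAlg k} (f : A ⟶ B) (q : PrimeSpectrum B.even) (n : ℕ) :
    IsFracAt f q n 0 :=
  ⟨0, zero_mem _, 1, 1, by rw [map_one]; exact one_notMem q, one_notMem q, by simp⟩

theorem IsFracAt.add {A B : SAlg k} {f : A ⟶ B} {q : PrimeSpectrum B.even} {n : ℕ} {b b' : B}
    (h : IsFracAt f q n b) (h' : IsFracAt f q n b') : IsFracAt f q n (b + b') := by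
  obtain ⟨a, ha, s, u, hs, hu, h⟩ := h
  obtain ⟨a', ha', s', u', hs', hu', h'⟩ := h'
  refine ⟨s' • a + s • a', add_mem (even_smul_mem_filt _ ha) (even_smul_mem_filt _ ha'), s * s',
    u * u', ?_, mul_notMem q hu hu', ?_⟩
  · rw [map_mul]; exact mul_notMem q hs hs'
  · rw [map_add, map_mul, map_even_smul, map_even_smul]
    linear_combination (norm := skip) (u' * evenMap f s') • h + (u * evenMap f s) • h'
    module

theorem IsFracAt.mul {A B : SAlg k} {f : A ⟶ B} {q : PrimeSpectrum B.even} {m n : ℕ} {b b' : B}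
    (h : IsFracAt f q m b) (h' : IsFracAt f q n b') : IsFracAt f q (m + n) (b * b') := by
  obtain ⟨a, ha, s, u, hs, hu, h⟩ := h
  obtain ⟨a', ha', s', u', hs', hu', h'⟩ := h'
  refine ⟨a * a', mul_mem_filt ha ha', s * s', u * u', ?_, mul_notMem q hu hu', ?_⟩
  · rw [map_mul]; exact mul_notMem q hs hs'
  · have := congrArg₂ (· * ·) h h'
    simp only [smul_mul_smul_comm] at this
    rwa [map_mul, map_mul]

/-- Odd elements are fractions with odd numerator, which settles the generators of `I_B`. Fractions
add and multiply compatibly with the filtration, so `I_B ^ n` is locally generated by fractions with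
numerator in `I_A ^ n`. -/
theorem IsLocIso.isFracAt {A B : SAlg k} {f : A ⟶ B} (hf : IsLocIso f)
    (q : PrimeSpectrum B.even) {n : ℕ} {b : B} (hb : b ∈ B.filt n) : IsFracAt f q n b := by
  have h0 : ∀ b, IsFracAt f q 0 b := fun b => by
    obtain ⟨a, s, u, h⟩ := hf.exists_frac q b
    exact ⟨a, mem_filt_zero _, s, u, h⟩
  have h1 : ∀ b ∈ B.oddIdeal, IsFracAt f q 1 b := by
    intro b hb
    unfold oddIdeal at hb
    induction hb using Submodule.span_induction with
    | mem x hx =>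
      obtain ⟨a, ha, s, u, h⟩ := hf.exists_frac_odd q hx
      exact ⟨a, odd_mem_filt_one ha, s, u, h⟩
    | zero => exact .zero f q 1
    | add x y _ _ hx hy => exact hx.add hy
    | smul r x _ hx =>
      have := (h0 r).mul hx
      rwa [zero_add] at this
  induction n generalizing b with
  | zero => exact h0 b
  | succ n ih =>
    change b ∈ B.oddIdeal ^ (n + 1) at hb
    rw [Ideal.IsTwoSided.pow_succ] at hb
    refine Submodule.mul_induction_on hb (fun x hx y hy => ?_) fun _ _ => .add
    rw [add_comm]
    exact (h1 x hx).mul (ih hy)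

/-- The projection of `gr A` to its component of degree `n`. -/
def grProj (A : SAlg k) (n : ℕ) : A.gr →+ A.gr where
  toFun x := DirectSum.of A.GrPiece n (DFunLike.coe (F := A.Gr) x n)
  map_zero' := map_zero (DirectSum.of A.GrPiece n)
  map_add' _ _ := map_add (DirectSum.of A.GrPiece n) _ _

theorem grProj_of_same {A : SAlg k} (n : ℕ) (a : A.GrPiece n) :
    A.grProj n (DirectSum.of A.GrPiece n a) = DirectSum.of A.GrPiece n a :=
  congrArg (DirectSum.of A.GrPiece n) (DirectSum.of_eq_same n a)

theorem grProj_of_ne {A : SAlg k} {m n : ℕ} (h : m ≠ n) (a : A.GrPiece m) :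
    A.grProj n (DirectSum.of A.GrPiece m a) = 0 :=
  (congrArg (DirectSum.of A.GrPiece n) (DirectSum.of_eq_of_ne m n a h.symm)).trans (map_zero _)

/-- Induction on elements of `gr A`. -/
theorem gr_induction' {A : SAlg k} {p : A.gr → Prop} (h0 : p 0)
    (hadd : ∀ x y, p x → p y → p (x + y))
    (hof : ∀ (n : ℕ) (a : A.filt n), p (DirectSum.of A.GrPiece n (A.symb n a))) (x : A.gr) :
    p x := by
  refine DirectSum.induction_on (motive := p) x h0 (fun n a => ?_) hadd
  obtain ⟨a, rfl⟩ := A.symb_surjective n a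
  exact hof n a

theorem grProj_evenToGr_smul {A : SAlg k} (n : ℕ) (c : A.even) (x : A.gr) :
    A.grProj n (A.evenToGr c • x) = A.evenToGr c • A.grProj n x := by
  induction x using gr_induction' with
  | h0 => rw [smul_zero, map_zero, smul_zero]
  | hadd x y hx hy => rw [smul_add, map_add, map_add, smul_add, hx, hy]
  | hof m a =>
    have := evenToGr_smul_of c a
    by_cases h : m = n
    · subst h
      rw [grProj_of_same]
      exact (congrArg (A.grProj m) this).trans ((grProj_of_same m _).trans this.symm)
    · rw [grProj_of_ne h, smul_zero]
      exact (congrArg (A.grProj n) this).trans (grProj_of_ne h _)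

theorem grProj_grMap {A B : SAlg k} (f : A ⟶ B) (n : ℕ) (x : A.gr) :
    B.grProj n (Hom.toAlgHom (grMap f) x) = Hom.toAlgHom (grMap f) (A.grProj n x) := by
  induction x using gr_induction' with
  | h0 => simp only [map_zero]
  | hadd x y hx hy => simp only [map_add, hx, hy]
  | hof m a =>
    have : Hom.toAlgHom (grMap f) (DirectSum.of A.GrPiece m (A.symb m a)) =
      DirectSum.of B.GrPiece m (grPieceMap f m (A.symb m a)) := grAlgHom_of f _
    by_cases h : m = n
    · subst h
      rw [grProj_of_same, this, grProj_of_same]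
    · rw [grProj_of_ne h, map_zero, this, grProj_of_ne h]

theorem exists_finset_sum_grProj {A : SAlg k} (x : A.gr) :
    ∃ S : Finset ℕ, x = ∑ n ∈ S, A.grProj n x := by
  classical
  exact ⟨_, (DirectSum.sum_support_of (show A.Gr from x)).symm⟩

/-- Elements outside a prime of `(gr A)₀` have a multiple that comes from `A₀`. -/
theorem exists_mul_eq_evenToGr (hk : ringChar k ≠ 2) {A : SAlg k} (q : PrimeSpectrum A.gr.even)
    {t : A.gr.even} (ht : t ∉ q.asIdeal) :
    ∃ (t' : A.gr.even) (c : A.even), t' * t = A.evenToGr c ∧ A.evenToGr c ∉ q.asIdeal := by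
  obtain ⟨c, n, ⟨N, hN⟩, rfl⟩ := exists_evenToGr_add hk t
  -- With `n ^ N = 0`, the element `c + n = c - (-n)` divides `c ^ N - (-n) ^ N = c ^ N`, which
  -- comes from `A₀`.
  have h1 : A.evenToGr c + n ∣ A.evenToGr c ^ N - (-n) ^ N := by
    have := sub_dvd_pow_sub_pow (A.evenToGr c) (-n) N
    rwa [sub_neg_eq_add] at this
  rw [neg_pow, hN, mul_zero, sub_zero] at h1
  obtain ⟨t', h2⟩ := h1
  refine ⟨t', c ^ N, by rw [map_pow, h2, mul_comm], fun h => ht ?_⟩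
  rw [map_pow] at h
  refine add_mem (q.2.mem_of_pow_mem _ h) (q.2.mem_of_pow_mem N ?_)
  rw [hN]
  exact zero_mem _

/-- This is injectivity of `I_A ^ n / I_A ^ (n + 1) → I_B ^ n / I_B ^ (n + 1)` after localization,
and it serves both `gr` and (with `n = 0`) the quotient `A / I_A`. -/
theorem IsLocIso.exists_smul_mem_filt_succ {A B : SAlg k} {f : A ⟶ B} (hf : IsLocIso f)
    (q : PrimeSpectrum B.even) {n : ℕ} (a : A.filt n) {c : B.even} (hc : c ∉ q.asIdeal)
    (h : c • Hom.toAlgHom f a ∈ B.filt (n + 1)) :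
    ∃ v : A.even, evenMap f v ∉ q.asIdeal ∧ v • (a : A) ∈ A.filt (n + 1) := by
  obtain ⟨a', ha', s, u, hs, hu, h1⟩ := hf.isFracAt q h
  obtain ⟨c', v, hc', hv, w, hw, h2⟩ := hf.exists_mul_eq_evenMap q hc
  -- Locally `c f(a) = f(a') / f(s)` with `a'` in `I_A ^ (n + 1)`, and `c = f(c') / f(w)`. Clearing
  -- denominators shows that `s c' a - w a'` dies at `q`, hence is killed by some `v'` from `A₀`.
  obtain ⟨v', hv', h3⟩ := hf.exists_smul_eq_zero q ((s * c') • (a : A) - w • a') (u * v)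
    (mul_notMem q hu hv) (by
      rw [map_sub, map_even_smul, map_even_smul, map_mul]
      linear_combination (norm := skip) (v * evenMap f w) • h1 -
        h2 • ((u * evenMap f s) • Hom.toAlgHom f a)
      module)
  refine ⟨v' * (s * c'), ?_, ?_⟩
  · rw [map_mul, map_mul]
    exact mul_notMem q hv' (mul_notMem q hs hc')
  · rw [smul_sub, sub_eq_zero] at h3
    rw [mul_smul, h3]
    exact even_smul_mem_filt _ (even_smul_mem_filt _ ha')

/-- Passing to associated graded superalgebras is compatible with localization. -/
theorem IsLocIso.grMap (hk : ringChar k ≠ 2) {A B : SAlg k} {f : A ⟶ B} (hf : IsLocIso f) :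
    IsLocIso (grMap f) where
  exists_frac q b := by
    let p : PrimeSpectrum B.even := PrimeSpectrum.comap B.evenToGr q
    -- Index 0 imposes no condition on the numerator. The predicate is used for its additivity,
    -- which reduces the claim to homogeneous elements.
    have key : IsFracAt (SAlg.grMap f) q 0 b := by
      induction b using gr_induction' with
      | h0 => exact .zero _ q 0
      | hadd x y hx hy => exact hx.add hy
      | hof n b =>
        obtain ⟨a, ha, s, u, hs, hu, h⟩ := hf.isFracAt p b.2
        refine ⟨DirectSum.of A.GrPiece n (A.symb n ⟨a, ha⟩), mem_filt_zero _, A.evenToGr s,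
          B.evenToGr u, ?_, hu, ?_⟩
        · rw [evenToGr_grMap]; exact hs
        · rw [evenToGr_grMap]
          have e1 : Hom.toAlgHom (SAlg.grMap f) (DirectSum.of A.GrPiece n (A.symb n ⟨a, ha⟩)) =
            DirectSum.of B.GrPiece n (B.symb n (filtMap f n ⟨a, ha⟩)) := grAlgHom_of f _
          rw [e1]
          have e2 := evenToGr_smul_of (evenMap f s) b
          have e3 := evenToGr_smul_of u ⟨evenMap f s • (b : B), even_smul_mem_filt _ b.2⟩
          have e4 := evenToGr_smul_of u (filtMap f n ⟨a, ha⟩)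
          refine (congrArg (B.evenToGr u • ·) e2).trans (e3.trans (Eq.trans ?_ e4.symm))
          exact congrArg (fun z => DirectSum.of B.GrPiece n (B.symb n z)) (Subtype.ext h)
    obtain ⟨a, -, s, u, h⟩ := key
    exact ⟨a, s, u, h⟩
  exists_smul_eq_zero q a u hu h := by
    classical
    let p : PrimeSpectrum B.even := PrimeSpectrum.comap B.evenToGr q
    obtain ⟨u', c, hc, hc'⟩ := exists_mul_eq_evenToGr hk q hu
    -- Replacing `u` by a multiple that comes from `B₀` makes the multiplier preserve degrees, so
    -- the relation can be read degree by degree.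
    have h1 : B.evenToGr c • Hom.toAlgHom (SAlg.grMap f) a = 0 := by
      rw [← hc, mul_smul, h, smul_zero]
    have h2 : ∀ n, ∃ v : A.even, evenMap f v ∉ p.asIdeal ∧ A.evenToGr v • A.grProj n a = 0 := by
      intro n
      obtain ⟨a', ha'⟩ := A.symb_surjective n (DFunLike.coe (F := A.Gr) a n)
      have e0 : A.grProj n a = DirectSum.of A.GrPiece n (A.symb n a') :=
        congrArg (DirectSum.of A.GrPiece n) ha'.symm
      have h3 := congrArg (B.grProj n) h1
      rw [grProj_evenToGr_smul, grProj_grMap, map_zero, e0] at h3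
      have e1 : Hom.toAlgHom (SAlg.grMap f) (DirectSum.of A.GrPiece n (A.symb n a')) =
        DirectSum.of B.GrPiece n (B.symb n (filtMap f n a')) := grAlgHom_of f _
      rw [e1] at h3
      have h4 := (evenToGr_smul_of c (filtMap f n a')).symm.trans h3
      have h5 := DirectSum.of_injective n (h4.trans (map_zero (DirectSum.of B.GrPiece n)).symm)
      obtain ⟨v, hv, h6⟩ := hf.exists_smul_mem_filt_succ p a' hc' (symb_eq_zero_iff.1 h5)
      refine ⟨v, hv, ?_⟩
      rw [e0]
      refine (evenToGr_smul_of v a').trans ?_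
      rw [symb_eq_zero h6, map_zero]
      rfl
    choose v hv hv' using h2
    obtain ⟨S, hS⟩ := exists_finset_sum_grProj a
    -- Only finitely many components of `a` matter, so the multipliers of the single degrees can be
    -- multiplied together.
    refine ⟨A.evenToGr (∏ n ∈ S, v n), ?_, ?_⟩
    · rw [evenToGr_grMap, map_prod]
      change (∏ n ∈ S, evenMap f (v n)) ∈ p.asIdeal.primeCompl
      exact Submonoid.prod_mem _ fun n _ => hv n
    · rw [hS, Finset.smul_sum]
      refine Finset.sum_eq_zero fun n hn => ?_
      rw [← Finset.prod_erase_mul S v hn, map_mul, mul_smul, hv' n, smul_zero]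

end SAlg

/-! ### Sections over basic open subsets. -/

namespace SAlg

variable {k : Type u} [Field k]

/-- The sections are by definition those of the sheaf associated with `A` as an `A₀`-module on `Spec
A₀`, so the known description of its global sections applies. -/
theorem toSections_top_bijective (A : SAlg k) :
    Function.Bijective (Hom.toAlgHom (A.toSections ⊤)) :=
  StructureSheaf.toOpenₗ_top_bijective (R := A.even) (M := A)

theorem evenMap_toSections_smul_apply {A : SAlg k} {U : Opens (PrimeSpectrum A.even)} (g : A.even)
    (s : A.specSections U) (x : U) :
    (evenMap (A.toSections U) g • s).1 x = frac x.1 (g : A) 1 * s.1 x := rfl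

theorem sections_basicOpen_surj {A : SAlg k} (g : A.even)
    (s : A.specSections (PrimeSpectrum.basicOpen g)) :
    ∃ (n : ℕ) (a : A), evenMap (A.toSections (PrimeSpectrum.basicOpen g)) (g ^ n) • s =
      Hom.toAlgHom (A.toSections (PrimeSpectrum.basicOpen g)) a := by
  obtain ⟨⟨a, _, n, rfl⟩, h⟩ := IsLocalizedModule.surj (.powers g)
    (StructureSheaf.toOpenₗ A.even A (PrimeSpectrum.basicOpen g)) s
  refine ⟨n, a, Eq.trans ?_ h⟩
  -- Two actions of `g ^ n` must be matched: multiplication by the constant section and the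
  -- `A₀`-module structure of the sheaf.
  refine sections_ext (A := A) fun x => ?_
  rw [evenMap_toSections_smul_apply]
  obtain ⟨b, t, hb⟩ := frac_surjective (s.1 x)
  rw [← hb, frac_mul, one_mul]
  have h2 : ((g ^ n) • (LocalizedModule.mk b t) : LocalizedModule x.1.asIdeal.primeCompl A) =
    LocalizedModule.mk ((g ^ n) • b) t := LocalizedModule.smul'_mk _ _ _
  refine Eq.trans h2.symm ?_
  exact congrArg (fun z : LocalizedModule x.1.asIdeal.primeCompl A => (g ^ n) • z) hb

theorem sections_basicOpen_eq_zero {A : SAlg k} {g : A.even} {a : A}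
    (h : Hom.toAlgHom (A.toSections (PrimeSpectrum.basicOpen g)) a = 0) :
    ∃ n : ℕ, g ^ n • a = 0 := by
  obtain ⟨⟨_, n, rfl⟩, h⟩ := (IsLocalizedModule.eq_zero_iff (.powers g)
    (StructureSheaf.toOpenₗ A.even A (PrimeSpectrum.basicOpen g))).1 h
  exact ⟨n, h⟩

theorem isUnit_evenMap_toSections {A : SAlg k} (g : A.even) :
    IsUnit (evenMap (A.toSections (PrimeSpectrum.basicOpen g)) g) := by
  refine IsUnit.of_mul_eq_one (⟨⟨fun x => frac x.1 1 ⟨g, x.2⟩, fun x =>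
    ⟨_, x.2, 𝟙 _, 1, g, fun y => ⟨y.2, rfl⟩⟩⟩, fun x =>
      ⟨1, SetLike.one_mem_graded A.grading, ⟨g, x.2⟩, rfl⟩⟩ :
        (A.specSections (PrimeSpectrum.basicOpen g)).even) (Subtype.ext (sections_ext fun x => ?_))
  change frac x.1 (g : A) 1 * frac x.1 1 ⟨g, x.2⟩ = 1
  rw [frac_mul, ← frac_one, frac_eq_iff]
  refine ⟨1, one_notMem x.1, ?_⟩
  simp only [one_smul, mul_one, one_mul]
  change (1 : A) * g = g * 1
  rw [one_mul, mul_one]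

theorem sections_basicOpen_surj_even {A : SAlg k} (g : A.even)
    (s : (A.specSections (PrimeSpectrum.basicOpen g)).even) :
    ∃ (n : ℕ) (a : A.even), evenMap (A.toSections (PrimeSpectrum.basicOpen g)) (g ^ n) * s =
      evenMap (A.toSections (PrimeSpectrum.basicOpen g)) a := by
  obtain ⟨n, a, h⟩ := sections_basicOpen_surj g s.1
  obtain ⟨c, hc, d, hd, rfl⟩ := A.exists_add a
  refine ⟨n, ⟨c, hc⟩, Subtype.ext ?_⟩
  set f := A.toSections (PrimeSpectrum.basicOpen g)
  change evenMap f (g ^ n) • s.1 = Hom.toAlgHom f c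
  have h0 : evenMap f (g ^ n) • s.1 - Hom.toAlgHom f c ∈ SAlg.grading _ 0 :=
    sub_mem (even_smul_mem _ s.2) (Hom.map_mem f 0 _ hc)
  have h1 : evenMap f (g ^ n) • s.1 - Hom.toAlgHom f c ∈ SAlg.grading _ 1 := by
    rw [h, map_add, add_sub_cancel_left]
    exact Hom.map_mem f 1 _ hd
  exact sub_eq_zero.1 (Submodule.disjoint_def.1 (SAlg.isCompl _).disjoint _ h0 h1)

theorem notMem_of_isUnit {R : Type u} [CommRing R] (x : PrimeSpectrum R) {a : R} (ha : IsUnit a) :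
    a ∉ x.asIdeal := fun h => x.2.ne_top (Ideal.eq_top_of_isUnit_mem _ h ha)

/-- Sections over `D(g)` have powers of `g` as denominators, these become units there, and an
element vanishing on `D(g)` is killed by a power of `g`. -/
theorem isLocIso_toSections {A : SAlg k} (g : A.even) :
    IsLocIso (A.toSections (PrimeSpectrum.basicOpen g)) where
  exists_frac q b := by
    obtain ⟨n, a, h⟩ := sections_basicOpen_surj g b
    refine ⟨a, g ^ n, 1, ?_, one_notMem q, by rw [h]⟩
    rw [map_pow]
    exact notMem_of_isUnit q ((isUnit_evenMap_toSections g).pow n)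
  exists_smul_eq_zero q a u hu h := by
    obtain ⟨n, c, hc⟩ := sections_basicOpen_surj_even g u
    have h1 : Hom.toAlgHom (A.toSections (PrimeSpectrum.basicOpen g)) (c • a) = 0 := by
      rw [map_even_smul, ← hc, mul_smul, h, smul_zero]
    obtain ⟨m, hm⟩ := sections_basicOpen_eq_zero h1
    refine ⟨g ^ m * c, ?_, by rw [mul_smul, hm]⟩
    rw [map_mul, ← hc, map_pow, map_pow]
    exact mul_notMem q (notMem_of_isUnit q ((isUnit_evenMap_toSections g).pow m))
      (mul_notMem q (notMem_of_isUnit q ((isUnit_evenMap_toSections g).pow n)) hu)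

/-- This makes the topological facts on localizations of commutative rings available for
`specPoint`. -/
theorem isLocalization_even_toSections {A : SAlg k} (g : A.even) :
    @IsLocalization.Away _ _ g (A.specSections (PrimeSpectrum.basicOpen g)).even _
      (evenMap (A.toSections (PrimeSpectrum.basicOpen g))).toAlgebra := by
  let _ := (evenMap (A.toSections (PrimeSpectrum.basicOpen g))).toAlgebra
  refine (isLocalization_iff _ _).2 ⟨?_, ?_, ?_⟩
  · rintro ⟨_, n, rfl⟩
    change IsUnit (evenMap (A.toSections (PrimeSpectrum.basicOpen g)) (g ^ n))
    rw [map_pow]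
    exact (isUnit_evenMap_toSections g).pow n
  · intro s
    obtain ⟨n, a, h⟩ := sections_basicOpen_surj_even g s
    exact ⟨⟨a, g ^ n, n, rfl⟩, (mul_comm _ _).trans h⟩
  · intro a b h
    have h1 : Hom.toAlgHom (A.toSections (PrimeSpectrum.basicOpen g)) (a - b : A) = 0 := by
      rw [map_sub, sub_eq_zero]
      exact congrArg Subtype.val h
    obtain ⟨n, hn⟩ := sections_basicOpen_eq_zero h1
    refine ⟨⟨g ^ n, n, rfl⟩, Subtype.ext ?_⟩
    rw [smul_sub, sub_eq_zero] at hn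
    exact hn

theorem isOpenEmbedding_specPoint_toSections {A : SAlg k} (g : A.even) :
    Topology.IsOpenEmbedding (specPoint (A.toSections (PrimeSpectrum.basicOpen g))) := by
  let _ := (evenMap (A.toSections (PrimeSpectrum.basicOpen g))).toAlgebra
  have := isLocalization_even_toSections g
  exact PrimeSpectrum.localization_away_isOpenEmbedding
    (A.specSections (PrimeSpectrum.basicOpen g)).even g

theorem range_specPoint_toSections {A : SAlg k} (g : A.even) :
    Set.range (specPoint (A.toSections (PrimeSpectrum.basicOpen g))) =
      PrimeSpectrum.basicOpen g := by
  let _ := (evenMap (A.toSections (PrimeSpectrum.basicOpen g))).toAlgebra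
  have := isLocalization_even_toSections g
  exact PrimeSpectrum.localization_away_comap_range
    (A.specSections (PrimeSpectrum.basicOpen g)).even g

theorem evenMap_bijective {A B : SAlg k} (f : A ⟶ B) [IsIso f] :
    Function.Bijective (evenMap f) := by
  constructor
  · intro a b h
    exact Subtype.ext ((bijective_of_isIso f).1 (congrArg Subtype.val h))
  · intro b
    refine ⟨⟨Hom.toAlgHom (inv f) b, Hom.map_mem (inv f) 0 _ b.2⟩, Subtype.ext ?_⟩
    exact congrArg (fun g => Hom.toAlgHom g (b : B)) (IsIso.inv_hom_id f)

theorem exists_isIso_fac {A B C : SAlg k} (f : A ⟶ C) (g : B ⟶ C) (hf : IsIso f) (hg : IsIso g) :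
    ∃ ψ : A ⟶ B, IsIso ψ ∧ ∀ a, Hom.toAlgHom g (Hom.toAlgHom ψ a) = Hom.toAlgHom f a := by
  refine ⟨f ≫ inv g, inferInstance, fun a => ?_⟩
  exact congrArg (fun h => Hom.toAlgHom h (Hom.toAlgHom f a)) (IsIso.inv_hom_id g)

theorem isOpenEmbedding_specPoint_of_isIso {A B : SAlg k} (f : A ⟶ B) [IsIso f] :
    Topology.IsOpenEmbedding (specPoint f) :=
  (PrimeSpectrum.isHomeomorph_comap_of_bijective (evenMap_bijective f)).isOpenEmbedding

end SAlg

open SAlg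

variable {k : Type u} [Field k]

/-! ### Affine open subsets: canonical charts and the basis property. -/

theorem pull_specMap_apply {A B : SAlg k} (f : A ⟶ B) {W : Opens (PrimeSpectrum A.even)}
    {W' : Opens (PrimeSpectrum B.even)} (h : ∀ y ∈ W', specPoint f y ∈ W) (s : A.specSections W)
    (y : W') :
    (show B.specSections W' from pull (specMap f) W W' h s).1 y =
      locMap f y.1 (s.1 ⟨PrimeSpectrum.comap (evenMap f) y.1, h y.1 y.2⟩) := rfl

theorem pull_specMap_toSections {A B : SAlg k} (f : A ⟶ B) {W : Opens (PrimeSpectrum A.even)}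
    {W' : Opens (PrimeSpectrum B.even)} (h : ∀ y ∈ W', specPoint f y ∈ W) (a : A) :
    pull (specMap f) W W' h (Hom.toAlgHom (A.toSections W) a) =
      Hom.toAlgHom (B.toSections W') (Hom.toAlgHom f a) := by
  refine sections_ext (A := B) fun y => ?_
  refine (pull_specMap_apply f h _ y).trans ((locMap_frac f y.1 a 1).trans ?_)
  exact congrArg (frac y.1 _) (Subtype.ext (map_one (evenMap f)))

/-- The pullback of sections as a morphism of superalgebras. -/
def pullHom {Y Z : PresheafedSpace.{u} (SAlg k)} (e : Y ⟶ Z) (W : Opens Z) (W' : Opens Y)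
    (h : ∀ y ∈ W', e.base y ∈ W) : Z.presheaf.obj (op W) ⟶ Y.presheaf.obj (op W') where
  toAlgHom := pull e W W' h
  map_mem _ _ hs := pull_map_mem e W W' h hs

theorem isAffineOpenSuper_of_isOpenImmersion {X : PresheafedSpace.{u} (SAlg k)} {A : SAlg k}
    (e : A.SSpec ⟶ X) [PresheafedSpace.IsOpenImmersion e] {U : Opens X}
    (hU : Set.range e.base = U) : IsAffineOpenSuper X U :=
  ⟨A, ⟨PresheafedSpace.IsOpenImmersion.isoOfRangeEq (X.ofRestrict U.isOpenEmbedding) e (by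
    rw [hU]; exact Subtype.range_coe)⟩⟩

theorem IsAffineOpenSuper.exists_isOpenImmersion {X : PresheafedSpace.{u} (SAlg k)} {U : Opens X}
    (hU : IsAffineOpenSuper X U) : ∃ (A : SAlg k) (e : A.SSpec ⟶ X),
      PresheafedSpace.IsOpenImmersion e ∧ Set.range e.base = U := by
  obtain ⟨A, ⟨i⟩⟩ := hU
  refine ⟨A, i.inv ≫ X.ofRestrict U.isOpenEmbedding, inferInstance, ?_⟩
  have : Function.Surjective i.inv.base := by
    intro x
    refine ⟨i.hom.base x, ?_⟩
    exact congrArg (fun f => PresheafedSpace.Hom.base f x) i.hom_inv_id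
  refine Eq.trans (this.range_comp (X.ofRestrict U.isOpenEmbedding).base) ?_
  exact Subtype.range_coe

/-- An affine open subset `U` is canonically the affine superscheme of `O(U)`. -/
theorem IsAffineOpenSuper.exists_chart {X : PresheafedSpace.{u} (SAlg k)} {U : Opens X}
    (hU : IsAffineOpenSuper X U) : ∃ e : (X.presheaf.obj (op U)).SSpec ⟶ X,
      PresheafedSpace.IsOpenImmersion e ∧ Set.range e.base = U ∧
      ∀ (h : ∀ q ∈ (⊤ : Opens (X.presheaf.obj (op U)).SSpec), e.base q ∈ U)
        (b : X.presheaf.obj (op U)), pull e U ⊤ h b = Hom.toAlgHom (toSections _ ⊤) b := by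
  obtain ⟨A, e, he, hr⟩ := hU.exists_isOpenImmersion
  have hq : ∀ q, q ∈ (⊤ : Opens A.SSpec) ↔ e.base q ∈ U := fun q =>
    ⟨fun _ => hr.le ⟨q, rfl⟩, fun _ => trivial⟩
  have hb := pull_bijective e hq hr.ge
  have h1 : IsIso (pullHom e U ⊤ fun q h => (hq q).1 h) := isIso_of_bijective _ hb
  have h2 : IsIso (A.toSections ⊤) := isIso_of_bijective _ A.toSections_top_bijective
  -- Both `A` and `O(U)` are identified with the global sections on `Spec A`. Composing the given
  -- chart with `Spec` of the resulting `ψ : A ≅ O(U)` normalizes it so that `b` pulls back to the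
  -- constant section `b / 1`.
  obtain ⟨ψ, hψ', hψ⟩ := exists_isIso_fac (C := A.SSpec.presheaf.obj (op ⊤)) (A.toSections ⊤)
    (pullHom e U ⊤ fun q h => (hq q).1 h) h2 h1
  have := isOpenImmersion_specMap (IsLocIso.of_isIso ψ) (isOpenEmbedding_specPoint_of_isIso ψ)
  refine ⟨specMap ψ ≫ e, inferInstance, ?_, fun h b => ?_⟩
  · refine Eq.trans (Function.Surjective.range_comp ?_ e.base) hr
    exact (PrimeSpectrum.isHomeomorph_comap_of_bijective (evenMap_bijective ψ)).surjective
  · obtain ⟨a, rfl⟩ := (bijective_of_isIso ψ).2 b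
    rw [pull_comp (specMap ψ) e (W' := ⊤) (fun q h => (hq q).1 h) (fun _ _ => trivial)]
    refine (congrArg (pull (specMap ψ) ⊤ ⊤ fun _ _ => trivial) (hψ a)).trans ?_
    exact pull_specMap_toSections ψ _ a

/-- Affine open subsets form a basis. -/
theorem IsSuperscheme.exists_affine_le {X : PresheafedSpace.{u} (SAlg k)} (hX : IsSuperscheme X)
    {W : Opens X} {x : X} (hx : x ∈ W) : ∃ V : Opens X, x ∈ V ∧ V ≤ W ∧ IsAffineOpenSuper X V := by
  obtain ⟨U, hxU, hU⟩ := hX.exists_affine x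
  obtain ⟨A, e, he, hr⟩ := hU.exists_isOpenImmersion
  obtain ⟨q, rfl⟩ := hr.ge hxU
  obtain ⟨_, ⟨_, ⟨g, rfl⟩, rfl⟩, hqg, hg⟩ := PrimeSpectrum.isBasis_basic_opens.exists_subset_of_mem_open
    (show q ∈ (Opens.map e.base).obj W from hx) ((Opens.map e.base).obj W).2
  -- A basic open `D(g)` of a chart is itself affine: it is the image of the open immersion from the
  -- spectrum of its superalgebra of sections.
  have := isOpenImmersion_specMap (isLocIso_toSections g) (isOpenEmbedding_specPoint_toSections g)
  refine ⟨he.base_open.functor.obj (PrimeSpectrum.basicOpen g), ⟨q, hqg, rfl⟩, ?_,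
    isAffineOpenSuper_of_isOpenImmersion
      (specMap (A.toSections (PrimeSpectrum.basicOpen g)) ≫ e) ?_⟩
  · rintro _ ⟨p, hp, rfl⟩
    exact hg hp
  · refine (Set.range_comp e.base (specPoint (A.toSections (PrimeSpectrum.basicOpen g)))).trans ?_
    exact congrArg (e.base '' ·) (range_specPoint_toSections g)

/-! ### Localizations as superalgebras, and locality of stalks. -/

namespace SAlg

variable {k : Type u} [Field k]

/-- The localization `A_P` as a superalgebra. -/
def locSAlg (A : SAlg k) (x : PrimeSpectrum A.even) : SAlg k where
  carrier := A.Loc x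
  grading := A.locGrading x
  isCompl := ⟨A.disjoint_locGrading x, by
    rw [codisjoint_iff, Submodule.eq_top_iff']
    intro z
    obtain ⟨b, hb, c, hc, h⟩ := loc_exists_add z
    exact Submodule.mem_sup.2 ⟨b, hb, c, hc, h⟩⟩
  supercomm := loc_supercomm

/-- Evaluation of a section at a point. -/
def evalSections (A : SAlg k) (U : Opens (PrimeSpectrum A.even)) (x : U) :
    A.specSections U ⟶ A.locSAlg x.1 where
  toAlgHom := (Pi.evalAlgHom k (fun x : U => A.Loc x.1) x).comp (A.sections U).val
  map_mem _ _ hs := hs x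

/-- The even fraction `c / t`. -/
def fracEven {A : SAlg k} (x : PrimeSpectrum A.even) (c : A.even) (t : x.asIdeal.primeCompl) :
    (A.locSAlg x).even := ⟨frac x (c : A) t, c, c.2, t, rfl⟩

theorem fracEven_surjective {A : SAlg k} {x : PrimeSpectrum A.even} (z : (A.locSAlg x).even) :
    ∃ c t, fracEven x c t = z := by
  obtain ⟨_, c, hc, t, rfl⟩ := z
  exact ⟨⟨c, hc⟩, t, rfl⟩

theorem isUnit_loc_even_iff {A : SAlg k} {x : PrimeSpectrum A.even} (c : A.even)
    (t : x.asIdeal.primeCompl) :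
    IsUnit (fracEven x c t) ↔ c ∉ x.asIdeal := by
  constructor
  · intro h hc
    obtain ⟨⟨z, b, hb, t', rfl⟩, h⟩ := h.exists_right_inv
    have h1 : frac x (c : A) t * frac x b t' = 1 := congrArg Subtype.val h
    rw [frac_mul, ← frac_one, frac_eq_iff] at h1
    obtain ⟨u, hu, h2⟩ := h1
    have h3 : u * (1 * (c * ⟨b, hb⟩)) = u * ((t * t' : x.asIdeal.primeCompl) * 1) := Subtype.ext h2
    rw [one_mul, mul_one] at h3
    refine mul_notMem x hu (t * t').2 ?_
    rw [← h3]
    exact Ideal.mul_mem_left _ _ (Ideal.mul_mem_right _ _ hc)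
  · intro hc
    refine IsUnit.of_mul_eq_one (fracEven x t ⟨c, hc⟩) (Subtype.ext ?_)
    change frac x (c : A) t * frac x (t : A) ⟨c, hc⟩ = 1
    rw [frac_mul, ← frac_one, frac_eq_iff]
    refine ⟨1, one_notMem x, congrArg ((1 : A.even) • ·) ?_⟩
    change (1 : A) * (c * t) = t * c * 1
    rw [one_mul, mul_one, even_central c.2]

instance (A : SAlg k) (x : PrimeSpectrum A.even) : IsLocalRing (A.locSAlg x).even := by
  have hn : Nontrivial (A.locSAlg x).even := by
    refine ⟨0, 1, fun h => ?_⟩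
    have h0 := (isUnit_loc_even_iff (x := x) 0 1).not.2 (fun h => h (zero_mem _))
    refine h0 ?_
    convert isUnit_one (M := (A.locSAlg x).even)
    rw [← h]
    exact Subtype.ext (frac_zero _)
  refine .of_nonunits_add ?_
  intro z z' h h' hadd
  obtain ⟨c, t, rfl⟩ := fracEven_surjective z
  obtain ⟨c', t', rfl⟩ := fracEven_surjective z'
  have h1 := not_not.1 ((isUnit_loc_even_iff c t).not.1 h)
  have h2 := not_not.1 ((isUnit_loc_even_iff c' t').not.1 h')
  refine (isUnit_loc_even_iff (t.1 * c' + t'.1 * c) (t * t')).1 ?_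
    (add_mem (Ideal.mul_mem_left _ _ h2) (Ideal.mul_mem_left _ _ h1))
  convert hadd using 1
  refine Subtype.ext ?_
  refine Eq.trans ?_ (frac_add c c' t t').symm
  exact congrArg (frac x · (t * t')) (add_comm _ _)

/-- The even section `a / t`. -/
def fracSections {A : SAlg k} (U : Opens (PrimeSpectrum A.even)) (a t : A.even)
    (h : ∀ y ∈ U, t ∉ y.asIdeal) : (A.specSections U).even :=
  ⟨⟨fun y => frac y.1 a ⟨t, h y.1 y.2⟩, fun y => ⟨U, y.2, 𝟙 _, a, t, fun z => ⟨h z.1 z.2, rfl⟩⟩⟩,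
    fun y => ⟨a, a.2, ⟨t, h y.1 y.2⟩, rfl⟩⟩

theorem sections_exists_frac_even {A : SAlg k} {U : Opens (PrimeSpectrum A.even)}
    (s : (A.specSections U).even) {x : PrimeSpectrum A.even} (hx : x ∈ U) :
    ∃ (V : Opens (PrimeSpectrum A.even)) (_ : x ∈ V) (hV : V ≤ U) (a : A.even) (t : A.even),
      ∀ (y) (hy : y ∈ V), ∃ ht : t ∉ y.asIdeal, s.1.1 ⟨y, hV hy⟩ = frac y (a : A) ⟨t, ht⟩ := by
  obtain ⟨V, hxV, hV, a, t, h⟩ := sections_exists_frac s.1 hx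
  obtain ⟨c, hc, d, hd, rfl⟩ := A.exists_add a
  refine ⟨V, hxV, hV, ⟨c, hc⟩, t, fun y hy => ?_⟩
  obtain ⟨ht, h⟩ := h y hy
  refine ⟨ht, ?_⟩
  -- The value of `s` is even, so the odd summand `d / t` is both even and odd and vanishes.
  rw [← frac_add'] at h
  have h0 : frac y d ⟨t, ht⟩ ∈ A.locGrading y 0 := by
    rw [← add_sub_cancel_left (frac y c ⟨t, ht⟩) (frac y d ⟨t, ht⟩), ← h]
    exact sub_mem (s.2 ⟨y, hV hy⟩) ⟨c, hc, _, rfl⟩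
  rw [h, Submodule.disjoint_def.1 (A.disjoint_locGrading y) _ h0 ⟨d, hd, _, rfl⟩, add_zero]

/-- An even section whose value at a point is a unit is invertible near that point. -/
theorem isUnit_near_of_isUnit_eval {A : SAlg k} {U : Opens (PrimeSpectrum A.even)}
    (s : (A.specSections U).even) (x : U) (h : IsUnit (evenMap (A.evalSections U x) s)) :
    ∃ (V : Opens (PrimeSpectrum A.even)) (_ : x.1 ∈ V) (hV : V ≤ U),
      IsUnit (evenMap (A.specRes hV) s) := by
  obtain ⟨V, hxV, hV, a, t, hs⟩ := sections_exists_frac_even s x.2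
  have ha : a ∉ x.1.asIdeal := by
    obtain ⟨ht, hx⟩ := hs x.1 hxV
    refine (isUnit_loc_even_iff a ⟨t, ht⟩).1 ?_
    convert h
    exact Subtype.ext hx.symm
  refine ⟨V ⊓ PrimeSpectrum.basicOpen a, ⟨hxV, ha⟩, inf_le_left.trans hV, ?_⟩
  refine IsUnit.of_mul_eq_one (fracSections _ t a fun y hy => hy.2)
    (Subtype.ext (sections_ext fun y => ?_))
  obtain ⟨ht, hy⟩ := hs y.1 y.2.1
  change s.1.1 ⟨y.1, hV y.2.1⟩ * frac y.1 (t : A) ⟨a, y.2.2⟩ = 1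
  rw [hy, frac_mul, ← frac_one, frac_eq_iff]
  refine ⟨1, one_notMem y.1, congrArg ((1 : A.even) • ·) ?_⟩
  change (1 : A) * (a * t) = t * a * 1
  rw [one_mul, mul_one, even_central a.2]

/-- Evaluation at `q` of the pullbacks of even sections near the image of `q`. -/
def stalkCocone {Z : PresheafedSpace.{u} (SAlg k)} {A : SAlg k} (e : A.SSpec ⟶ Z)
    (q : PrimeSpectrum A.even) :
    Limits.Cocone ((OpenNhds.inclusion (X := Z.carrier) (e.base q)).op ⋙
      (Z.presheaf ⋙ evenFunctor k)) where
  pt := CommRingCat.of (A.locSAlg q).even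
  ι :=
    { app := fun U => CommRingCat.ofHom (evenMap (e.c.app (op U.unop.1) ≫
        A.evalSections ((Opens.map e.base).obj U.unop.1) ⟨q, U.unop.2⟩))
      naturality := fun U V i => by
        ext s
        refine Subtype.ext ?_
        have := congrArg (fun g => Hom.toAlgHom g (show (Z.presheaf.obj (op U.unop.1)).even from s).1)
          (e.c.naturality ((OpenNhds.inclusion (X := Z.carrier) (e.base q)).op.map i))
        exact congrArg (fun g : A.specSections _ => g.1 ⟨q, V.unop.2⟩) this }

/-- The map from the even part of a stalk to the even part of the localization, induced by a
morphism from an affine superscheme. -/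
def stalkEval {Z : PresheafedSpace.{u} (SAlg k)} {A : SAlg k} (e : A.SSpec ⟶ Z)
    (q : PrimeSpectrum A.even) : evenStalk Z (e.base q) ⟶ CommRingCat.of (A.locSAlg q).even :=
  Limits.colimit.desc _ (stalkCocone e q)

theorem stalkEval_evenGerm {Z : PresheafedSpace.{u} (SAlg k)} {A : SAlg k} (e : A.SSpec ⟶ Z)
    (q : PrimeSpectrum A.even) (W : Opens Z) (hq : e.base q ∈ W)
    (s : (Z.presheaf.obj (op W)).even) :
    (stalkEval e q).hom (evenGerm Z W (e.base q) hq s) =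
      evenMap (e.c.app (op W) ≫ A.evalSections ((Opens.map e.base).obj W) ⟨q, hq⟩) s := by
  have := Limits.colimit.ι_desc (stalkCocone e q) (op ⟨W, hq⟩)
  exact congrArg (fun g => g.hom s) this

/-- An even section whose value in `A_q` is a unit is invertible on a neighbourhood of `q`, and an
open immersion carries that neighbourhood and the inverse over to `Z`. -/
theorem isLocalHom_stalkEval {Z : PresheafedSpace.{u} (SAlg k)} {A : SAlg k} (e : A.SSpec ⟶ Z)
    [he : PresheafedSpace.IsOpenImmersion e] (q : PrimeSpectrum A.even) :
    IsLocalHom (stalkEval e q).hom := by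
  constructor
  intro z hz
  obtain ⟨W, hq, s, rfl⟩ := TopCat.Presheaf.exists_germ_eq (X := Z.carrier)
    (C := CommRingCat.{u}) (Z.presheaf ⋙ evenFunctor k) (x := e.base q) z
  have h1 : IsUnit (evenMap (A.evalSections ((Opens.map e.base).obj W) ⟨q, hq⟩)
      (evenMap (e.c.app (op W)) s)) :=
    (congrArg IsUnit (stalkEval_evenGerm e q W hq s)).mp hz
  obtain ⟨V, hqV, hV, hu⟩ := isUnit_near_of_isUnit_eval _ _ h1
  let N : Opens Z := he.base_open.functor.obj V
  have hN : ∀ p, p ∈ V ↔ e.base p ∈ N := fun p =>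
    ⟨fun hp => ⟨p, hp, rfl⟩, fun ⟨p', hp', h⟩ => he.base_open.injective h ▸ hp'⟩
  have hNW : N ≤ W := by
    rintro _ ⟨p, hp, rfl⟩
    exact hV hp
  have hi : IsIso (pullHom e N V fun p hp => (hN p).1 hp) :=
    isIso_of_bijective _ (pull_bijective e hN (by rintro _ ⟨p, _, rfl⟩; exact ⟨p, rfl⟩))
  let s' : (Z.presheaf.obj (op N)).even := evenMap (Z.presheaf.map (homOfLE hNW).op) s
  have h2 : evenMap (pullHom e N V fun p hp => (hN p).1 hp) s' =
      evenMap (A.specRes hV) (evenMap (e.c.app (op W)) s) :=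
    Subtype.ext (pull_resHom e hNW (fun p hp => (hN p).1 hp) s.1)
  have h3 : IsUnit s' := by
    have := (RingEquiv.ofBijective _ (evenMap_bijective (pullHom e N V _))).symm.toRingHom.isUnit_map
      (show IsUnit (evenMap (pullHom e N V fun p hp => (hN p).1 hp) s') by rw [h2]; exact hu)
    convert this
    exact ((RingEquiv.ofBijective _ (evenMap_bijective (pullHom e N V _))).symm_apply_apply s').symm
  have h4 := (evenGerm Z N (e.base q) ((hN q).1 hqV)).isUnit_map h3
  refine (congrArg IsUnit ?_).mp h4
  exact (TopCat.Presheaf.germ_res_apply (X := Z.carrier) (C := CommRingCat.{u}) (Z.presheaf ⋙ evenFunctor k)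
    (homOfLE hNW) (e.base q) ((hN q).1 hqV) s)

/-- The stalk need not be computed: a ring with a local homomorphism to a local ring is local. -/
theorem isLocalRing_evenStalk {Z : PresheafedSpace.{u} (SAlg k)} {A : SAlg k} (e : A.SSpec ⟶ Z)
    [PresheafedSpace.IsOpenImmersion e] (q : PrimeSpectrum A.even) :
    IsLocalRing (evenStalk Z (e.base q)) :=
  have := isLocalHom_stalkEval e q
  RingHom.domain_isLocalRing (stalkEval e q).hom

end SAlg

/-! ### Charts of a superscheme, and restriction maps as local isomorphisms. -/

namespace Superscheme

open SAlg

variable {k : Type u} [Field k]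

/-- The canonical open immersion `Spec O(U) → X` of an affine open subset. -/
def chart (X : Superscheme k) (U : X.AffineOpens) : (X.sec U).SSpec ⟶ X.toPresheafedSpace :=
  Classical.choose U.2.2.exists_chart

instance isOpenImmersion_chart (X : Superscheme k) (U : X.AffineOpens) :
    PresheafedSpace.IsOpenImmersion (X.chart U) :=
  (Classical.choose_spec U.2.2.exists_chart).1

theorem range_chart (X : Superscheme k) (U : X.AffineOpens) :
    Set.range (X.chart U).base = U.1 :=
  (Classical.choose_spec U.2.2.exists_chart).2.1

theorem chart_mem (X : Superscheme k) (U : X.AffineOpens) (q : PrimeSpectrum (X.sec U).even) :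
    (X.chart U).base q ∈ U.1 :=
  (X.range_chart U).le ⟨q, rfl⟩

theorem pull_chart (X : Superscheme k) (U : X.AffineOpens)
    (W : Opens (PrimeSpectrum (X.sec U).even)) (h : ∀ q ∈ W, (X.chart U).base q ∈ U.1)
    (b : X.sec U) :
    pull (X.chart U) U.1 W h b = Hom.toAlgHom ((X.sec U).toSections W) b := by
  have h1 := (Classical.choose_spec U.2.2.exists_chart).2.2 (fun q _ => X.chart_mem U q) b
  have h2 := resHom_pull (X.chart U) (V' := W) (W' := ⊤) le_top (fun q _ => X.chart_mem U q) b
  refine h2.symm.trans ?_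
  refine (congrArg (resHom (X.sec U).SSpec le_top) h1).trans ?_
  rfl

theorem pull_chart_resHom (X : Superscheme k) (U : X.AffineOpens) {M : Opens X.carrier}
    (hM : M ≤ U.1) (W : Opens (PrimeSpectrum (X.sec U).even))
    (h : ∀ q ∈ W, (X.chart U).base q ∈ M) (b : X.sec U) :
    pull (X.chart U) M W h (resHom X.toPresheafedSpace hM b) =
      Hom.toAlgHom ((X.sec U).toSections W) b :=
  (pull_resHom (X.chart U) hM h b).trans (X.pull_chart U W _ b)

/-- The local homomorphism `stalkEval` sends the germ of `s` to `s / 1` in the localization at `q`,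
a unit exactly when `s ∉ q`. So on points the chosen chart is inverse to the canonical map `point`.
-/
theorem point_chart (X : Superscheme k) (U : X.AffineOpens) (q : PrimeSpectrum (X.sec U).even)
    (h : (X.chart U).base q ∈ U.1) : X.point U ((X.chart U).base q) h = q := by
  refine PrimeSpectrum.ext (Ideal.ext fun s => ?_)
  change evenGerm X.toPresheafedSpace U.1 _ h s ∈ IsLocalRing.maximalIdeal _ ↔ _
  have := isLocalHom_stalkEval (X.chart U) q
  rw [IsLocalRing.mem_maximalIdeal, mem_nonunits_iff, ← not_iff_not, not_not]
  have h1 : (stalkEval (X.chart U) q).hom (evenGerm X.toPresheafedSpace U.1 _ h s) =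
      fracEven q s 1 := by
    refine (stalkEval_evenGerm (X.chart U) q U.1 h s).trans (Subtype.ext ?_)
    have := X.pull_chart U ((Opens.map (X.chart U).base).obj U.1) (fun _ h => h) s.1
    have h2 := congrArg (fun t : (X.sec U).specSections _ => t.1 ⟨q, h⟩) this
    refine Eq.trans ?_ h2
    exact congrArg (fun t : (X.sec U).specSections _ => t.1 ⟨q, h⟩)
      (resHom_self (X.sec U).SSpec (Hom.toAlgHom ((X.chart U).c.app (op U.1)) s.1)).symm
  rw [← isUnit_map_iff (stalkEval (X.chart U) q).hom]
  exact (congrArg IsUnit h1).to_iff.trans (isUnit_loc_even_iff s 1)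

theorem exists_chart_eq (X : Superscheme k) (U : X.AffineOpens) {x : X.carrier} (hx : x ∈ U.1) :
    ∃ q, (X.chart U).base q = x :=
  (X.range_chart U).ge hx

theorem chart_point (X : Superscheme k) (U : X.AffineOpens) {x : X.carrier} (hx : x ∈ U.1) :
    (X.chart U).base (X.point U x hx) = x := by
  obtain ⟨q, rfl⟩ := X.exists_chart_eq U hx
  exact congrArg (X.chart U).base (X.point_chart U q hx)

theorem point_res (X : Superscheme k) {U V : X.AffineOpens} (h : V.1 ≤ U.1) {x : X.carrier}
    (hx : x ∈ V.1) : specPoint (X.res h) (X.point V x hx) = X.point U x (h hx) := by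
  refine PrimeSpectrum.ext (Ideal.ext fun s => ?_)
  change evenGerm X.toPresheafedSpace V.1 x hx (evenMap (X.res h) s) ∈
      IsLocalRing.maximalIdeal (evenStalk X.toPresheafedSpace x) ↔
    evenGerm X.toPresheafedSpace U.1 x (h hx) s ∈
      IsLocalRing.maximalIdeal (evenStalk X.toPresheafedSpace x)
  have : evenGerm X.toPresheafedSpace V.1 x hx (evenMap (X.res h) s) =
    evenGerm X.toPresheafedSpace U.1 x (h hx) s :=
    TopCat.Presheaf.germ_res_apply (X := X.carrier) (C := CommRingCat.{u})
      (X.presheaf ⋙ evenFunctor k) (homOfLE h) x hx s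
  rw [this]

/-- The charts are chosen independently for each open subset. They agree on points because each is
inverse to `point`, which is natural. -/
theorem chart_specPoint_res (X : Superscheme k) {U V : X.AffineOpens} (h : V.1 ≤ U.1)
    (r : PrimeSpectrum (X.sec V).even) :
    (X.chart U).base (specPoint (X.res h) r) = (X.chart V).base r := by
  conv_lhs => rw [← X.point_chart V r (X.chart_mem V r)]
  rw [X.point_res h, X.chart_point]

theorem isOpenEmbedding_specPoint_res (X : Superscheme k) {U V : X.AffineOpens} (h : V.1 ≤ U.1) :
    Topology.IsOpenEmbedding (specPoint (X.res h)) := by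
  refine Topology.IsOpenEmbedding.of_comp _
    (PresheafedSpace.IsOpenImmersion.base_open (f := X.chart U)) ?_
  have e : ⇑(X.chart U).base ∘ specPoint (X.res h) = (X.chart V).base :=
    funext (X.chart_specPoint_res h)
  exact (congrArg Topology.IsOpenEmbedding e).mpr
    (PresheafedSpace.IsOpenImmersion.base_open (f := X.chart V))

theorem pull_chart_injective (X : Superscheme k) (U : X.AffineOpens) (M : Opens X.carrier)
    (W : Opens (PrimeSpectrum (X.sec U).even)) (h : ∀ q ∈ W, (X.chart U).base q ∈ M)
    (h' : ∀ x ∈ M, ∃ q ∈ W, (X.chart U).base q = x) :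
    Function.Injective (pull (X.chart U) M W h) := by
  refine (pull_bijective (X.chart U) (W := M) (W' := W) (fun q => ⟨h q, fun hq => ?_⟩) ?_).1
  · obtain ⟨p, hp, e⟩ := h' _ hq
    rwa [← PresheafedSpace.IsOpenImmersion.base_open.injective e]
  · intro x hx
    obtain ⟨q, _, rfl⟩ := h' x hx
    exact ⟨q, rfl⟩

/-- The restriction map between affine open subsets induces isomorphisms of localizations. -/
theorem isLocIso_res (X : Superscheme k) {U V : X.AffineOpens} (h : V.1 ≤ U.1) :
    IsLocIso (X.res h) where
  exists_frac q b := by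
    have hp := X.chart_specPoint_res h q
    -- The section `b` on `V`, viewed on `Spec O(U)`, is near the image of `q` a fraction `a / s`
    -- with `a` and `s` from `O(U)`.
    let t : (X.sec U).specSections ((Opens.map (X.chart U).base).obj V.1) :=
      pull (X.chart U) V.1 ((Opens.map (X.chart U).base).obj V.1) (fun _ h => h) b
    obtain ⟨N, hN, hNV, a, s, ht⟩ := sections_exists_frac t (x := specPoint (X.res h) q) (by
      change (X.chart U).base _ ∈ V.1
      rw [hp]; exact X.chart_mem V q)
    let M : Opens X.carrier :=
      (PresheafedSpace.IsOpenImmersion.base_open (f := X.chart U)).functor.obj N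
    have hMV : M ≤ V.1 := by
      rintro _ ⟨p, hp, rfl⟩
      exact hNV hp
    have hNM : ∀ p ∈ N, (X.chart U).base p ∈ M := fun p hp => ⟨p, hp, rfl⟩
    -- The relation `s b = a` is established on an open `M` of `X` through the chart of `U`, then
    -- read through the chart of `V` and evaluated at `q`.
    have key : resHom X.toPresheafedSpace (hMV.trans h) (s : X.sec U) *
        resHom X.toPresheafedSpace hMV b = resHom X.toPresheafedSpace (hMV.trans h) a := by
      refine X.pull_chart_injective U M N hNM (fun x hx => hx) ?_
      rw [map_mul, X.pull_chart_resHom U (hMV.trans h), X.pull_chart_resHom U (hMV.trans h)]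
      refine sections_ext (A := X.sec U) fun y => ?_
      have e1 : pull (X.chart U) M N hNM (resHom X.toPresheafedSpace hMV b) =
          resHom (X.sec U).SSpec hNV t :=
        (pull_resHom _ _ _ _).trans (resHom_pull (X.chart U) hNV (fun _ h => h) b).symm
      rw [e1]
      change frac y.1 (s : X.sec U) 1 * t.1 ⟨y.1, hNV y.2⟩ = frac y.1 a 1
      obtain ⟨hs, e2⟩ := ht y.1 y.2
      rw [e2, frac_mul, one_mul, frac_eq_iff]
      exact ⟨1, one_notMem y.1, congrArg ((1 : (X.sec U).even) • ·) (one_smul _ _)⟩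
    have hq : (X.chart V).base q ∈ M := by
      rw [← hp]; exact hNM _ hN
    have e3 : ∀ c, pull (X.chart V) M ((Opens.map (X.chart V).base).obj M) (fun _ h => h)
        (resHom X.toPresheafedSpace (hMV.trans h) c) =
          Hom.toAlgHom (toSections _ _) (Hom.toAlgHom (X.res h) c) := by
      intro c
      rw [← X.pull_chart_resHom V hMV _ (fun _ h => h)]
      exact congrArg _ (resHom_resHom X.toPresheafedSpace h hMV c).symm
    have e4 := congrArg (pull (X.chart V) M ((Opens.map (X.chart V).base).obj M) fun _ h => h) key
    have e5 := (congrArg₂ (· * ·) (e3 s.1) (X.pull_chart_resHom V hMV _ (fun _ h => h) b)).symm.trans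
      ((map_mul _ _ _).symm.trans (e4.trans (e3 a)))
    have e5 := congrArg (fun t : (X.sec V).specSections _ => t.1 ⟨q, hq⟩) e5
    have e6 : frac q (Hom.toAlgHom (X.res h) s) 1 * frac q b 1 =
      frac q (Hom.toAlgHom (X.res h) a) 1 := e5
    rw [frac_mul, frac_eq_iff] at e6
    obtain ⟨u, hu, e7⟩ := e6
    refine ⟨a, s, u, ?_, hu, ?_⟩
    · exact (ht _ hN).1
    · change u • ((1 : (X.sec V).even) • _) = u • ((1 * 1 : (X.sec V).even) • _) at e7
      rwa [one_mul, one_smul, one_smul] at e7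
  exists_smul_eq_zero q a u hu h0 := by
    -- On `D(u)` the relation `u a = 0` forces `a` to vanish. Hence `a` restricts to zero on the
    -- corresponding open `M` of `X`, and the chart of `U` turns this into `a / 1 = 0` at the image
    -- of `q`.
    let N : Opens (PrimeSpectrum (X.sec V).even) := PrimeSpectrum.basicOpen u
    let M : Opens X.carrier :=
      (PresheafedSpace.IsOpenImmersion.base_open (f := X.chart V)).functor.obj N
    have hMV : M ≤ V.1 := by
      rintro _ ⟨p, hp, rfl⟩
      exact X.chart_mem V p
    have hNM : ∀ p ∈ N, (X.chart V).base p ∈ M := fun p hp => ⟨p, hp, rfl⟩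
    have key : resHom X.toPresheafedSpace (hMV.trans h) a = 0 := by
      refine (resHom_resHom X.toPresheafedSpace h hMV a).symm.trans ?_
      refine X.pull_chart_injective V M N hNM (fun x hx => hx) ?_
      rw [map_zero]
      refine (X.pull_chart_resHom V hMV N hNM (Hom.toAlgHom (X.res h) a)).trans ?_
      exact sections_ext (A := X.sec V) fun y => frac_eq_zero.2 ⟨u, y.2, h0⟩
    have hp : (X.chart U).base (specPoint (X.res h) q) ∈ M := by
      rw [X.chart_specPoint_res h q]
      exact hNM q hu
    have e1 := X.pull_chart_resHom U (hMV.trans h) ((Opens.map (X.chart U).base).obj M)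
      (fun _ h => h) a
    rw [key, map_zero] at e1
    have e2 : (0 : (X.sec U).Loc (specPoint (X.res h) q)) = frac _ a 1 :=
      congrArg (fun t : (X.sec U).specSections _ => t.1 ⟨specPoint (X.res h) q, hp⟩) e1
    exact frac_eq_zero.1 e2.symm

end Superscheme

/-! ### Functoriality of the maps on localizations. -/

namespace SAlg

variable {k : Type u} [Field k]

theorem locMap_mem {A B : SAlg k} (f : A ⟶ B) (y : PrimeSpectrum B.even) {i : ZMod 2}
    {z : A.Loc (specPoint f y)} (hz : z ∈ A.locGrading (specPoint f y) i) :
    locMap f y z ∈ B.locGrading y i := by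
  obtain ⟨a, ha, s, rfl⟩ := hz
  exact ⟨_, Hom.map_mem f i a ha, _, (locMap_frac f y a s).symm⟩

theorem locMap_comp {A B C : SAlg k} (f : A ⟶ B) (g : B ⟶ C) (y : PrimeSpectrum C.even)
    (z : A.Loc (specPoint f (specPoint g y))) :
    locMap g y (locMap f (specPoint g y) z) = locMap (f ≫ g) y z := by
  obtain ⟨a, s, rfl⟩ := frac_surjective z
  refine (congrArg (locMap g y) (locMap_frac f _ a s)).trans ((locMap_frac g y _ _).trans ?_)
  exact (locMap_frac (f ≫ g) y a s).symm

theorem locMap_congr {A C : SAlg k} {f g : A ⟶ C} (e : f = g) (y : PrimeSpectrum C.even)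
    (z : A.Loc (specPoint f y)) (z' : A.Loc (specPoint g y)) (hz : HEq z z') :
    locMap f y z = locMap g y z' := by
  subst e
  rw [eq_of_heq hz]

theorem apply_heq {A : SAlg k} {U : Opens (PrimeSpectrum A.even)} (t : ∀ x : U, A.Loc x.1)
    {p q : PrimeSpectrum A.even} (e : p = q) (hp : p ∈ U) (hq : q ∈ U) :
    HEq (t ⟨p, hp⟩) (t ⟨q, hq⟩) := by
  subst e; rfl

theorem sections_heq {A : SAlg k} {U : Opens (PrimeSpectrum A.even)} (t : A.specSections U)
    {p q : PrimeSpectrum A.even} (e : p = q) (hp : p ∈ U) (hq : q ∈ U) :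
    HEq (t.1 ⟨p, hp⟩) (t.1 ⟨q, hq⟩) :=
  apply_heq t.1 e hp hq

end SAlg

open SAlg

/-! ### Gluing a family of affine superschemes: construction. -/

/-- A family of affine superschemes with compatible embeddings into a topological space `X`, whose
images form a basis of a topology of `X`. -/
structure AffineFamily (k : Type u) [Field k] (X : TopCat.{u}) where
  ι : Type u
  [preorder : Preorder ι]
  alg : ι → SAlg k
  res : ∀ {i j : ι}, i ≤ j → (alg j ⟶ alg i)
  res_comp : ∀ {i j l : ι} (h : i ≤ j) (h' : j ≤ l), res h' ≫ res h = res (h.trans h')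
  map : ∀ i, C(PrimeSpectrum (alg i).even, X)
  map_res : ∀ {i j : ι} (h : i ≤ j) (r), map j (specPoint (res h) r) = map i r
  isOpenEmbedding : ∀ i, Topology.IsOpenEmbedding (map i)
  isLocIso : ∀ {i j : ι} (h : i ≤ j), IsLocIso (res h)
  exists_le : ∀ (i j : ι) (p q), map i p = map j q →
    ∃ (m : ι) (_ : m ≤ i) (_ : m ≤ j) (r : _), map m r = map i p
  exists_map : ∀ x, ∃ i p, map i p = x

namespace AffineFamily

attribute [instance] AffineFamily.preorder

variable {k : Type u} [Field k] {X : TopCat.{u}} (F : AffineFamily k X)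

/-- The preimage of an open subset. -/
def pre (i : F.ι) (W : Opens X) : Opens (PrimeSpectrum (F.alg i).even) := W.comap (F.map i)

theorem specPoint_mem_pre {i j : F.ι} (h : i ≤ j) {W : Opens X}
    {r : PrimeSpectrum (F.alg i).even} (hr : r ∈ F.pre i W) :
    specPoint (F.res h) r ∈ F.pre j W := by
  change F.map j _ ∈ W
  rw [F.map_res h r]
  exact hr

theorem isOpenEmbedding_specPoint {i j : F.ι} (h : i ≤ j) :
    Topology.IsOpenEmbedding (specPoint (F.res h)) := by
  refine Topology.IsOpenEmbedding.of_comp _ (F.isOpenEmbedding j) ?_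
  have e : F.map j ∘ specPoint (F.res h) = F.map i := funext (F.map_res h)
  rw [e]
  exact F.isOpenEmbedding i

/-- Sections of the glued superscheme: compatible families of sections. -/
def sections (W : Opens X) : Subalgebra k (∀ i, (F.alg i).specSections (F.pre i W)) where
  carrier := {s | ∀ (i j : F.ι) (h : i ≤ j) (r) (hr : r ∈ F.pre i W),
    locMap (F.res h) r ((s j).1 ⟨specPoint (F.res h) r, F.specPoint_mem_pre h hr⟩) =
      (s i).1 ⟨r, hr⟩}
  add_mem' hs ht i j h r hr := (map_add (locMap (F.res h) r) _ _).trans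
    (congrArg₂ (· + ·) (hs i j h r hr) (ht i j h r hr))
  mul_mem' hs ht i j h r hr := (map_mul (locMap (F.res h) r) _ _).trans
    (congrArg₂ (· * ·) (hs i j h r hr) (ht i j h r hr))
  algebraMap_mem' c _ _ h r _ := (locMap (F.res h) r).commutes c

/-- The grading of the sections. -/
def secGrading (W : Opens X) (a : ZMod 2) : Submodule k (F.sections W) where
  carrier := {s | ∀ i, s.1 i ∈ SAlg.grading _ a}
  zero_mem' _ := zero_mem _
  add_mem' hs ht i := add_mem (hs i) (ht i)
  smul_mem' c _ hs i := Submodule.smul_mem _ c (hs i)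

instance (W : Opens X) : SetLike.GradedMonoid (F.secGrading W) where
  one_mem i := SetLike.one_mem_graded (SAlg.grading ((F.alg i).specSections (F.pre i W)))
  mul_mem _ _ _ _ hs ht i :=
    SetLike.mul_mem_graded (A := SAlg.grading ((F.alg i).specSections (F.pre i W))) (hs i) (ht i)

theorem isCompl_secGrading (W : Opens X) : IsCompl (F.secGrading W 0) (F.secGrading W 1) := by
  constructor
  · rw [Submodule.disjoint_def]
    intro s h0 h1
    exact Subtype.ext (funext fun i =>
      Submodule.disjoint_def.1 (SAlg.isCompl _).disjoint _ (h0 i) (h1 i))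
  · rw [codisjoint_iff, Submodule.eq_top_iff']
    intro s
    choose e he o ho heo using fun i => SAlg.exists_add _ (s.1 i)
    -- As `locMap` preserves parity, the compatibility condition splits into its even and odd
    -- components.
    have key : ∀ (i j : F.ι) (h : i ≤ j) (r) (hr : r ∈ F.pre i W),
        locMap (F.res h) r ((e j).1 ⟨specPoint (F.res h) r, F.specPoint_mem_pre h hr⟩) =
          (e i).1 ⟨r, hr⟩ ∧
        locMap (F.res h) r ((o j).1 ⟨specPoint (F.res h) r, F.specPoint_mem_pre h hr⟩) =
          (o i).1 ⟨r, hr⟩ := by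
      intro i j h r hr
      have h1 := s.2 i j h r hr
      rw [← heo i, ← heo j] at h1
      have h2 : locMap (F.res h) r ((e j).1 ⟨specPoint (F.res h) r, F.specPoint_mem_pre h hr⟩) +
          locMap (F.res h) r ((o j).1 ⟨specPoint (F.res h) r, F.specPoint_mem_pre h hr⟩) =
          (e i).1 ⟨r, hr⟩ + (o i).1 ⟨r, hr⟩ := (map_add (locMap (F.res h) r) _ _).symm.trans h1
      have h3 := Submodule.disjoint_def.1 ((F.alg i).disjoint_locGrading r) _
        (sub_mem (locMap_mem (F.res h) r (he j ⟨_, F.specPoint_mem_pre h hr⟩)) (he i ⟨r, hr⟩))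
        (by
          rw [sub_eq_sub_iff_add_eq_add.2 (h2.trans (add_comm _ _))]
          exact sub_mem (ho i ⟨r, hr⟩) (locMap_mem (F.res h) r
            (ho j ⟨_, F.specPoint_mem_pre h hr⟩)))
      have h4 := sub_eq_zero.1 h3
      refine ⟨h4, ?_⟩
      rw [h4] at h2
      exact add_left_cancel h2
    exact Submodule.mem_sup.2 ⟨⟨e, fun i j h r hr => (key i j h r hr).1⟩, he,
      ⟨o, fun i j h r hr => (key i j h r hr).2⟩, ho, Subtype.ext (funext heo)⟩

/-- The superalgebra of sections of the glued superscheme. -/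
def secSAlg (W : Opens X) : SAlg k where
  carrier := F.sections W
  grading := F.secGrading W
  isCompl := F.isCompl_secGrading W
  supercomm a b s t hs ht := Subtype.ext <| funext fun i => by
    have := SAlg.supercomm _ a b (s.1 i) (t.1 i) (hs i) (ht i)
    simpa using this

/-- Restriction of sections of the glued superscheme. -/
def secRes {W V : Opens X} (h : V ≤ W) : F.secSAlg W ⟶ F.secSAlg V where
  toAlgHom :=
    { toFun := fun s => ⟨fun i => Hom.toAlgHom ((F.alg i).specRes
        (show F.pre i V ≤ F.pre i W from fun _ hx => h hx)) (s.1 i),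
          fun i j h' r hr => s.2 i j h' r (h hr)⟩
      map_one' := rfl
      map_mul' := fun _ _ => rfl
      map_zero' := rfl
      map_add' := fun _ _ => rfl
      commutes' := fun _ => rfl }
  map_mem _ _ hs i x := hs i ⟨x.1, h x.2⟩

/-- The glued structure sheaf. -/
def sheaf : TopCat.Presheaf (SAlg k) X where
  obj W := F.secSAlg W.unop
  map i := F.secRes i.unop.le

/-- The glued superscheme. -/
abbrev space : PresheafedSpace.{u} (SAlg k) := ⟨X, F.sheaf⟩

/-- The projection of a compatible family to its component. -/
def proj (i : F.ι) (W : Opens X) : F.secSAlg W ⟶ (F.alg i).specSections (F.pre i W) where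
  toAlgHom := (Pi.evalAlgHom k (fun i => (F.alg i).specSections (F.pre i W)) i).comp
    (F.sections W).val
  map_mem _ _ hs := hs i

/-- The embeddings of the members of the family in the glued superscheme. -/
def emb (i : F.ι) : (F.alg i).SSpec ⟶ F.space where
  base := TopCat.ofHom (F.map i)
  c := { app := fun W => F.proj i W.unop }

theorem sections_ext {W : Opens X} {s t : F.secSAlg W}
    (h : ∀ i r (hr : r ∈ F.pre i W), (s.1 i).1 ⟨r, hr⟩ = (t.1 i).1 ⟨r, hr⟩) : s = t :=
  Subtype.ext (funext fun i => SAlg.sections_ext fun x => h i x.1 x.2)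

theorem specMap_emb {i j : F.ι} (h : i ≤ j) : specMap (F.res h) ≫ F.emb j = F.emb i := by
  refine hom_ext_of_pull ?_ ?_
  · refine TopCat.hom_ext (ContinuousMap.ext fun r => F.map_res h r)
  · intro W W' h1 h2 s
    refine SAlg.sections_ext (A := F.alg i) fun x => ?_
    exact s.2 i j h x.1 (h2 x.1 x.2)

theorem exists_le' (i j : F.ι) (p q) (e : F.map i p = F.map j q) :
    ∃ (m : F.ι) (h : m ≤ i) (h' : m ≤ j) (r : _), specPoint (F.res h) r = p ∧
      specPoint (F.res h') r = q := by
  obtain ⟨m, h, h', r, hr⟩ := F.exists_le i j p q e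
  refine ⟨m, h, h', r, (F.isOpenEmbedding i).injective ?_, (F.isOpenEmbedding j).injective ?_⟩
  · rw [F.map_res, hr]
  · rw [F.map_res, hr, e]

/-- A point of the member `l` over `W` also comes from `i`, hence both come from a common smaller
member `m`. As `locMap` is bijective, the value in `l` is determined by the value in `m`, and that
one by the value in `i`. -/
theorem proj_injective (i : F.ι) {W : Opens X} (hW : (W : Set X) ⊆ Set.range (F.map i)) :
    Function.Injective (Hom.toAlgHom (F.proj i W)) := by
  intro s t hst
  refine F.sections_ext fun l r hr => ?_
  obtain ⟨p, hp⟩ := hW hr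
  obtain ⟨m, h, h', r', rfl, rfl⟩ := F.exists_le' i l p r hp
  have hr' : r' ∈ F.pre m W := by
    change F.map m r' ∈ W
    rw [← F.map_res h']
    exact hr
  refine ((F.isLocIso h').locMap_bijective r').1 ?_
  refine (s.2 m l h' r' hr').trans (Eq.trans ?_ (t.2 m l h' r' hr').symm)
  refine (s.2 m i h r' hr').symm.trans (Eq.trans ?_ (t.2 m i h r' hr'))
  exact congrArg (fun u : (F.alg i).specSections (F.pre i W) =>
    locMap (F.res h) r' (u.1 ⟨_, F.specPoint_mem_pre h hr'⟩)) hst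

theorem specPoint_res_comp {i j l : F.ι} (h : i ≤ j) (h' : j ≤ l)
    (r : PrimeSpectrum (F.alg i).even) :
    specPoint (F.res h') (specPoint (F.res h) r) = specPoint (F.res (h.trans h')) r :=
  congrArg (fun f => specPoint f r) (F.res_comp h h')

theorem locMap_res_comp {i j l : F.ι} (h : i ≤ j) (h' : j ≤ l) (r : PrimeSpectrum (F.alg i).even)
    (z : (F.alg l).Loc (specPoint (F.res h') (specPoint (F.res h) r)))
    (z' : (F.alg l).Loc (specPoint (F.res (h.trans h')) r)) (hz : HEq z z') :
    locMap (F.res h) r (locMap (F.res h') _ z) = locMap (F.res (h.trans h')) r z' :=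
  (locMap_comp (F.res h') (F.res h) r z).trans (locMap_congr (F.res_comp h h') r z z' hz)

/-- The value of the family at a point of `l` is obtained by transporting `t` from `i` to `l`
through a common smaller member. It has to be shown independent of that member, locally a fraction,
and compatible. -/
theorem proj_surjective (i : F.ι) {W : Opens X} (hW : (W : Set X) ⊆ Set.range (F.map i)) :
    Function.Surjective (Hom.toAlgHom (F.proj i W)) := by
  intro t
  have key : ∀ (l : F.ι) (x : F.pre l W), ∃ z : (F.alg l).Loc x.1, ∀ (m : F.ι) (h : m ≤ i)
      (h' : m ≤ l) (r : PrimeSpectrum (F.alg m).even) (hr : r ∈ F.pre m W)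
      (z' : (F.alg l).Loc (specPoint (F.res h') r)), specPoint (F.res h') r = x.1 → HEq z' z →
        locMap (F.res h') r z' =
          locMap (F.res h) r (t.1 ⟨specPoint (F.res h) r, F.specPoint_mem_pre h hr⟩) := by
    rintro l ⟨x, hx⟩
    obtain ⟨p, hp⟩ := hW hx
    obtain ⟨m, h, h', r, rfl, rfl⟩ := F.exists_le' i l p x hp
    have hr : specPoint (F.res h) r ∈ F.pre i W := (congrArg (· ∈ W) hp).mpr hx
    obtain ⟨z, hz⟩ := ((F.isLocIso h').locMap_bijective r).2 (locMap (F.res h) r (t.1 ⟨_, hr⟩))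
    refine ⟨z, fun m₁ h₁ h₁' r₁ hr₁ z' e hz' => ?_⟩
    -- Two choices `m` and `m₁` of the intermediate member are compared on a third one below both.
    obtain ⟨m₂, g, g₁, r₂, rfl, rfl⟩ := F.exists_le' m m₁ r r₁ (by
      rw [← F.map_res h', ← F.map_res h₁']; exact congrArg _ e.symm)
    refine ((F.isLocIso g₁).locMap_bijective r₂).1 ?_
    have e1 := F.specPoint_res_comp g h' r₂
    have e2 := F.specPoint_res_comp g h r₂
    have e3 := F.specPoint_res_comp g₁ h₁ r₂
    have hm : specPoint (F.res (g.trans h)) r₂ ∈ F.pre i W := e2 ▸ hr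
    have hz1 := congrArg (locMap (F.res g) r₂) hz
    have hz2 := F.locMap_res_comp g h r₂ _ (t.1 ⟨_, hm⟩) (sections_heq t e2 hr hm)
    have hz3 := F.locMap_res_comp g h' r₂ z (cast (congrArg _ e1) z) (cast_heq _ z).symm
    refine (F.locMap_res_comp g₁ h₁' r₂ z' (cast (congrArg _ e1) z)
      (hz'.trans (cast_heq _ z).symm)).trans ?_
    refine (hz3.symm.trans (hz1.trans hz2)).trans ?_
    exact (F.locMap_res_comp g₁ h₁ r₂ _ (t.1 ⟨_, hm⟩)
      (sections_heq t e3 (F.specPoint_mem_pre h₁ hr₁) hm)).symm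
  choose s hs using key
  have hs' : ∀ (m l : F.ι) (h : m ≤ i) (h' : m ≤ l) (r : PrimeSpectrum (F.alg m).even)
      (hr : r ∈ F.pre m W),
      locMap (F.res h') r (s l ⟨specPoint (F.res h') r, F.specPoint_mem_pre h' hr⟩) =
        locMap (F.res h) r (t.1 ⟨specPoint (F.res h) r, F.specPoint_mem_pre h hr⟩) :=
    fun m l h h' r hr => hs l ⟨_, F.specPoint_mem_pre h' hr⟩ m h h' r hr _ rfl HEq.rfl
  have hs_mem : ∀ l, s l ∈ (F.alg l).sections (F.pre l W) := by
    rintro l ⟨x, hx⟩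
    obtain ⟨p, hp⟩ := hW hx
    obtain ⟨m, h, h', r, rfl, rfl⟩ := F.exists_le' i l p x hp
    have ho := F.isOpenEmbedding_specPoint h'
    -- On the open image of `m` in `l`, the restriction of `t` to `m` corresponds to a genuine
    -- section `σ`. It agrees with `s l` there, which is therefore locally a fraction.
    let O : Opens (PrimeSpectrum (F.alg l).even) :=
      F.pre l W ⊓ ⟨Set.range (specPoint (F.res h')), ho.isOpen_range⟩
    have hO : ∀ r, r ∈ O.comap (specPoint (F.res h')) → r ∈ F.pre m W := by
      intro r hr
      have : F.map l (specPoint (F.res h') r) ∈ W := hr.1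
      rwa [F.map_res h'] at this
    obtain ⟨σ, hσ⟩ := (specSectionsHom_bijective (F.isLocIso h') ho (U := O)
      (fun _ hy => hy.2)).2 (Hom.toAlgHom ((F.alg m).specRes
        (show O.comap (specPoint (F.res h')) ≤ (F.pre i W).comap (specPoint (F.res h)) from
          fun r hr => F.specPoint_mem_pre h (hO r hr))) (specSectionsHom (F.res h) _ t))
    obtain ⟨V, hxV, hV, a, u, hu⟩ := sections_exists_frac (A := F.alg l) σ
      (x := specPoint (F.res h') r) ⟨hx, r, rfl⟩
    refine ⟨V, hxV, homOfLE (hV.trans inf_le_left), a, u, ?_⟩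
    rintro ⟨y, hy⟩
    obtain ⟨hu, hu'⟩ := hu y hy
    refine ⟨hu, Eq.trans ?_ hu'⟩
    obtain ⟨r', rfl⟩ := (hV hy).2
    refine ((F.isLocIso h').locMap_bijective r').1 ?_
    exact (hs' m l h h' r' (hO r' (hV hy))).trans
      (congrArg (fun f => f.1 ⟨r', hV hy⟩) hσ).symm
  refine ⟨⟨fun l => ⟨s l, hs_mem l⟩, fun a l h₀ r hr => ?_⟩, SAlg.sections_ext fun x => ?_⟩
  · obtain ⟨p, hp⟩ := hW hr
    obtain ⟨m, h, h', r, rfl, rfl⟩ := F.exists_le' i a p r hp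
    have hr' : r ∈ F.pre m W := (congrArg (· ∈ W) (F.map_res h' r)).mp hr
    refine ((F.isLocIso h').locMap_bijective r).1 ?_
    refine (F.locMap_res_comp h' h₀ r _ (s l ⟨_, F.specPoint_mem_pre (h'.trans h₀) hr'⟩)
      (apply_heq (s l) (F.specPoint_res_comp h' h₀ r) _ _)).trans ?_
    exact (hs' m l h (h'.trans h₀) r hr').trans (hs' m a h h' r hr').symm
  · obtain ⟨m, h, h', r, hr, hr'⟩ := F.exists_le' i i x.1 x.1 rfl
    obtain ⟨x, hx⟩ := x
    change specPoint (F.res h) r = x at hr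
    subst hr
    exact ((F.isLocIso h).locMap_bijective r).1
      (hs' m i h h r ((congrArg (· ∈ W) (F.map_res h r)).mp hx))

theorem isOpenImmersion_emb (i : F.ι) : PresheafedSpace.IsOpenImmersion (F.emb i) := by
  refine isOpenImmersion_of_pull _ (F.isOpenEmbedding i) fun W W' h hW => ?_
  obtain rfl : W' = F.pre i W := Opens.ext (Set.ext h)
  exact ⟨F.proj_injective i hW, F.proj_surjective i hW⟩

end AffineFamily

/-! ### The sheaf condition. -/

namespace SAlg

variable {k : Type u} [Field k]

/-- The sheaf condition for a presheaf of superalgebras. -/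
abbrev IsSheafOfSets (Z : PresheafedSpace.{u, u + 1, u} (SAlg k)) : Prop :=
  TopCat.Presheaf.IsSheaf (X := Z.carrier) (C := Type u) (Z.presheaf ⋙ SAlg.toType k)

theorem eq_of_resHom_eq {Z : PresheafedSpace.{u, u + 1, u} (SAlg k)} (hZ : IsSheafOfSets Z)
    {W : Opens Z} {s t : Z.presheaf.obj (op W)}
    (h : ∀ x ∈ W, ∃ (V : Opens Z) (hV : V ≤ W), x ∈ V ∧ resHom Z hV s = resHom Z hV t) :
    s = t := by
  choose V hV hx he using h
  refine TopCat.Sheaf.eq_of_locally_eq'.{u} (X := Z.carrier) (C := Type u)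
    ⟨Z.presheaf ⋙ SAlg.toType k, hZ⟩ (fun x : W => V x.1 x.2) W (fun x => homOfLE (hV x.1 x.2))
    (fun x hxW => Opens.mem_iSup.2 ⟨⟨x, hxW⟩, hx x hxW⟩) s t fun x => he x.1 x.2

theorem exists_resHom_eq {Z : PresheafedSpace.{u, u + 1, u} (SAlg k)} (hZ : IsSheafOfSets Z)
    {ι : Type u} (V : ι → Opens Z) (W : Opens Z) (hV : ∀ i, V i ≤ W)
    (hW : ∀ x ∈ W, ∃ i, x ∈ V i) (s : ∀ i, Z.presheaf.obj (op (V i)))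
    (hs : ∀ i j, resHom Z (inf_le_left : V i ⊓ V j ≤ V i) (s i) =
      resHom Z (inf_le_right : V i ⊓ V j ≤ V j) (s j)) :
    ∃ t : Z.presheaf.obj (op W), ∀ i, resHom Z (hV i) t = s i := by
  let s' : ∀ i, (Z.presheaf ⋙ SAlg.toType k).obj (op (V i)) := s
  have hs' : TopCat.Presheaf.IsCompatible.{u} (X := Z.carrier) (C := Type u)
    (Z.presheaf ⋙ SAlg.toType k) V s' := fun i j => hs i j
  obtain ⟨t, ht, -⟩ := TopCat.Sheaf.existsUnique_gluing'.{u} (X := Z.carrier) (C := Type u)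
    ⟨Z.presheaf ⋙ SAlg.toType k, hZ⟩ V W (fun i => homOfLE (hV i))
    (fun x hx => Opens.mem_iSup.2 (hW x hx)) s' hs'
  exact ⟨t, ht⟩

end SAlg

open SAlg

namespace AffineFamily

variable {k : Type u} [Field k] {X : TopCat.{u}} (F : AffineFamily k X)

/-- Gluing is done pointwise: at each point of each member the value is taken from some `U a` that
contains it, with no dependence on `a` by compatibility. Being locally a fraction and being
compatible are conditions near a point. -/
theorem isSheafOfSets : IsSheafOfSets F.space := by
  refine TopCat.Presheaf.isSheaf_of_isSheafUniqueGluing_types _ fun {ι} U s hs => ?_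
  have hc : ∀ a b l q (ha : q ∈ F.pre l (U a)) (hb : q ∈ F.pre l (U b)),
      (((s a : F.secSAlg (U a))).1 l).1 ⟨q, ha⟩ = (((s b : F.secSAlg (U b))).1 l).1 ⟨q, hb⟩ :=
    fun a b l q ha hb =>
      congrArg (fun t : F.secSAlg (U a ⊓ U b) => (t.1 l).1 ⟨q, ⟨ha, hb⟩⟩) (hs a b)
  have hU : ∀ l q, q ∈ F.pre l (iSup U) → ∃ a, q ∈ F.pre l (U a) := fun l q hq =>
    (Opens.mem_iSup (s := U) (x := F.map l q)).1 hq
  choose a ha using hU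
  let t : ∀ l (q : F.pre l (iSup U)), (F.alg l).Loc q.1 := fun l q =>
    ((s (a l q.1 q.2) : F.secSAlg _).1 l).1 ⟨q.1, ha l q.1 q.2⟩
  have ht : ∀ b l q (hq : q ∈ F.pre l (iSup U)) (hb : q ∈ F.pre l (U b)),
      t l ⟨q, hq⟩ = (((s b : F.secSAlg (U b))).1 l).1 ⟨q, hb⟩ := fun b l q hq hb =>
    hc _ b l q _ hb
  have hle : ∀ b, U b ≤ iSup U := le_iSup U
  refine ⟨⟨fun l => ⟨t l, ?_⟩, ?_⟩, ?_, ?_⟩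
  · rintro ⟨q, hq⟩
    obtain ⟨V, hqV, hV, c, u, h⟩ := sections_exists_frac
      ((s (a l q hq) : F.secSAlg _).1 l) (ha l q hq)
    refine ⟨V, hqV, homOfLE fun x hx => hle _ (hV hx), c, u, fun y => ?_⟩
    obtain ⟨hu, e⟩ := h y.1 y.2
    exact ⟨hu, (ht _ l y.1 _ (hV y.2)).trans e⟩
  · intro i j h r hr
    refine (congrArg (locMap (F.res h) r) (ht (a i r hr) j _ _
      (F.specPoint_mem_pre h (ha i r hr)))).trans ?_
    exact (s (a i r hr) : F.secSAlg _).2 i j h r (ha i r hr)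
  · intro b
    exact F.sections_ext fun l r hr => ht b l r (hle b hr) hr
  · intro t' ht'
    refine F.sections_ext fun l r hr => ?_
    exact congrArg (fun t : F.secSAlg (U (a l r hr)) => (t.1 l).1 ⟨r, ha l r hr⟩)
      (ht' (a l r hr))

theorem isSuperscheme : IsSuperscheme F.space where
  isSheaf := F.isSheafOfSets
  isLocalRing x := by
    obtain ⟨i, p, rfl⟩ := F.exists_map x
    have := F.isOpenImmersion_emb i
    exact isLocalRing_evenStalk (F.emb i) p
  exists_affine x := by
    obtain ⟨i, p, rfl⟩ := F.exists_map x
    have := F.isOpenImmersion_emb i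
    exact ⟨⟨_, (F.isOpenEmbedding i).isOpen_range⟩, ⟨p, rfl⟩,
      isAffineOpenSuper_of_isOpenImmersion (F.emb i) rfl⟩

end AffineFamily

/-! ### Uniqueness of the gluing of a family. -/

open SAlg

namespace AffineFamily

variable {k : Type u} [Field k] {X : TopCat.{u}} (F : AffineFamily k X)

/-- A sheaf of superalgebras on `X` with compatible open immersions of the members of the family. -/
structure IsGlued (S : TopCat.Presheaf (SAlg k) X)
    (e : ∀ i, (F.alg i).SSpec ⟶ (⟨X, S⟩ : PresheafedSpace.{u, u + 1, u} (SAlg k))) : Prop where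
  isSheaf : IsSheafOfSets (⟨X, S⟩ : PresheafedSpace.{u, u + 1, u} (SAlg k))
  isOpenImmersion : ∀ i, PresheafedSpace.IsOpenImmersion (e i)
  base_apply : ∀ i p, (e i).base p = F.map i p
  specMap_comp : ∀ {i j} (h : i ≤ j), specMap (F.res h) ≫ e j = e i

variable {F} {S S' : TopCat.Presheaf (SAlg k) X}
  {e : ∀ i, (F.alg i).SSpec ⟶ (⟨X, S⟩ : PresheafedSpace.{u, u + 1, u} (SAlg k))}
  {e' : ∀ i, (F.alg i).SSpec ⟶ (⟨X, S'⟩ : PresheafedSpace.{u, u + 1, u} (SAlg k))}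

theorem IsGlued.mem (he : F.IsGlued S e) {i : F.ι} {W : Opens X}
    {p : PrimeSpectrum (F.alg i).even} (hp : p ∈ F.pre i W) : (e i).base p ∈ W :=
  (congrArg (· ∈ W) (he.base_apply i p)).mpr hp

theorem IsGlued.pull_bijective (he : F.IsGlued S e) {i : F.ι} {W : Opens X}
    (hW : (W : Set X) ⊆ Set.range (F.map i)) :
    Function.Bijective (pull (e i) W (F.pre i W) fun _ hp => he.mem hp) := by
  have := he.isOpenImmersion i
  refine _root_.pull_bijective (e i) (W := W) (W' := F.pre i W) (fun p => ?_) ?_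
  · exact (congrArg (· ∈ W) (he.base_apply i p)).to_iff.symm
  · intro x hx
    obtain ⟨p, hp⟩ := hW hx
    exact ⟨p, (he.base_apply i p).trans hp⟩

/-- The part of `W` in the image of a member of the family. -/
def part (F : AffineFamily k X) (W : Opens X) (i : F.ι) : Opens X :=
  W ⊓ ⟨Set.range (F.map i), (F.isOpenEmbedding i).isOpen_range⟩

theorem IsGlued.eq_of_pull_eq (he : F.IsGlued S e) {W : Opens X} {s t : S.obj (op W)}
    (h : ∀ i, pull (e i) W (F.pre i W) (fun _ hp => he.mem hp) s =
      pull (e i) W (F.pre i W) (fun _ hp => he.mem hp) t) : s = t := by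
  refine eq_of_resHom_eq he.isSheaf (W := W) fun x hx => ?_
  obtain ⟨i, p, hp⟩ := F.exists_map x
  refine ⟨F.part W i, inf_le_left, ⟨hx, p, hp⟩, ?_⟩
  refine (he.pull_bijective (W := F.part W i) (i := i) fun _ hx => hx.2).1 ?_
  refine (pull_resHom (e i) _ _ s).trans (Eq.trans ?_ (pull_resHom (e i) _ _ t).symm)
  have h1 : F.pre i (F.part W i) ≤ F.pre i W := fun _ h => h.1
  refine (resHom_pull (e i) h1 (fun _ hp => he.mem hp) s).symm.trans
    (Eq.trans ?_ (resHom_pull (e i) h1 (fun _ hp => he.mem hp) t))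
  exact congrArg _ (h i)

theorem IsGlued.hom_ext (he : F.IsGlued S e) {Z : PresheafedSpace.{u, u + 1, u} (SAlg k)}
    {f g : (⟨X, S⟩ : PresheafedSpace.{u, u + 1, u} (SAlg k)) ⟶ Z} (hb : f.base = g.base)
    (h : ∀ i, e i ≫ f = e i ≫ g) : f = g := by
  refine hom_ext_of_pull hb fun W W' hf hg s => he.eq_of_pull_eq fun i => ?_
  refine (pull_comp (e i) f hf _ s).symm.trans (Eq.trans ?_ (pull_comp (e i) g hg _ s))
  exact pull_congr (h i) _ s

/-- The sections of a glued superscheme as compatible families. -/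
def IsGlued.toFamily (he : F.IsGlued S e) (W : Opens X) : S.obj (op W) ⟶ F.secSAlg W where
  toAlgHom := ((AlgHom.pi fun i =>
      pull (e i) W (F.pre i W) fun _ hp => he.mem hp).codRestrict (F.sections W) (by
    intro s i j h r hr
    have h1 : ∀ y ∈ F.pre i W, (specMap (F.res h)).base y ∈ F.pre j W := fun y hy =>
      F.specPoint_mem_pre h hy
    have h2 := pull_comp (specMap (F.res h)) (e j) (fun _ hp => he.mem hp) h1 s
    have h3 := pull_congr (he.specMap_comp h) (fun y hy => he.mem (h1 y hy)) s
    exact congrArg (fun t : (F.alg i).specSections (F.pre i W) => t.1 ⟨r, hr⟩)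
      (h2.symm.trans h3)))
  map_mem a s hs i := pull_map_mem (e i) W (F.pre i W) (fun _ hp => he.mem hp) hs

theorem IsGlued.toFamily_resHom (he : F.IsGlued S e) {W V : Opens X} (h : V ≤ W)
    (s : S.obj (op W)) : Hom.toAlgHom (he.toFamily V) (resHom ⟨X, S⟩ h s) =
      Hom.toAlgHom (F.secRes h) (Hom.toAlgHom (he.toFamily W) s) := by
  refine Subtype.ext (funext fun i => ?_)
  have h1 : F.pre i V ≤ F.pre i W := fun _ hx => h hx
  exact (pull_resHom (e i) h (fun _ hp => he.mem hp) s).trans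
    (resHom_pull (e i) h1 (fun _ hp => he.mem hp) s).symm

/-- Over the part of `W` inside one member, both kinds of sections are determined by the component
in that member, which gives local preimages. Injectivity makes them agree on overlaps, so the sheaf
condition glues them. -/
theorem IsGlued.toFamily_bijective (he : F.IsGlued S e) (W : Opens X) :
    Function.Bijective (Hom.toAlgHom (he.toFamily W)) := by
  have hinj : ∀ W, Function.Injective (Hom.toAlgHom (he.toFamily W)) := fun W s t h =>
    he.eq_of_pull_eq fun i => congrArg (fun t : F.secSAlg W => t.1 i) h
  refine ⟨hinj W, fun t => ?_⟩
  have hp : ∀ i, F.part W i ≤ W := fun i => inf_le_left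
  have key : ∀ i, ∃ s : S.obj (op (F.part W i)),
      Hom.toAlgHom (he.toFamily (F.part W i)) s = Hom.toAlgHom (F.secRes (hp i)) t := by
    intro i
    have hr : (F.part W i : Set X) ⊆ Set.range (F.map i) := fun _ hx => hx.2
    obtain ⟨s, hs⟩ := (he.pull_bijective hr).2
      ((Hom.toAlgHom (F.secRes (hp i)) t : F.secSAlg (F.part W i)).1 i)
    exact ⟨s, F.proj_injective i hr hs⟩
  choose s hs using key
  obtain ⟨s', hs'⟩ := exists_resHom_eq he.isSheaf (F.part W) W hp
    (fun x hx => by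
      obtain ⟨i, p, hp⟩ := F.exists_map x
      exact ⟨i, hx, p, hp⟩) s (fun i j => hinj _ (by
        rw [he.toFamily_resHom, he.toFamily_resHom, hs, hs]; rfl))
  refine ⟨s', F.sections_ext fun i r hr => ?_⟩
  have h1 := (he.toFamily_resHom (hp i) s').symm.trans ((congrArg _ (hs' i)).trans (hs i))
  exact congrArg (fun t : F.secSAlg (F.part W i) => (t.1 i).1 ⟨r, hr, r, rfl⟩) h1

/-- The canonical morphism between two gluings. -/
def IsGlued.desc (he : F.IsGlued S e) :
    F.space ⟶ (⟨X, S⟩ : PresheafedSpace.{u, u + 1, u} (SAlg k)) where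
  base := 𝟙 X
  c :=
    { app := fun W => he.toFamily W.unop
      naturality := fun _ _ h => SAlg.Hom.ext (AlgHom.ext fun s =>
        he.toFamily_resHom h.unop.le s) }

theorem IsGlued.isIso_desc (he : F.IsGlued S e) : IsIso he.desc := by
  have h1 : IsIso he.desc.base := inferInstanceAs (IsIso (𝟙 X))
  have h2 : IsIso he.desc.c := by
    have : ∀ W, IsIso (he.desc.c.app W) := fun W =>
      isIso_of_bijective _ (he.toFamily_bijective W.unop)
    exact NatIso.isIso_of_isIso_app _
  exact PresheafedSpace.isIso_of_components _

theorem IsGlued.emb_desc (he : F.IsGlued S e) (i : F.ι) : F.emb i ≫ he.desc = e i := by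
  refine hom_ext_of_pull ?_ fun W W' h h' s => ?_
  · exact TopCat.hom_ext (ContinuousMap.ext fun p => (he.base_apply i p).symm)
  · have h1 : W' ≤ F.pre i W := h
    exact resHom_pull (e i) h1 (fun _ hp => he.mem hp) s

/-- Two gluings of a family are isomorphic in a unique way. -/
theorem IsGlued.existsUnique_iso (he : F.IsGlued S e) (he' : F.IsGlued S' e') :
    ∃! h : (⟨X, S⟩ : PresheafedSpace.{u, u + 1, u} (SAlg k)) ≅ ⟨X, S'⟩,
      h.hom.base = 𝟙 X ∧ ∀ i, e i ≫ h.hom = e' i := by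
  have := he.isIso_desc
  have := he'.isIso_desc
  -- Both gluings are compared with the explicit one, `F.space`, through morphisms that are the
  -- identity on points.
  have hb : ((asIso he.desc).symm ≪≫ asIso he'.desc).hom.base = 𝟙 X := by
    have h1 : he.desc.base ≫ (inv he.desc).base = 𝟙 X := by
      rw [← PresheafedSpace.comp_base, IsIso.hom_inv_id]; rfl
    have h2 : (inv he.desc).base = 𝟙 X := (Category.id_comp _).symm.trans h1
    refine (PresheafedSpace.comp_base _ _).trans ?_
    refine (congrArg (· ≫ he'.desc.base) h2).trans ?_
    exact Category.id_comp _
  have hc : ∀ i, e i ≫ ((asIso he.desc).symm ≪≫ asIso he'.desc).hom = e' i := fun i => by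
    change e i ≫ inv he.desc ≫ he'.desc = e' i
    rw [← he.emb_desc i, Category.assoc, IsIso.hom_inv_id_assoc, he'.emb_desc]
  exact ⟨_, ⟨hb, hc⟩, fun g hg => Iso.ext
    (he.hom_ext (hg.1.trans hb.symm) fun i => (hg.2 i).trans (hc i).symm)⟩

end AffineFamily

/-! ### The superscheme `gr X`. -/

namespace SAlg

variable {k : Type u} [Field k]

theorem grMap_comp {A B C : SAlg k} (f : A ⟶ B) (g : B ⟶ C) :
    grMap f ≫ grMap g = grMap (f ≫ g) := by
  refine Hom.ext (AlgHom.ext fun x => ?_)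
  change grAlgHom g (grAlgHom f x) = grAlgHom (f ≫ g) x
  induction x using DirectSum.induction_on with
  | zero => simp
  | add x y hx hy => simp only [map_add, hx, hy]
  | of n a =>
    obtain ⟨a, rfl⟩ := A.symb_surjective n a
    simp only [grAlgHom_of]
    rfl

theorem comap_specPoint_grMap {A B : SAlg k} (f : A ⟶ B) (q : PrimeSpectrum B.gr.even) :
    PrimeSpectrum.comap A.evenToGr (specPoint (grMap f) q) =
      specPoint f (PrimeSpectrum.comap B.evenToGr q) := by
  refine PrimeSpectrum.ext (Ideal.ext fun a => ?_)
  change evenMap (grMap f) (A.evenToGr a) ∈ q.asIdeal ↔ B.evenToGr (evenMap f a) ∈ q.asIdeal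
  rw [evenToGr_grMap]

end SAlg

open SAlg

namespace Superscheme

variable {k : Type u} [Field k]

instance (X : Superscheme k) : Preorder X.AffineOpens where
  le V U := V.1 ≤ U.1
  le_refl _ := le_rfl
  le_trans _ _ _ h h' := le_trans (α := Opens X.carrier) h h'

theorem res_comp (X : Superscheme k) {U V W : X.AffineOpens} (h : U.1 ≤ V.1) (h' : V.1 ≤ W.1) :
    X.res h' ≫ X.res h = X.res (h.trans h') :=
  (X.presheaf.map_comp (homOfLE h').op (homOfLE h).op).symm

theorem exists_affineOpen_le (X : Superscheme k) {W : Opens X.carrier} {x : X.carrier}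
    (hx : x ∈ W) : ∃ V : X.AffineOpens, x ∈ V.1 ∧ V.1 ≤ W := by
  obtain ⟨V, hxV, hV, h⟩ := X.isSuperscheme.exists_affine_le hx
  exact ⟨⟨V, ⟨x, hxV⟩, h⟩, hxV, hV⟩

/-- A point of two affine open subsets lies in an affine open subset of their intersection. -/
theorem exists_affineOpen_le_inf (X : Superscheme k) {U V : X.AffineOpens} {x : X.carrier}
    (hU : x ∈ U.1) (hV : x ∈ V.1) : ∃ W : X.AffineOpens, x ∈ W.1 ∧ W ≤ U ∧ W ≤ V := by
  obtain ⟨W, hx, hW⟩ := X.exists_affineOpen_le (W := U.1 ⊓ V.1) ⟨hU, hV⟩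
  exact ⟨W, hx, hW.trans inf_le_left, hW.trans inf_le_right⟩

/-- The point of `X` that corresponds to a prime of `gr O(U)`. -/
def grChart (X : Superscheme k) (U : X.AffineOpens) :
    C(PrimeSpectrum (X.sec U).gr.even, X.carrier) :=
  (X.chart U).base.hom.comp ⟨PrimeSpectrum.comap (X.sec U).evenToGr, by fun_prop⟩

theorem isOpenEmbedding_grChart (hk : ringChar k ≠ 2) (X : Superscheme k) (U : X.AffineOpens) :
    Topology.IsOpenEmbedding (X.grChart U) :=
  (PresheafedSpace.IsOpenImmersion.base_open (f := X.chart U)).comp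
    (isHomeomorph_comap_evenToGr hk _).isOpenEmbedding

theorem range_grChart (hk : ringChar k ≠ 2) (X : Superscheme k) (U : X.AffineOpens) :
    Set.range (X.grChart U) = U.1 := by
  have h := (isHomeomorph_comap_evenToGr hk (X.sec U)).surjective
  exact (h.range_comp (X.chart U).base).trans (X.range_chart U)

/-- The family of the affine superschemes of the superalgebras `gr O(U)`. -/
def grFamily (hk : ringChar k ≠ 2) (X : Superscheme k) : AffineFamily k X.carrier where
  ι := X.AffineOpens
  alg U := (X.sec U).gr
  res h := grMap (X.res h)
  res_comp h h' := (grMap_comp _ _).trans (congrArg grMap (X.res_comp h h'))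
  map := X.grChart
  map_res h r := (congrArg (X.chart _).base (comap_specPoint_grMap (X.res h) r)).trans
    (X.chart_specPoint_res h _)
  isOpenEmbedding := X.isOpenEmbedding_grChart hk
  isLocIso h := (X.isLocIso_res h).grMap hk
  exists_le U V p q h := by
    have hU : X.grChart U p ∈ U.1 := (X.range_grChart hk U).le ⟨p, rfl⟩
    have hV : X.grChart U p ∈ V.1 := h ▸ (X.range_grChart hk V).le ⟨q, rfl⟩
    obtain ⟨W, hx, hWU, hWV⟩ := X.exists_affineOpen_le_inf hU hV
    obtain ⟨r, hr⟩ := (X.range_grChart hk W).ge hx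
    exact ⟨W, hWU, hWV, r, hr⟩
  exists_map x := by
    obtain ⟨W, hx, -⟩ := X.exists_affineOpen_le (W := ⊤) (x := x) trivial
    obtain ⟨r, hr⟩ := (X.range_grChart hk W).ge hx
    exact ⟨W, r, hr⟩

/-- The superscheme `gr X`. -/
def grGluing (hk : ringChar k ≠ 2) (X : Superscheme k) : X.GrGluing where
  sheaf := (X.grFamily hk).sheaf
  isSuperscheme := (X.grFamily hk).isSuperscheme
  emb := (X.grFamily hk).emb
  isOpenImmersion := (X.grFamily hk).isOpenImmersion_emb
  range_emb U := X.range_grChart hk U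
  comap_emb U q hq := (X.point_chart U (PrimeSpectrum.comap (X.sec U).evenToGr q) hq).symm
  specMap_emb U V h := (X.grFamily hk).specMap_emb (i := V) (j := U) h

/-- The condition `comap_emb` forces each embedding to be `grChart` on points, since the chart
inverts `point`. Every gluing is therefore one of the same family. -/
theorem GrGluing.isGlued (hk : ringChar k ≠ 2) {X : Superscheme k} (G : X.GrGluing) :
    (X.grFamily hk).IsGlued G.sheaf G.emb where
  isSheaf := G.isSuperscheme.isSheaf
  isOpenImmersion := G.isOpenImmersion
  base_apply U p := by
    have hp : (G.emb U).base p ∈ U.1 := (G.range_emb U).le ⟨p, rfl⟩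
    refine (X.chart_point U hp).symm.trans ?_
    exact congrArg (X.chart U).base (G.comap_emb U p hp).symm
  specMap_comp {V U} h := G.specMap_emb U V h

end Superscheme

/-! ### The affine schemes of `A / I_A` and their transition maps. -/

/-- A criterion for a ring map to induce an isomorphism of localizations at primes. -/
theorem Localization.localRingHom_bijective_of_exists {R S : Type*} [CommRing R] [CommRing S]
    (f : R →+* S) (q : Ideal S) [q.IsPrime]
    (h : ∀ x : S, ∃ (a s : R) (u : S), f s ∉ q ∧ u ∉ q ∧ u * (f s * x) = u * f a)
    (h' : ∀ (a : R) (u : S), u ∉ q → u * f a = 0 → ∃ v, f v ∉ q ∧ v * a = 0) :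
    Function.Bijective (Localization.localRingHom (q.comap f) q f rfl) := by
  constructor
  · rw [injective_iff_map_eq_zero]
    intro z hz
    obtain ⟨a, s, rfl⟩ := IsLocalization.exists_mk'_eq (q.comap f).primeCompl z
    rw [Localization.localRingHom_mk', IsLocalization.mk'_eq_zero_iff] at hz
    obtain ⟨u, hu⟩ := hz
    obtain ⟨v, hv, hv'⟩ := h' a u.1 u.2 hu
    exact (IsLocalization.mk'_eq_zero_iff a s).2 ⟨⟨v, hv⟩, hv'⟩
  · intro z
    obtain ⟨x, y, rfl⟩ := IsLocalization.exists_mk'_eq q.primeCompl z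
    obtain ⟨a, s, u, hs, hu, e⟩ := h x
    obtain ⟨b, t, v, ht, hv, e'⟩ := h y.1
    have hb : f b ∉ q := by
      intro hb
      have h1 : v * (f t * y.1) ∈ q := e' ▸ q.mul_mem_left v hb
      rcases Ideal.IsPrime.mem_or_mem ‹_› h1 with h1 | h1
      · exact hv h1
      · rcases Ideal.IsPrime.mem_or_mem ‹_› h1 with h1 | h1
        · exact ht h1
        · exact y.2 h1
    -- Locally `x = f a / f s` and `y = f b / f t`, so `x / y` is the image of `a t / (s b)`.
    refine ⟨IsLocalization.mk' _ (a * t) (⟨s, hs⟩ * ⟨b, hb⟩ : (q.comap f).primeCompl), ?_⟩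
    rw [Localization.localRingHom_mk', IsLocalization.mk'_eq_iff_eq, IsLocalization.eq_iff_exists
      q.primeCompl]
    refine ⟨⟨u, hu⟩ * ⟨v, hv⟩, ?_⟩
    simp only [Submonoid.coe_mul, map_mul]
    linear_combination (-(v * f t * y.1)) * e + (u * f s * x) * e'

namespace SAlg

variable {k : Type u} [Field k]

/-- Surjectivity is inherited from `f` modulo the odd ideals; injectivity is the case `n = 0` of
`IsLocIso.exists_smul_mem_filt_succ`. -/
theorem IsLocIso.localRingHom_assocMap_bijective {A B : SAlg k} {f : A ⟶ B} (hf : IsLocIso f)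
    (q : PrimeSpectrum B.Assoc) :
    Function.Bijective (Localization.localRingHom (q.asIdeal.comap (assocMap f)) q.asIdeal
      (assocMap f) rfl) := by
  let p : PrimeSpectrum B.even := PrimeSpectrum.comap B.evenToAssoc q
  refine Localization.localRingHom_bijective_of_exists (assocMap f) q.asIdeal (fun x => ?_)
    fun a u hu h => ?_
  · obtain ⟨b, rfl⟩ := Ideal.Quotient.mk_surjective x
    obtain ⟨a, s, u, hs, hu, e⟩ := hf.exists_frac p b
    exact ⟨Ideal.Quotient.mk _ a, A.evenToAssoc s, B.evenToAssoc u, hs, hu,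
      congrArg (Ideal.Quotient.mk B.oddIdeal) e⟩
  · obtain ⟨a, rfl⟩ := Ideal.Quotient.mk_surjective a
    obtain ⟨c, rfl⟩ := B.evenToAssoc_surjective u
    have h1 : c • Hom.toAlgHom f a ∈ B.filt (0 + 1) :=
      mem_filt_one.2 (Ideal.Quotient.eq_zero_iff_mem.1 h)
    obtain ⟨v, hv, hv'⟩ := hf.exists_smul_mem_filt_succ p ⟨a, mem_filt_zero a⟩ hu h1
    exact ⟨A.evenToAssoc v, hv, Ideal.Quotient.eq_zero_iff_mem.2 (mem_filt_one.1 hv')⟩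

/-- The homeomorphisms onto `Spec A₀` and `Spec B₀` turn this map into `specPoint f`. -/
theorem isOpenEmbedding_comap_assocMap (hk : ringChar k ≠ 2) {A B : SAlg k} {f : A ⟶ B}
    (ho : Topology.IsOpenEmbedding (specPoint f)) :
    Topology.IsOpenEmbedding (PrimeSpectrum.comap (assocMap f)) :=
  Topology.IsOpenEmbedding.of_comp (f := PrimeSpectrum.comap (assocMap f))
    (g := PrimeSpectrum.comap A.evenToAssoc) (isHomeomorph_comap_evenToAssoc hk A).isOpenEmbedding
    (ho.comp (isHomeomorph_comap_evenToAssoc hk B).isOpenEmbedding)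

/-- The morphism of affine schemes induced by a superalgebra map `A → B`. -/
abbrev specAssocMap {A B : SAlg k} (f : A ⟶ B) :
    Spec (CommRingCat.of B.Assoc) ⟶ Spec (CommRingCat.of A.Assoc) :=
  Spec.map (CommRingCat.ofHom (assocMap f))

theorem isOpenImmersion_specAssocMap (hk : ringChar k ≠ 2) {A B : SAlg k} {f : A ⟶ B}
    (hf : IsLocIso f) (ho : Topology.IsOpenEmbedding (specPoint f)) :
    IsOpenImmersion (specAssocMap f) := by
  have (q : Spec (CommRingCat.of B.Assoc)) : IsIso ((specAssocMap f).stalkMap q) := by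
    rw [← MorphismProperty.isomorphisms.iff,
      (MorphismProperty.isomorphisms CommRingCat).arrow_mk_iso_iff
        (Scheme.arrowStalkMapSpecIso (CommRingCat.ofHom (assocMap f)) q),
      MorphismProperty.isomorphisms.iff, ConcreteCategory.isIso_iff_bijective]
    exact hf.localRingHom_assocMap_bijective q
  exact IsOpenImmersion.of_isIso_stalkMap _ (isOpenEmbedding_comap_assocMap hk ho)

end SAlg

namespace SAlg

variable {k : Type u} [Field k]

theorem assocMap_comp {A B C : SAlg k} (f : A ⟶ B) (g : B ⟶ C) :
    assocMap (f ≫ g) = (assocMap g).comp (assocMap f) :=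
  Ideal.Quotient.ringHom_ext rfl

theorem assocMap_id (A : SAlg k) : assocMap (𝟙 A) = RingHom.id A.Assoc :=
  Ideal.Quotient.ringHom_ext rfl

theorem assocMap_algebraMap {A B : SAlg k} (f : A ⟶ B) (c : k) :
    assocMap f (algebraMap k A.Assoc c) = algebraMap k B.Assoc c :=
  congrArg (Ideal.Quotient.mk B.oddIdeal) ((Hom.toAlgHom f).commutes c)

theorem specAssocMap_comp {A B C : SAlg k} (f : A ⟶ B) (g : B ⟶ C) :
    specAssocMap (f ≫ g) = specAssocMap g ≫ specAssocMap f := by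
  rw [specAssocMap, assocMap_comp, CommRingCat.ofHom_comp, Spec.map_comp]

theorem specAssocMap_id (A : SAlg k) : specAssocMap (𝟙 A) = 𝟙 _ := by
  rw [specAssocMap, assocMap_id]
  exact Spec.map_id _

end SAlg

/-! ### The scheme associated with a superscheme. -/

open SAlg

namespace Superscheme

variable {k : Type u} [Field k]

/-- The point of `X` that corresponds to a prime of `O(U) / (O(U)₁)`. -/
def assocChart (X : Superscheme k) (U : X.AffineOpens) :
    C(PrimeSpectrum (X.sec U).Assoc, X.carrier) :=
  (X.chart U).base.hom.comp ⟨PrimeSpectrum.comap (X.sec U).evenToAssoc, by fun_prop⟩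

theorem isOpenEmbedding_assocChart (hk : ringChar k ≠ 2) (X : Superscheme k)
    (U : X.AffineOpens) : Topology.IsOpenEmbedding (X.assocChart U) :=
  (PresheafedSpace.IsOpenImmersion.base_open (f := X.chart U)).comp
    (isHomeomorph_comap_evenToAssoc hk _).isOpenEmbedding

theorem range_assocChart (hk : ringChar k ≠ 2) (X : Superscheme k) (U : X.AffineOpens) :
    Set.range (X.assocChart U) = U.1 := by
  have h := (isHomeomorph_comap_evenToAssoc hk (X.sec U)).surjective
  exact (h.range_comp (X.chart U).base).trans (X.range_chart U)

theorem assocChart_res (X : Superscheme k) {U V : X.AffineOpens} (h : V.1 ≤ U.1)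
    (q : PrimeSpectrum (X.sec V).Assoc) :
    X.assocChart U (PrimeSpectrum.comap (assocMap (X.res h)) q) = X.assocChart V q :=
  X.chart_specPoint_res h (PrimeSpectrum.comap (X.sec V).evenToAssoc q)

/-- This is the source of local directedness, both of the diagram of the affine pieces and of the
cover of a gluing by them. -/
theorem exists_assocChart_eq (hk : ringChar k ≠ 2) (X : Superscheme k) {U V : X.AffineOpens}
    {p : PrimeSpectrum (X.sec U).Assoc} {q : PrimeSpectrum (X.sec V).Assoc}
    (h : X.assocChart U p = X.assocChart V q) :
    ∃ (W : X.AffineOpens) (hU : W.1 ≤ U.1) (hV : W.1 ≤ V.1) (r : PrimeSpectrum (X.sec W).Assoc),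
      PrimeSpectrum.comap (assocMap (X.res hU)) r = p ∧
        PrimeSpectrum.comap (assocMap (X.res hV)) r = q := by
  have hU : X.assocChart U p ∈ U.1 := (X.range_assocChart hk U).le ⟨p, rfl⟩
  have hV : X.assocChart U p ∈ V.1 := h ▸ (X.range_assocChart hk V).le ⟨q, rfl⟩
  obtain ⟨W, hx, hWU, hWV⟩ := X.exists_affineOpen_le_inf hU hV
  obtain ⟨r, hr⟩ := (X.range_assocChart hk W).ge hx
  refine ⟨W, hWU, hWV, r, (X.isOpenEmbedding_assocChart hk U).injective ?_,
    (X.isOpenEmbedding_assocChart hk V).injective ?_⟩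
  · rw [X.assocChart_res, hr]
  · rw [X.assocChart_res, hr, h]

theorem exists_assocChart (hk : ringChar k ≠ 2) (X : Superscheme k) (x : X.carrier) :
    ∃ U q, X.assocChart U q = x := by
  obtain ⟨U, hx, -⟩ := X.exists_affineOpen_le (W := ⊤) (x := x) trivial
  obtain ⟨q, hq⟩ := (X.range_assocChart hk U).ge hx
  exact ⟨U, q, hq⟩

theorem res_self (X : Superscheme k) (U : X.AffineOpens) : X.res (le_refl U.1) = 𝟙 _ :=
  X.presheaf.map_id (op U.1)

/-- The diagram of the affine schemes of the algebras `O(U) / (O(U)₁)`. -/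
def assocDiagram (X : Superscheme k) : X.AffineOpens ⥤ Scheme.{u} where
  obj U := Spec (CommRingCat.of (X.sec U).Assoc)
  map h := specAssocMap (X.res h.le)
  map_id U := (congrArg specAssocMap (X.res_self U)).trans (specAssocMap_id _)
  map_comp h h' := (congrArg specAssocMap (X.res_comp h.le h'.le).symm).trans
    (specAssocMap_comp _ _)

/-- The structure morphisms of the affine schemes of the algebras `O(U) / (O(U)₁)`. -/
def assocStr (X : Superscheme k) (U : X.AffineOpens) :
    Spec (CommRingCat.of (X.sec U).Assoc) ⟶ Spec (CommRingCat.of k) :=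
  Spec.map (CommRingCat.ofHom (algebraMap k (X.sec U).Assoc))

theorem specAssocMap_assocStr (X : Superscheme k) {U V : X.AffineOpens} (h : V.1 ≤ U.1) :
    specAssocMap (X.res h) ≫ X.assocStr U = X.assocStr V := by
  rw [specAssocMap, assocStr, ← Spec.map_comp, ← CommRingCat.ofHom_comp]
  exact congrArg (fun f => Spec.map (CommRingCat.ofHom f))
    (RingHom.ext fun c => assocMap_algebraMap (X.res h) c)

theorem isOpenImmersion_assocDiagram_map (hk : ringChar k ≠ 2) (X : Superscheme k)
    {U V : X.AffineOpens} (h : U ⟶ V) : IsOpenImmersion (X.assocDiagram.map h) :=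
  isOpenImmersion_specAssocMap hk (X.isLocIso_res h.le) (X.isOpenEmbedding_specPoint_res h.le)

theorem isLocallyDirected_assocDiagram (hk : ringChar k ≠ 2) (X : Superscheme k) :
    (X.assocDiagram ⋙ Scheme.forget).IsLocallyDirected where
  cond {U V W} f g p q h := by
    have h : PrimeSpectrum.comap (assocMap (X.res f.le)) p =
      PrimeSpectrum.comap (assocMap (X.res g.le)) q := h
    have h' : X.assocChart U p = X.assocChart V q :=
      (X.assocChart_res f.le p).symm.trans ((congrArg (X.assocChart W) h).trans
        (X.assocChart_res g.le q))
    obtain ⟨W', hU, hV, r, h1, h2⟩ := X.exists_assocChart_eq hk h'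
    exact ⟨W', homOfLE hU, homOfLE hV, r, h1, h2⟩

theorem AssocGluing.homeo_emb {X : Superscheme k} (S : X.AssocGluing) (U : X.AffineOpens)
    (q : Spec (CommRingCat.of (X.sec U).Assoc)) : S.homeo (S.emb U q) = X.assocChart U q := by
  have hq : S.homeo (S.emb U q) ∈ U.1 := (S.range_emb U).le ⟨q, rfl⟩
  refine (X.chart_point U hq).symm.trans ?_
  exact congrArg (X.chart U).base (S.comap_emb U q hq).symm

theorem AssocGluing.exists_emb (hk : ringChar k ≠ 2) {X : Superscheme k} (S : X.AssocGluing)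
    (s : S.scheme) : ∃ U q, S.emb U q = s := by
  obtain ⟨U, q, h⟩ := X.exists_assocChart hk (S.homeo s)
  exact ⟨U, q, S.homeo.injective ((S.homeo_emb U q).trans h)⟩

theorem AssocGluing.exists_pullback_lift_eq (hk : ringChar k ≠ 2) {X : Superscheme k}
    (S : X.AssocGluing) (U V : X.AffineOpens)
    (x : ↥(Limits.pullback (S.emb U) (S.emb V))) : ∃ (W : X.AffineOpens) (hU : W ⟶ U) (hV : W ⟶ V)
      (r : Spec (CommRingCat.of (X.sec W).Assoc)),
      Limits.pullback.lift (X.assocDiagram.map hU) (X.assocDiagram.map hV)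
        ((S.specMap_emb _ _ hU.le).trans (S.specMap_emb _ _ hV.le).symm) r = x := by
  have hU := S.isOpenImmersion U
  have hV := S.isOpenImmersion V
  let p := Limits.pullback.fst (S.emb U) (S.emb V) x
  let q := Limits.pullback.snd (S.emb U) (S.emb V) x
  have h1 : S.emb U p = S.emb V q := by
    rw [← Scheme.Hom.comp_apply, ← Scheme.Hom.comp_apply, Limits.pullback.condition]
  obtain ⟨W, hWU, hWV, r, h2, h3⟩ := X.exists_assocChart_eq hk (U := U) (V := V) (p := p) (q := q)
    ((S.homeo_emb U p).symm.trans ((congrArg S.homeo h1).trans (S.homeo_emb V q)))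
  refine ⟨W, homOfLE hWU, homOfLE hWV, r, ?_⟩
  -- The first projection is an open immersion, so a point of the fibre product is determined by its
  -- first coordinate.
  refine (Limits.pullback.fst (S.emb U) (S.emb V)).isOpenEmbedding.injective ?_
  exact (congrArg (fun f => f r) (Limits.pullback.lift_fst (specAssocMap (X.res hWU))
    (specAssocMap (X.res hWV)) ((S.specMap_emb _ _ hWU).trans (S.specMap_emb _ _ hWV).symm))).trans h2

/-- The open cover of a gluing by its affine pieces. -/
def AssocGluing.cover (hk : ringChar k ≠ 2) {X : Superscheme k} (S : X.AssocGluing) :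
    S.scheme.OpenCover where
  I₀ := X.AffineOpens
  X U := Spec (CommRingCat.of (X.sec U).Assoc)
  f := S.emb
  mem₀ := by
    rw [Scheme.presieve₀_mem_precoverage_iff]
    exact ⟨S.exists_emb hk, S.isOpenImmersion⟩

instance (hk : ringChar k ≠ 2) {X : Superscheme k} (S : X.AssocGluing) :
    Preorder (S.cover hk).I₀ := inferInstanceAs (Preorder X.AffineOpens)

instance AssocGluing.locallyDirected_cover (hk : ringChar k ≠ 2) {X : Superscheme k}
    (S : X.AssocGluing) : (S.cover hk).LocallyDirected where
  trans h := X.assocDiagram.map h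
  trans_id U := X.assocDiagram.map_id U
  trans_comp h h' := X.assocDiagram.map_comp h h'
  w h := S.specMap_emb _ _ h.le
  directed {U V} x := S.exists_pullback_lift_eq hk U V x
  property_trans h := X.isOpenImmersion_assocDiagram_map hk h

theorem AssocGluing.hom_ext (hk : ringChar k ≠ 2) {X : Superscheme k} (S : X.AssocGluing)
    {Z : Scheme.{u}} {f g : S.scheme ⟶ Z} (h : ∀ U, S.emb U ≫ f = S.emb U ≫ g) : f = g :=
  (S.cover hk).hom_ext f g h

/-- The morphism from a gluing to a scheme given by compatible morphisms on the affine pieces. -/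
def AssocGluing.desc (hk : ringChar k ≠ 2) {X : Superscheme k} (S : X.AssocGluing)
    {Z : Scheme.{u}} (g : ∀ U, Spec (CommRingCat.of (X.sec U).Assoc) ⟶ Z)
    (h : ∀ (U V : X.AffineOpens) (h : V.1 ≤ U.1), specAssocMap (X.res h) ≫ g U = g V) :
    S.scheme ⟶ Z :=
  (S.cover hk).glueMorphismsOfLocallyDirected g fun i => h _ _ i.le

theorem AssocGluing.emb_desc (hk : ringChar k ≠ 2) {X : Superscheme k} (S : X.AssocGluing)
    {Z : Scheme.{u}} (g : ∀ U, Spec (CommRingCat.of (X.sec U).Assoc) ⟶ Z)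
    (h : ∀ (U V : X.AffineOpens) (h : V.1 ≤ U.1), specAssocMap (X.res h) ≫ g U = g V)
    (U : X.AffineOpens) : S.emb U ≫ S.desc hk g h = g U :=
  (S.cover hk).map_glueMorphismsOfLocallyDirected g (fun i => h _ _ i.le) U

theorem AssocGluing.existsUnique_iso (hk : ringChar k ≠ 2) {X : Superscheme k}
    (S S' : X.AssocGluing) : ∃! h : S.scheme ≅ S'.scheme,
      h.hom ≫ S'.str = S.str ∧ (∀ s : S.scheme, S'.homeo (h.hom s) = S.homeo s) ∧
        ∀ U : X.AffineOpens, S.emb U ≫ h.hom = S'.emb U := by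
  have h1 := S.emb_desc hk S'.emb S'.specMap_emb
  have h2 := S'.emb_desc hk S.emb S.specMap_emb
  refine ⟨⟨S.desc hk S'.emb S'.specMap_emb, S'.desc hk S.emb S.specMap_emb,
    S.hom_ext hk fun U => ?_, S'.hom_ext hk fun U => ?_⟩, ⟨?_, fun s => ?_, h1⟩, ?_⟩
  · rw [reassoc_of% h1 U, h2, Category.comp_id]
  · rw [reassoc_of% h2 U, h1, Category.comp_id]
  · refine S.hom_ext hk fun U => ?_
    rw [reassoc_of% h1 U, S.emb_str, S'.emb_str]
  · obtain ⟨U, q, rfl⟩ := S.exists_emb hk s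
    change S'.homeo (S.desc hk S'.emb S'.specMap_emb _) = _
    rw [← Scheme.Hom.comp_apply, h1, S.homeo_emb, S'.homeo_emb]
  · rintro g ⟨-, -, hg⟩
    exact Iso.ext (S.hom_ext hk fun U => (hg U).trans (h1 U).symm)

open Limits in
-- The colimit of a locally directed diagram of open immersions is covered by the pieces, and by
-- local directedness its points are those of `|X|`. Both the inclusions of the pieces and the
-- `assocChart` are open embeddings, so the bijection is a homeomorphism.
theorem exists_assocGluing (hk : ringChar k ≠ 2) (X : Superscheme k) : Nonempty X.AssocGluing := by
  have h1 := fun {U V : X.AffineOpens} (h : U ⟶ V) => X.isOpenImmersion_assocDiagram_map hk h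
  have h2 := X.isLocallyDirected_assocDiagram hk
  let ι := fun U : X.AffineOpens => colimit.ι X.assocDiagram U
  have hι : ∀ {U V : X.AffineOpens} (p : PrimeSpectrum (X.sec U).Assoc)
      (q : PrimeSpectrum (X.sec V).Assoc),
      ι U p = ι V q ↔ X.assocChart U p = X.assocChart V q := by
    intro U V p q
    refine (Scheme.IsLocallyDirected.ι_eq_ι_iff X.assocDiagram).trans ⟨?_, fun h => ?_⟩
    · rintro ⟨W, f, g, r, rfl, rfl⟩
      exact (X.assocChart_res f.le r).trans (X.assocChart_res g.le r).symm
    · obtain ⟨W, hU, hV, r, e1, e2⟩ := X.exists_assocChart_eq hk h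
      exact ⟨W, homOfLE hU, homOfLE hV, r, e1, e2⟩
  have hs := Scheme.IsLocallyDirected.ι_jointly_surjective X.assocDiagram
  choose i p hp using hs
  -- The map is defined through chosen representatives; by `hι` its value does not depend on them.
  let φ : ↥(colimit X.assocDiagram) → X.carrier := fun x => X.assocChart (i x) (p x)
  have hφ : ∀ U q, φ (ι U q) = X.assocChart U q := fun U q => (hι _ _).1 (hp (ι U q))
  have hφι : ∀ U, φ ∘ ι U = X.assocChart U := fun U => funext (hφ U)
  have hφ_bij : Function.Bijective φ := by
    constructor
    · intro x y h
      rw [← hp x, ← hp y]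
      exact (hι _ _).2 h
    · intro x
      obtain ⟨U, q, rfl⟩ := X.exists_assocChart hk x
      exact ⟨ι U q, hφ U q⟩
  have hφ_cont : Continuous φ := by
    refine continuous_iff_continuousAt.2 fun x => ?_
    rw [← hp x]
    refine ((ι (i x)).isOpenEmbedding.continuousAt_iff).1 ?_
    rw [hφι]
    exact (X.assocChart (i x)).continuous.continuousAt
  have hφ_open : IsOpenMap φ := by
    intro O hO
    have : φ '' O = ⋃ U, X.assocChart U '' (ι U ⁻¹' O) := by
      ext y
      simp only [Set.mem_image, Set.mem_iUnion]
      constructor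
      · rintro ⟨x, hx, rfl⟩
        exact ⟨i x, p x, (congrArg (· ∈ O) (hp x)).mpr hx, rfl⟩
      · rintro ⟨U, q, hq, rfl⟩
        exact ⟨_, hq, hφ U q⟩
    rw [this]
    exact isOpen_iUnion fun U => (X.isOpenEmbedding_assocChart hk U).isOpenMap _
      (hO.preimage (ι U).continuous)
  exact ⟨{
    scheme := colimit X.assocDiagram
    str := colimit.desc X.assocDiagram ⟨_, ⟨X.assocStr, fun U V h =>
      (X.specAssocMap_assocStr h.le).trans (Category.comp_id _).symm⟩⟩
    homeo := (Equiv.ofBijective φ hφ_bij).toHomeomorphOfContinuousOpen hφ_cont hφ_open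
    emb := ι
    emb_str := fun U => colimit.ι_desc _ U
    isOpenImmersion := fun U => inferInstanceAs (IsOpenImmersion (colimit.ι X.assocDiagram U))
    range_emb := fun U => (congrArg Set.range (hφι U)).trans (X.range_assocChart hk U)
    comap_emb := fun U q hq => by
      have h1 : φ (ι U q) = (X.chart U).base (PrimeSpectrum.comap (X.sec U).evenToAssoc q) :=
        hφ U q
      change _ = X.point U (φ (ι U q)) hq
      simp only [h1]
      exact (X.point_chart U _ _).symm
    specMap_emb := fun U V h => colimit.w X.assocDiagram (homOfLE h : V ⟶ U) }⟩

end Superscheme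

end

/-! ### Existence and uniqueness of both gluings. -/

theorem mainTheorem11 {k : Type u} [Field k] (hk : ringChar k ≠ 2) (X : Superscheme k) :
    (Nonempty X.GrGluing ∧
      ∀ G G' : X.GrGluing, ∃! h : G.space ≅ G'.space,
        h.hom.base = 𝟙 X.carrier ∧ ∀ U : X.AffineOpens, G.emb U ≫ h.hom = G'.emb U) ∧
    (Nonempty X.AssocGluing ∧
      ∀ S S' : X.AssocGluing, ∃! h : S.scheme ≅ S'.scheme,
        h.hom ≫ S'.str = S.str ∧ (∀ s : S.scheme, S'.homeo (h.hom s) = S.homeo s) ∧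
          ∀ U : X.AffineOpens, S.emb U ≫ h.hom = S'.emb U) := by
  refine ⟨⟨⟨X.grGluing hk⟩, fun G G' => ?_⟩, X.exists_assocGluing hk, fun S S' =>
    S.existsUnique_iso hk S'⟩
  exact (G.isGlued hk).existsUnique_iso (G'.isGlued hk)
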